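/- **Setting.** Let $0<R<r$, $a>0$, $d>R$, $k>0$, $M>0$ and let $N\ge 1$ be an integer. Put $\Omega=\{\mathbf x=(x,y,z)\in\mathbb R^3: |x|,|y|,|z|<R\}$ and $\Gamma=\{|x|,|y|<R,\ z=-R\}$. Let $H^3=H^3(\Omega;\mathbb C^N)$, identified with $H^3(\Omega;\mathbb R^{2N})$, be the real Hilbert space with $\|V\|^2=\sum_{|\beta|\le 3}\|D^\beta V\|_{L^2(\Omega)}^2$ and scalar product $(V,W)=\mathrm{Re}\sum_{|\beta|\le3}\int_\Omega D^\beta V\cdot\overline{D^\beta W}\,d\mathbf x$; $H^2$ is defined likewise. Let $H^3_0=\{h\in H^3: h|_{\partial\Omega}=0,\ \partial_z h|_\Gamma=0\}$, and, for given functions $\psi_0,\psi_1$, $$B(M)=\{V\in H^3:\ \|V\|<M,\ V|_{\partial\Omega}=\psi_0,\ \partial_zV|_\Gamma=\psi_1\},$$ boundary values being those of the continuous representatives on $\overline\Omega$ (recall $H^3\subset C^1(\overline\Omega)$); $\overline{B(M)}$ is the closure of $B(M)$ in $H^3$. Let $\Psi_0,\Psi_1,\dots$ be the Gram–Schmidt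 orthonormalization in $L^2(-a,a)$ of $\alpha^n e^\alpha$, $n=0,1,\dots$, and let $S_N=(s_{mn})_{m,n=0}^{N-1}$ with $s_{mn}=\int_{-a}^a\Psi_n'\Psi_m\,d\alpha$. With $\mathbf x_\alpha=(\alpha,0,-d)$ put $$\tilde{\mathbf x}_\alpha=\frac{ik(\mathbf x-\mathbf x_\alpha)}{|\mathbf x-\mathbf x_\alpha|}-\frac{\mathbf x-\mathbf x_\alpha}{|\mathbf x-\mathbf x_\alpha|^2},\qquad \widehat{\mathbf x}_\alpha=\partial_\alpha\tilde{\mathbf x}_\alpha .$$ For $V=(v_0,\dots,v_{N-1})\in H^3$ let $L(V)=\Delta V+S_N^{-1}f(\nabla V)$, where, for $0\le m\le N-1$ and with bilinear dot products, $$f_m(\nabla V)=2\sum_{n,l=0}^{N-1}\nabla v_n\cdot\nabla v_l\int_{-a}^a\Psi_m\Psi_n\Psi_l'\,d\alpha+2\sum_{n=0}^{N-1}\int_{-a}^a\Psi_m\Psi_n'\,\nabla v_n\cdot\tilde{\mathbf x}_\alpha\,d\alpha+2\sum_{n=0}^{N-1}\int_{-a}^a\Psi_m\Psi_n\,\widehat{\mathbf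 x}_\alpha\cdot\nabla v_n\,d\alpha .$$ For $\lambda,\gamma>0$ let $$J_{\lambda,\gamma}(V)=e^{-2\lambda(R+r)^2}\int_\Omega|L(V)|^2e^{2\lambda(z-r)^2}\,d\mathbf x+\gamma\|V\|^2 ,\qquad V\in H^3 .$$ Where $J_{\lambda,\gamma}$ is Fréchet differentiable, $J'_{\lambda,\gamma}(V)\in H^3_0$ denotes the element such that the Fréchet derivative of $J_{\lambda,\gamma}$ at $V$ in every direction $h\in H^3_0$ equals $(J'_{\lambda,\gamma}(V),h)$. **Theorem 5.3.** There is a number $\lambda_2>1$, depending only on $M,N,r,\Omega$ and on the fixed parameters $a,d,k$ of the problem (not on $\psi_0,\psi_1,\gamma$), such that the following holds for every $\lambda\ge\lambda_2$. 1. ($\lambda_2$ is a threshold for strict convexity.) There is $C>0$, independent of $\psi_0,\psi_1,\gamma$, such that for all $\psi_0,\psi_1$ and all $\gamma>0$ the functional $J_{\lambda,\gamma}$ is Fréchet differentiable at every point of $\overline{B(M)}$, and $$J_{\lambda,\gamma}(V_2)-J_{\lambda,\gamma}(V_1)-(J'_{\lambda,\gamma}(V_1),V_2-V_1)\ \ge\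 C\|V_2-V_1\|_{H^2}^2+\gamma\|V_2-V_1\|_{H^3}^2\qquad\text{for all }V_1,V_2\in\overline{B(M)} .$$ 2. For all $\psi_0,\psi_1$ for which $B(M)$ is nonempty, and for all $\gamma>0$, the functional $J_{\lambda,\gamma}$ has a unique minimizer $V_{\min,\lambda,\gamma}$ on $\overline{B(M)}$, and $$(J'_{\lambda,\gamma}(V_{\min,\lambda,\gamma}),\,V_{\min,\lambda,\gamma}-Q)\le 0\qquad\text{for all }Q\in\overline{B(M)} .$$ -/

import Mathlib

open MeasureTheory Set
open scoped ContDiff Matrix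

noncomputable section

namespace Convexification

/-! ### Geometry -/

/-- `ℝ³` with the Euclidean norm; the coordinates `0, 1, 2` are `x, y, z`. -/
abbrev E3 : Type := EuclideanSpace ℝ (Fin 3)

/-- `ℂᴺ`. As a real inner product space (with `Re ⟪·,·⟫`) it is `ℝ²ᴺ`. -/
abbrev CN (N : ℕ) : Type := EuclideanSpace ℂ (Fin N)

/-- The open cube `Ω = {|x|, |y|, |z| < R}`. -/
def cube (R : ℝ) : Set E3 := {x | ∀ i, |x i| < R}

/-- The lower face `Γ = {|x|, |y| < R, z = -R}` of the cube. -/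
def lowerFace (R : ℝ) : Set E3 := {x | |x 0| < R ∧ |x 1| < R ∧ x 2 = -R}

/-! ### The Sobolev space `H³(Ω; ℂᴺ)`, regarded as `H³(Ω; ℝ²ᴺ)` -/

/-- Multi-indices `β = (β₀, β₁, β₂)` of order `|β| = β₀ + β₁ + β₂ ≤ 3`. -/
abbrev MIdx : Type := {β : Fin 3 → Fin 4 // ∑ i, (β i : ℕ) ≤ 3}

/-- The order `|β|`. -/
def MIdx.order (β : MIdx) : ℕ := ∑ i, (β.1 i : ℕ)

/-- The multi-index `0`. -/
def MIdx.none : MIdx := ⟨fun _ => 0, by decide⟩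

/-- The multi-index of `∂ᵢ`. -/
def MIdx.first (i : Fin 3) : MIdx := ⟨Pi.single i 1, by revert i; decide⟩

/-- The multi-index of `∂ᵢ²`. -/
def MIdx.second (i : Fin 3) : MIdx := ⟨Pi.single i 2, by revert i; decide⟩

/-- The classical partial derivative `∂ᵢ φ`. -/
def pd (i : Fin 3) (φ : E3 → ℝ) : E3 → ℝ :=
  fun x => fderiv ℝ φ x (EuclideanSpace.single i 1)

/-- The classical derivative `D^β φ = ∂₀^β₀ ∂₁^β₁ ∂₂^β₂ φ`. -/
def multiDeriv (β : MIdx) (φ : E3 → ℝ) : E3 → ℝ :=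
  (pd 0)^[(β.1 0 : ℕ)] ((pd 1)^[(β.1 1 : ℕ)] ((pd 2)^[(β.1 2 : ℕ)] φ))

/-- `φ ∈ C_c^∞(Ω)`. -/
def IsTestFunction (Ω : Set E3) (φ : E3 → ℝ) : Prop :=
  ContDiff ℝ ∞ φ ∧ HasCompactSupport φ ∧ tsupport φ ⊆ Ω

theorem pd_smooth {φ : E3 → ℝ} (i : Fin 3) (h : ContDiff ℝ ∞ φ ∧ HasCompactSupport φ) :
    ContDiff ℝ ∞ (pd i φ) ∧ HasCompactSupport (pd i φ) := by
  constructor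
  · have h1 : ContDiff ℝ ∞ (fderiv ℝ φ) := h.1.fderiv_right (by simp)
    exact h1.clm_apply contDiff_const
  · exact h.2.fderiv_apply (𝕜 := ℝ) _

theorem pd_iterate_smooth {φ : E3 → ℝ} (i : Fin 3) (n : ℕ)
    (h : ContDiff ℝ ∞ φ ∧ HasCompactSupport φ) :
    ContDiff ℝ ∞ ((pd i)^[n] φ) ∧ HasCompactSupport ((pd i)^[n] φ) := by
  induction n with
  | zero => exact h
  | succ n ih => rw [Function.iterate_succ_apply']; exact pd_smooth i ih

theorem multiDeriv_smooth {φ : E3 → ℝ} (β : MIdx)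
    (h : ContDiff ℝ ∞ φ ∧ HasCompactSupport φ) :
    ContDiff ℝ ∞ (multiDeriv β φ) ∧ HasCompactSupport (multiDeriv β φ) :=
  pd_iterate_smooth _ _ (pd_iterate_smooth _ _ (pd_iterate_smooth _ _ h))

/-- `L²(Ω; ℂᴺ)` for the cube `Ω`. -/
abbrev L2 (R : ℝ) (N : ℕ) : Type := Lp (CN N) 2 (volume.restrict (cube R))

theorem integrable_test_smul {R : ℝ} {N : ℕ} {φ : E3 → ℝ}
    (h : ContDiff ℝ ∞ φ ∧ HasCompactSupport φ) (u : L2 R N) :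
    Integrable (fun x => φ x • u x) (volume.restrict (cube R)) := by
  have h1 : MemLp φ 2 (volume.restrict (cube R)) :=
    (h.1.continuous.memLp_of_hasCompactSupport h.2)
  have h2 := (Lp.memLp u).smul (r := 1) h1
  exact memLp_one_iff_integrable.1 h2

/-- `w` is the weak derivative `D^β u` of `u` in `Ω`. -/
def IsWeakDeriv {R : ℝ} {N : ℕ} (β : MIdx) (u w : L2 R N) : Prop :=
  ∀ φ : E3 → ℝ, IsTestFunction (cube R) φ →
    ∫ x in cube R, multiDeriv β φ x • u x
      = (-1 : ℝ) ^ β.order • ∫ x in cube R, φ x • w x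

/-- `H³(Ω; ℂᴺ)`, as the space of families `(D^β V)_{|β| ≤ 3}` of the weak derivatives in
`L²(Ω; ℂᴺ)` of a function `V = D^0 V`. The norm that it inherits is
`‖V‖² = ∑_{|β| ≤ 3} ‖D^β V‖²_{L²}`, and the (real) scalar product is
`(V, W) = Re ∑_{|β| ≤ 3} ∫_Ω D^β V ⬝ conj (D^β W)`. -/
def sobolevH3 (R : ℝ) (N : ℕ) : Submodule ℝ (PiLp 2 fun _ : MIdx => L2 R N) where
  carrier := {V | ∀ β, IsWeakDeriv β (V MIdx.none) (V β)}
  zero_mem' := by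
    intro β φ _
    have h0 : ∀ᵐ x ∂(volume.restrict (cube R)), (0 : L2 R N) x = 0 :=
      Lp.coeFn_zero (CN N) 2 (volume.restrict (cube R))
    have h1 : ∫ x in cube R, multiDeriv β φ x • (0 : L2 R N) x = 0 :=
      integral_eq_zero_of_ae (by filter_upwards [h0] with x hx; rw [hx, smul_zero, Pi.zero_apply])
    have h2 : ∫ x in cube R, φ x • (0 : L2 R N) x = 0 :=
      integral_eq_zero_of_ae (by filter_upwards [h0] with x hx; rw [hx, smul_zero, Pi.zero_apply])
    simp only [PiLp.zero_apply]
    rw [h1, h2, smul_zero]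
  add_mem' := by
    intro V W hV hW β φ hφ
    have key : ∀ (ψ : E3 → ℝ), ContDiff ℝ ∞ ψ ∧ HasCompactSupport ψ → ∀ u w : L2 R N,
        ∫ x in cube R, ψ x • (u + w) x
          = (∫ x in cube R, ψ x • u x) + ∫ x in cube R, ψ x • w x := by
      intro ψ hψ u w
      rw [← integral_add (integrable_test_smul hψ u) (integrable_test_smul hψ w)]
      refine integral_congr_ae ?_
      filter_upwards [Lp.coeFn_add u w] with x hx
      rw [hx, Pi.add_apply, smul_add]
    simp only [PiLp.add_apply]
    rw [key _ (multiDeriv_smooth β ⟨hφ.1, hφ.2.1⟩), key _ ⟨hφ.1, hφ.2.1⟩, hV β φ hφ,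
      hW β φ hφ, smul_add]
  smul_mem' := by
    intro c V hV β φ hφ
    have key : ∀ (ψ : E3 → ℝ) (u : L2 R N),
        ∫ x in cube R, ψ x • (c • u) x = c • ∫ x in cube R, ψ x • u x := by
      intro ψ u
      rw [← integral_smul]
      refine integral_congr_ae ?_
      filter_upwards [Lp.coeFn_smul c u] with x hx
      rw [hx, Pi.smul_apply, smul_comm]
    simp only [PiLp.smul_apply]
    rw [key, key, hV β φ hφ, smul_comm]

/-- The type of elements of `H³(Ω; ℂᴺ)`, a real inner product space. -/
abbrev H3 (R : ℝ) (N : ℕ) : Type := ↥(sobolevH3 R N)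

/-- The weak derivative `D^β V ∈ L²(Ω; ℂᴺ)` of `V ∈ H³(Ω; ℂᴺ)`. -/
def weakD {R : ℝ} {N : ℕ} (β : MIdx) (V : H3 R N) : L2 R N :=
  (V : PiLp 2 fun _ : MIdx => L2 R N) β

/-- The squared norm of `V` in `H²(Ω; ℂᴺ)`. -/
def normSqH2 {R : ℝ} {N : ℕ} (V : H3 R N) : ℝ :=
  ∑ β : MIdx, if β.order ≤ 2 then ‖weakD β V‖ ^ 2 else 0

/-- `u = ψ` on `S ⊆ closure Ω`, for a function `u` on `Ω` that has a continuous representative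
on `closure Ω` (as `V` and `∂ᵢ V` do for `V ∈ H³(Ω)`, since `H³(Ω) ⊂ C¹(closure Ω)`): the
representative takes the values `ψ` on `S`. -/
def HasBoundaryValues {R : ℝ} {N : ℕ} (u : L2 R N) (S : Set E3) (ψ : E3 → CN N) : Prop :=
  ∃ g : E3 → CN N, ContinuousOn g (closure (cube R)) ∧
    (∀ᵐ x ∂(volume.restrict (cube R)), u x = g x) ∧ ∀ x ∈ S, g x = ψ x

/-- The set of `V ∈ H³(Ω; ℂᴺ)` with `V = ψ₀` on `∂Ω` and `∂_z V = ψ₁` on `Γ`. -/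
def withBoundaryData (R : ℝ) (N : ℕ) (ψ₀ ψ₁ : E3 → CN N) : Set (H3 R N) :=
  {V | HasBoundaryValues (weakD MIdx.none V) (frontier (cube R)) ψ₀ ∧
    HasBoundaryValues (weakD (MIdx.first 2) V) (lowerFace R) ψ₁}

/-- The space `H₀³` of `h ∈ H³(Ω; ℂᴺ)` with `h = 0` on `∂Ω` and `∂_z h = 0` on `Γ`. -/
def H03 (R : ℝ) (N : ℕ) : Set (H3 R N) := withBoundaryData R N 0 0

/-- The set `B(M)` of `V ∈ H³` with `‖V‖ < M`, `V = ψ₀` on `∂Ω` and `∂_z V = ψ₁` on `Γ`. -/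
def ballB (R : ℝ) (N : ℕ) (M : ℝ) (ψ₀ ψ₁ : E3 → CN N) : Set (H3 R N) :=
  {V | ‖V‖ < M} ∩ withBoundaryData R N ψ₀ ψ₁

/-! ### The orthonormal basis of `L²(-a, a)` -/

/-- The Gram-Schmidt orthogonalization in `L²(-a, a)` of the functions `α ↦ αⁿ e^α`. -/
def orthoBasis (a : ℝ) (n : ℕ) : ℝ → ℝ := fun α =>
  α ^ n * Real.exp α - ∑ j : Fin n,
    (∫ t in (-a)..a, t ^ n * Real.exp t * orthoBasis a j t) /
      (∫ t in (-a)..a, orthoBasis a j t ^ 2) * orthoBasis a j α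
termination_by n
decreasing_by all_goals exact j.2

/-- The orthonormal functions `Ψₙ`. -/
def Psi (a : ℝ) (n : ℕ) : ℝ → ℝ := fun α =>
  orthoBasis a n α / √(∫ t in (-a)..a, orthoBasis a n t ^ 2)

/-- The matrix `S_N = (s_{mn})`, `s_{mn} = ⟨Ψₙ', Ψₘ⟩`. -/
def matS (a : ℝ) (N : ℕ) : Matrix (Fin N) (Fin N) ℝ :=
  Matrix.of fun m n => ∫ α in (-a)..a, deriv (Psi a n) α * Psi a m α

/-! ### The nonlinear elliptic operator -/

/-- The point source `x_α = (α, 0, -d)`. -/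
def source (d α : ℝ) : E3 := !₂[α, 0, -d]

/-- The vector `x̃_α = ∇ log u₀(x, α) = i k (x - x_α) / |x - x_α| - (x - x_α) / |x - x_α|²`. -/
def xTilde (k d α : ℝ) (x : E3) : Fin 3 → ℂ := fun i =>
  Complex.I * k * (x - source d α) i / ‖x - source d α‖
    - (x - source d α) i / (‖x - source d α‖ : ℂ) ^ 2

/-- The vector `x̂_α = ∂_α x̃_α`. -/
def xHat (k d α : ℝ) (x : E3) : Fin 3 → ℂ := fun i =>
  let ρ : ℝ := ‖x - source d α‖
  let A : Fin 3 → ℝ :=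
    ![-(x 1) ^ 2 - (x 2 + d) ^ 2, (x 0 - α) * x 1, (x 0 - α) * (x 2 + d)]
  let B : Fin 3 → ℝ :=
    ![(x 0 - α) ^ 2 - (x 1) ^ 2 - (x 2 + d) ^ 2, 2 * (x 0 - α) * x 1,
      2 * (x 0 - α) * (x 2 + d)]
  Complex.I * k / (ρ : ℂ) ^ 3 * A i - 1 / (ρ : ℂ) ^ 4 * B i

/-- The quadratic function `f = (f_m)` of the gradients `p n = ∇vₙ ∈ ℂ³` at the point `x`; the dot
products are bilinear (without conjugation). -/
def quadF (a d k : ℝ) (N : ℕ) (x : E3) (p : Fin N → Fin 3 → ℂ) : Fin N → ℂ := fun m =>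
  (2 * ∑ n : Fin N, ∑ l : Fin N,
      (p n ⬝ᵥ p l) * (∫ α in (-a)..a, (Psi a m α * Psi a n α * deriv (Psi a l) α : ℂ)))
    + (2 * ∑ n : Fin N, (∫ α in (-a)..a,
        (Psi a m α * deriv (Psi a n) α : ℂ) * (p n ⬝ᵥ xTilde k d α x)))
    + (2 * ∑ n : Fin N, (∫ α in (-a)..a,
        (Psi a m α * Psi a n α : ℂ) * (xHat k d α x ⬝ᵥ p n)))

/-- `K = S_N⁻¹ f`. -/
def termK (a d k : ℝ) (N : ℕ) (x : E3) (p : Fin N → Fin 3 → ℂ) : CN N :=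
  WithLp.toLp 2 (((matS a N)⁻¹.map Complex.ofReal) *ᵥ quadF a d k N x p)

/-- The operator `L(V)(x) = ΔV(x) + K(∇V(x))`. -/
def opL (a d k : ℝ) {R : ℝ} {N : ℕ} (V : H3 R N) (x : E3) : CN N :=
  (∑ i : Fin 3, weakD (MIdx.second i) V x)
    + termK a d k N x (fun n i => weakD (MIdx.first i) V x n)

/-! ### The weighted Tikhonov-like functional -/

/-- The Carleman weight `μ_λ(z) = exp(2 λ (z - r)²)`. -/
def carlemanWeight (lam r z : ℝ) : ℝ := Real.exp (2 * lam * (z - r) ^ 2)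

/-- The functional
`J_{λ,γ}(V) = exp(-2 λ (R + r)²) ∫_Ω |L(V)|² μ_λ(z) dx + γ ‖V‖²_{H³}`. -/
def functionalJ (r a d k lam γ : ℝ) {R : ℝ} {N : ℕ} (V : H3 R N) : ℝ :=
  Real.exp (-2 * lam * (R + r) ^ 2)
      * (∫ x in cube R, ‖opL a d k V x‖ ^ 2 * carlemanWeight lam r (x 2))
    + γ * ‖V‖ ^ 2

/-- `G = J'(V)`: the functional `J` is Fréchet differentiable at `V`, and `G` is the element of
`H₀³` that represents its derivative there, `J'(V) h = (G, h)` for all `h ∈ H₀³`. -/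
def IsGradientAt {R : ℝ} {N : ℕ} (J : H3 R N → ℝ) (V G : H3 R N) : Prop :=
  DifferentiableAt ℝ J V ∧ G ∈ H03 R N ∧ ∀ h ∈ H03 R N, inner ℝ G h = fderiv ℝ J V h

end Convexification

end

open Convexification

/-! The functional is a polynomial of degree four on a Hilbert space. Once the square root of the
normalized Carleman weight is absorbed into the operators, J(V) = ‖T V + Q(V, V)‖² + γ‖V‖², where T
: H³ → L² is linear, Q : H³ × H³ → L² is bilinear, and both are bounded (`exists_operator`,
`functionalJ_eq`). For Q this rests on the embedding of H² in L^∞, by which gradients of H³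
functions are bounded. The Taylor formula is therefore exact: with h = V₂ - V₁ and V = V₁, the gap
between J and its linearization is ‖T h + Q(V, h) + Q(h, V) + Q(h, h)‖² + 2⟨T V + Q(V, V), Q(h, h)⟩
+ γ‖h‖² (`quadratic_diff`).

It remains to show that for large λ the first two terms control the H² norm of h
(`exists_coercive`). The difference h lies in H³₀, so a Carleman estimate applies. Write μ for the
weight, A for the integral of |Δh|²μ and c₀ = exp(-2λ(R + r)²). Then λ∫|∇h|²μ and λ³∫|h|²μ are
bounded by multiples of A, and the second derivatives by a multiple of λA. In the first Taylor term
the integrand is |Δh + w|² with |w| ≤ C|∇h|, so this term is at least c₀(A/2 - Cλ⁻¹A). The second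
Taylor term contains ΔV, which lies in H¹ only and need not be bounded. The Sobolev inequality puts
ΔV in L⁶, and Hölder's inequality combined with the two Carleman estimates gives ∫|ΔV||∇h|²μ ≤
C‖V‖λ^(-1/2)A (`exists_trilinear`). Hence c₀A/4 survives once λ is large. The constants see V and h
only through ‖V‖ ≤ M and ‖h‖ ≤ 2M, so neither the boundary data nor γ enters.

For smooth functions the Carleman estimates follow from two pointwise identities that split the
weighted square of the Laplacian into squares, a divergence and further explicit terms (`div_fluxA`,
`div_fluxB`). They pass to Sobolev functions through smoothing operators whose kernels are reflected
in the faces of the cube. Differentiation exchanges odd and even reflection, so the smoothings of h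
vanish exactly on the boundary, converge in H², and have uniformly small normal derivative on the
lower face. That small flux disappears in the limit at fixed λ (`ZeroDataH2.exists_approx`). The
same operators, with even reflection, carry the Sobolev and Morrey inequalities from smooth
functions to weakly differentiable ones.

Finally, the term γ‖h‖² makes J strongly convex on the closed convex set in the H³ norm. Minimizing
sequences are then Cauchy, which gives existence and uniqueness, and the variational inequality is
the first order condition at a minimum over a convex set. -/

namespace Convexification

open Filter Topology

section

/-! ### Minimization of strongly convex functionals -/

/-- Strong convexity makes every minimizing sequence Cauchy, so completeness and continuity give the
minimizer without any weak compactness. -/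
theorem existsUnique_isMinOn_of_strongly_convex {H : Type*} [NormedAddCommGroup H]
    [InnerProductSpace ℝ H] [CompleteSpace H] {S : Set H} (hS : IsClosed S) (hconv : Convex ℝ S)
    (hne : S.Nonempty) {J : H → ℝ} (hJ : ∀ x, 0 ≤ J x) (hcont : Continuous J) {γ : ℝ}
    (hγ : 0 < γ)
    (hstrong : ∀ x ∈ S, ∃ G : H, ∀ y ∈ S,
      γ * ‖y - x‖ ^ 2 ≤ J y - J x - inner ℝ G (y - x)) :
    ∃! x, x ∈ S ∧ IsMinOn J S x := by
  set m := sInf (J '' S) with hm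
  have hbdd : BddBelow (J '' S) := ⟨0, by rintro _ ⟨x, -, rfl⟩; exact hJ x⟩
  have hmle : ∀ x ∈ S, m ≤ J x := fun x hx => csInf_le hbdd ⟨x, hx, rfl⟩
  -- The convexity inequality is used at the midpoint z of x and y. The gradient terms for x - z and
  -- y - z cancel, and each distance contributes γ‖x - y‖²/4.
  have key : ∀ x ∈ S, ∀ y ∈ S, γ / 2 * ‖x - y‖ ^ 2 ≤ (J x - m) + (J y - m) := by
    intro x hx y hy
    set z := (1 / 2 : ℝ) • x + (1 / 2 : ℝ) • y with hz
    have hzS : z ∈ S := hconv hx hy (by norm_num) (by norm_num) (by norm_num)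
    obtain ⟨G, hG⟩ := hstrong z hzS
    have h1 := hG x hx
    have h2 := hG y hy
    have e1 : x - z = (1 / 2 : ℝ) • (x - y) := by rw [hz]; module
    have e2 : y - z = -((1 / 2 : ℝ) • (x - y)) := by rw [hz]; module
    rw [e1, norm_smul] at h1
    rw [e2, norm_neg, norm_smul, inner_neg_right] at h2
    have := hmle z hzS
    norm_num [mul_pow] at h1 h2
    nlinarith
  have hex : ∀ n : ℕ, ∃ x ∈ S, J x < m + 1 / ((n : ℝ) + 1) := by
    intro n
    have : sInf (J '' S) < m + 1 / ((n : ℝ) + 1) := by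
      have : (0 : ℝ) < 1 / ((n : ℝ) + 1) := by positivity
      linarith
    obtain ⟨_, ⟨x, hx, rfl⟩, h⟩ := exists_lt_of_csInf_lt (hne.image J) this
    exact ⟨x, hx, h⟩
  choose x hxS hxJ using hex
  have hlim : Tendsto (fun n => J (x n)) atTop (𝓝 m) := by
    refine tendsto_of_tendsto_of_tendsto_of_le_of_le tendsto_const_nhds
      (h := fun n : ℕ => m + 1 / ((n : ℝ) + 1)) ?_ (fun n => hmle _ (hxS n)) fun n => (hxJ n).le
    simpa using (tendsto_const_nhds (x := m)).add (tendsto_one_div_add_atTop_nhds_zero_nat (𝕜 := ℝ))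
  have hcau : CauchySeq x := by
    rw [Metric.cauchySeq_iff]
    intro ε hε
    have h1 : (0 : ℝ) < γ / 4 * ε ^ 2 := by positivity
    obtain ⟨n0, hn0⟩ := (hlim.eventually_lt_const (show m < m + γ / 4 * ε ^ 2 by linarith)).exists_forall_of_atTop
    refine ⟨n0, fun a ha b hb => ?_⟩
    have h2 := key _ (hxS a) _ (hxS b)
    have h3 := hn0 a ha
    have h4 := hn0 b hb
    rw [dist_eq_norm]
    have h5 : ‖x a - x b‖ ^ 2 < ε ^ 2 := by
      by_contra hcon
      push Not at hcon
      nlinarith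
    exact lt_of_pow_lt_pow_left₀ 2 hε.le h5
  obtain ⟨v, hv⟩ := cauchySeq_tendsto_of_complete hcau
  have hvS : v ∈ S := hS.mem_of_tendsto hv (Eventually.of_forall hxS)
  have hvJ : J v = m := tendsto_nhds_unique ((hcont.tendsto v).comp hv) hlim
  refine ⟨v, ⟨hvS, fun y hy => by simpa [hvJ] using hmle y hy⟩, ?_⟩
  rintro y ⟨hyS, hy⟩
  have h1 : J y ≤ J v := hy hvS
  have h2 := key y hyS v hvS
  have h3 : ‖y - v‖ ^ 2 ≤ 0 := by
    have : 0 ≤ ‖y - v‖ ^ 2 := by positivity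
    nlinarith
  have h4 : ‖y - v‖ = 0 := by
    have := le_antisymm h3 (by positivity)
    simpa using this
  exact sub_eq_zero.1 (norm_eq_zero.1 h4)

theorem fderiv_nonneg_of_isMinOn_convex {H : Type*} [NormedAddCommGroup H] [NormedSpace ℝ H]
    {S : Set H} (hconv : Convex ℝ S) {J : H → ℝ} {x y : H} (hx : x ∈ S) (hy : y ∈ S)
    (hmin : IsMinOn J S x) (hJ : DifferentiableAt ℝ J x) : 0 ≤ fderiv ℝ J x (y - x) :=
  (hmin.localize).hasFDerivWithinAt_nonneg hJ.hasFDerivAt.hasFDerivWithinAt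
    (sub_mem_posTangentConeAt_of_segment_subset (hconv.segment_subset hx hy))

end

section

/-! ### The cube in coordinates and weak partial derivatives -/

/-- `ℝ³` as a product. -/
abbrev Coord : Type := Fin 3 → ℝ

/-- The open cube in coordinates. -/
def box (R : ℝ) : Set Coord := Set.pi univ fun _ => Ioo (-R) R

/-- The partial derivative of a function on `ℝ³`. -/
noncomputable def dd (i : Fin 3) (f : Coord → ℝ) : Coord → ℝ :=
  fun x => fderiv ℝ f x (Pi.single i 1)

/-- `w` is the weak partial derivative `∂ᵢ u` in the open cube. -/
def WeakPartial (R : ℝ) (i : Fin 3) (u w : Coord → ℝ) : Prop :=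
  ∀ φ : Coord → ℝ, ContDiff ℝ ∞ φ → HasCompactSupport φ → tsupport φ ⊆ box R →
    ∫ x in box R, dd i φ x * u x = -∫ x in box R, φ x * w x

/-- `w` is the weak partial derivative `∂ᵢ u`, tested against all smooth functions; this encodes
that `u` vanishes on the faces orthogonal to the `i`-th direction. -/
def StrongPartial (R : ℝ) (i : Fin 3) (u w : Coord → ℝ) : Prop :=
  ∀ φ : Coord → ℝ, ContDiff ℝ ∞ φ →
    ∫ x in box R, dd i φ x * u x = -∫ x in box R, φ x * w x

theorem mem_box {R : ℝ} {x : Coord} : x ∈ box R ↔ ∀ i, |x i| < R := by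
  simp [box, abs_lt]

theorem isOpen_box (R : ℝ) : IsOpen (box R) :=
  isOpen_set_pi finite_univ fun _ _ => isOpen_Ioo

theorem measurableSet_box (R : ℝ) : MeasurableSet (box R) := (isOpen_box R).measurableSet

theorem box_subset_Icc (R : ℝ) : box R ⊆ Icc (fun _ => -R) (fun _ => R) := fun _ hx =>
  ⟨fun i => (hx i trivial).1.le, fun i => (hx i trivial).2.le⟩

theorem volume_box_lt_top (R : ℝ) : volume (box R) < ⊤ :=
  lt_of_le_of_lt (measure_mono (box_subset_Icc R)) isCompact_Icc.measure_lt_top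

instance isFiniteMeasure_box (R : ℝ) : IsFiniteMeasure (volume.restrict (box R)) :=
  ⟨by simpa using volume_box_lt_top R⟩

theorem exists_bound_Icc {f : Coord → ℝ} (hf : Continuous f) (R : ℝ) :
    ∃ C, 0 < C ∧ ∀ x ∈ Icc (fun _ => -R : Coord) (fun _ => R), |f x| ≤ C := by
  obtain ⟨C, hC⟩ := (isCompact_Icc (a := (fun _ => -R : Coord)) (b := fun _ => R)).exists_bound_of_continuousOn
    hf.continuousOn
  exact ⟨max C 1, by positivity, fun x hx => (hC x hx).trans (le_max_left _ _)⟩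

theorem exists_bound_box {f : Coord → ℝ} (hf : Continuous f) (R : ℝ) :
    ∃ C, 0 < C ∧ ∀ x ∈ box R, |f x| ≤ C := by
  obtain ⟨C, hC, h⟩ := exists_bound_Icc hf R
  exact ⟨C, hC, fun x hx => h x (box_subset_Icc R hx)⟩

theorem integrableOn_box_mul {f u : Coord → ℝ} {R : ℝ} (hf : Continuous f)
    (hu : IntegrableOn u (box R)) : IntegrableOn (fun x => f x * u x) (box R) := by
  obtain ⟨C, -, hC⟩ := exists_bound_box hf R
  refine hu.bdd_mul hf.aestronglyMeasurable.restrict (c := C) ?_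
  filter_upwards [ae_restrict_mem (measurableSet_box R)] with x hx using hC x hx

theorem dd_eq_of_hasFDerivAt {f : Coord → ℝ} {f' : Coord →L[ℝ] ℝ} {x : Coord} (i : Fin 3)
    (h : HasFDerivAt f f' x) : dd i f x = f' (Pi.single i 1) := by rw [dd, h.fderiv]

theorem hasDerivAt_update_dd {f : Coord → ℝ} {x : Coord} (i : Fin 3)
    (hf : DifferentiableAt ℝ f x) :
    HasDerivAt (fun t => f (Function.update x i t)) (dd i f x) (x i) := by
  have h := hasDerivAt_update x i (x i)
  have h2 : HasFDerivAt f (fderiv ℝ f x) (Function.update x i (x i)) := by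
    simpa using hf.hasFDerivAt
  exact h2.comp_hasDerivAt _ h

theorem contDiff_dd {f : Coord → ℝ} (i : Fin 3) (hf : ContDiff ℝ ∞ f) : ContDiff ℝ ∞ (dd i f) := by
  have h1 : ContDiff ℝ ∞ (fderiv ℝ f) := hf.fderiv_right (by simp)
  exact h1.clm_apply contDiff_const

theorem dd_mul {f g : Coord → ℝ} (i : Fin 3) (hf : ContDiff ℝ ∞ f) (hg : ContDiff ℝ ∞ g)
    (x : Coord) : dd i (fun y => f y * g y) x = dd i f x * g x + f x * dd i g x := by
  have h1 := (hf.differentiable (by simp) x).hasFDerivAt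
  have h2 := (hg.differentiable (by simp) x).hasFDerivAt
  rw [show (fun y => f y * g y) = f * g from rfl, dd_eq_of_hasFDerivAt i (h1.mul h2)]
  simp [dd]
  ring

theorem fderiv_apply_eq_sum_dd {f : Coord → ℝ} {x v : Coord} :
    fderiv ℝ f x v = ∑ i, v i * dd i f x := by
  conv_lhs => rw [← Finset.univ_sum_single v, map_sum]
  refine Finset.sum_congr rfl fun i _ => ?_
  have : (Pi.single i (v i) : Coord) = v i • Pi.single i (1 : ℝ) := by
    rw [← Pi.single_smul]; simp
  rw [this, map_smul, smul_eq_mul, dd]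

/-! ### Products of functions of one variable -/

/-- The function `∏ⱼ aⱼ(xⱼ)`. -/
def prodFn (a : Fin 3 → ℝ → ℝ) : Coord → ℝ := fun x => ∏ j, a j (x j)

theorem contDiff_prodFn {a : Fin 3 → ℝ → ℝ} (ha : ∀ j, ContDiff ℝ ∞ (a j)) :
    ContDiff ℝ ∞ (prodFn a) :=
  contDiff_prod fun j _ => (ha j).comp (contDiff_apply ℝ ℝ j)

theorem prodFn_update (a : Fin 3 → ℝ → ℝ) (x : Coord) (i : Fin 3) (t : ℝ) :
    prodFn a (Function.update x i t) = a i t * ∏ j ∈ Finset.univ.erase i, a j (x j) := by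
  rw [prodFn, ← Finset.mul_prod_erase _ _ (Finset.mem_univ i)]
  congr 1
  · simp
  · refine Finset.prod_congr rfl fun j hj => ?_
    rw [Function.update_of_ne (Finset.ne_of_mem_erase hj)]

theorem prodFn_update_left (a : Fin 3 → ℝ → ℝ) (b : ℝ → ℝ) (x : Coord) (i : Fin 3) :
    prodFn (Function.update a i b) x = b (x i) * ∏ j ∈ Finset.univ.erase i, a j (x j) := by
  rw [prodFn, ← Finset.mul_prod_erase _ _ (Finset.mem_univ i)]
  congr 1
  · simp
  · refine Finset.prod_congr rfl fun j hj => ?_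
    rw [Function.update_of_ne (Finset.ne_of_mem_erase hj)]

theorem dd_prodFn {a : Fin 3 → ℝ → ℝ} (ha : ∀ j, ContDiff ℝ ∞ (a j)) (i : Fin 3) :
    dd i (prodFn a) = prodFn (Function.update a i (deriv (a i))) := by
  funext x
  have h1 := hasDerivAt_update_dd i ((contDiff_prodFn ha).differentiable (by simp) x)
  have h2 : HasDerivAt (fun t => prodFn a (Function.update x i t))
      (deriv (a i) (x i) * ∏ j ∈ Finset.univ.erase i, a j (x j)) (x i) := by
    simp_rw [prodFn_update]
    exact (((ha i).differentiable (by simp) (x i)).hasDerivAt).mul_const _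
  rw [h1.unique h2, prodFn_update_left]

theorem hasCompactSupport_prodFn {a : Fin 3 → ℝ → ℝ} {r : ℝ} (h : ∀ j t, r < |t| → a j t = 0) :
    HasCompactSupport (prodFn a) ∧ tsupport (prodFn a) ⊆ Icc (fun _ => -r) (fun _ => r) := by
  have h1 : tsupport (prodFn a) ⊆ Icc (fun _ => -r) (fun _ => r) := by
    refine closure_minimal (fun x hx => ?_) isClosed_Icc
    have : ∀ i, |x i| ≤ r := by
      intro i
      by_contra hc
      push Not at hc
      exact hx (Finset.prod_eq_zero (Finset.mem_univ i) (h i _ hc))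
    exact ⟨fun i => (abs_le.1 (this i)).1, fun i => (abs_le.1 (this i)).2⟩
  exact ⟨isCompact_Icc.of_isClosed_subset (isClosed_tsupport _) h1, h1⟩

theorem integral_abs_prodFn (a : Fin 3 → ℝ → ℝ) :
    ∫ x, |prodFn a x| = ∏ j, ∫ t, |a j t| := by
  simp_rw [prodFn, Finset.abs_prod]
  exact integral_fintype_prod_volume_eq_prod (fun j t => |a j t|)

/-! ### Cutoff functions -/

theorem exists_bound_deriv_smoothTransition :
    ∃ C, 0 < C ∧ ∀ t, |deriv Real.smoothTransition t| ≤ C := by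
  have hc : Continuous (deriv Real.smoothTransition) :=
    (Real.smoothTransition.contDiff (n := 1)).continuous_deriv (by simp)
  obtain ⟨C, hC⟩ := (isCompact_Icc (a := (-1 : ℝ)) (b := 2)).exists_bound_of_continuousOn
    hc.continuousOn
  refine ⟨max C 1, by positivity, fun t => ?_⟩
  by_cases ht : t ∈ Icc (-1 : ℝ) 2
  · exact (hC t ht).trans (le_max_left _ _)
  · have : deriv Real.smoothTransition t = 0 := by
      rw [mem_Icc, not_and_or, not_le, not_le] at ht
      rcases ht with ht | ht
      · have : Real.smoothTransition =ᶠ[𝓝 t] fun _ => 0 := by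
          filter_upwards [gt_mem_nhds ht] with s hs
          exact Real.smoothTransition.zero_of_nonpos (by linarith)
        simp [this.deriv_eq]
      · have : Real.smoothTransition =ᶠ[𝓝 t] fun _ => 1 := by
          filter_upwards [lt_mem_nhds ht] with s hs
          exact Real.smoothTransition.one_of_one_le (by linarith)
        simp [this.deriv_eq]
    rw [this, abs_zero]
    positivity

/-- A cutoff function of the interval `(-R, R)` with a transition zone of width `δ`. -/
structure IsCutoff (R C δ : ℝ) (χ : ℝ → ℝ) : Prop where
  smooth : ContDiff ℝ ∞ χ
  nonneg : ∀ t, 0 ≤ χ t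
  le_one : ∀ t, χ t ≤ 1
  eq_zero : ∀ t, R - δ < |t| → χ t = 0
  eq_one : ∀ t, |t| < R - 2 * δ → χ t = 1
  deriv_le : ∀ t, |deriv χ t| ≤ C / δ

/-- A product of two rescaled smooth steps, one for each endpoint. The constant C comes from the
slope of the unscaled step, hence depends on neither R nor δ. -/
theorem exists_isCutoff : ∃ C, 0 < C ∧ ∀ R δ : ℝ, 0 < δ → ∃ χ, IsCutoff R C δ χ := by
  obtain ⟨C, hC, hb⟩ := exists_bound_deriv_smoothTransition
  refine ⟨2 * C, by positivity, fun R δ hδ => ?_⟩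
  let S := Real.smoothTransition
  have hS : ∀ n : ℕ∞, ContDiff ℝ n S := fun n => Real.smoothTransition.contDiff
  have hd : ∀ t, HasDerivAt (fun t => S ((R - δ - t) / δ) * S ((R - δ + t) / δ))
      (deriv S ((R - δ - t) / δ) * (-1 / δ) * S ((R - δ + t) / δ)
        + S ((R - δ - t) / δ) * (deriv S ((R - δ + t) / δ) * (1 / δ))) t := by
    intro t
    have hS1 : ∀ s, HasDerivAt S (deriv S s) s := fun s =>
      ((hS 1).differentiable (by simp) s).hasDerivAt
    have e1 : HasDerivAt (fun t => (R - δ - t) / δ) (-1 / δ) t :=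
      ((hasDerivAt_id t).const_sub (R - δ)).div_const δ
    have e2 : HasDerivAt (fun t => (R - δ + t) / δ) (1 / δ) t :=
      ((hasDerivAt_id t).const_add (R - δ)).div_const δ
    exact ((hS1 _).comp t e1).mul ((hS1 _).comp t e2)
  have h0 : ∀ s, 0 ≤ S s := Real.smoothTransition.nonneg
  have h1 : ∀ s, S s ≤ 1 := Real.smoothTransition.le_one
  refine ⟨fun t => S ((R - δ - t) / δ) * S ((R - δ + t) / δ), ?_, ?_, ?_, ?_, ?_, ?_⟩
  · have hS' : ContDiff ℝ ∞ S := hS ⊤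
    exact (hS'.comp (by fun_prop)).mul (hS'.comp (by fun_prop))
  · exact fun t => mul_nonneg (h0 _) (h0 _)
  · exact fun t => mul_le_one₀ (h1 _) (h0 _) (h1 _)
  · intro t ht
    rcases lt_abs.1 ht with h | h
    · have : S ((R - δ - t) / δ) = 0 :=
        Real.smoothTransition.zero_of_nonpos (div_nonpos_of_nonpos_of_nonneg (by linarith) hδ.le)
      simp [this]
    · have : S ((R - δ + t) / δ) = 0 :=
        Real.smoothTransition.zero_of_nonpos (div_nonpos_of_nonpos_of_nonneg (by linarith) hδ.le)
      simp [this]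
  · intro t ht
    obtain ⟨ha, hb'⟩ := abs_lt.1 ht
    have e1 : S ((R - δ - t) / δ) = 1 :=
      Real.smoothTransition.one_of_one_le ((one_le_div hδ).2 (by linarith))
    have e2 : S ((R - δ + t) / δ) = 1 :=
      Real.smoothTransition.one_of_one_le ((one_le_div hδ).2 (by linarith))
    simp [e1, e2]
  · intro t
    rw [(hd t).deriv]
    have b1 := hb ((R - δ - t) / δ)
    have b2 := hb ((R - δ + t) / δ)
    have p1 : |deriv S ((R - δ - t) / δ) * (-1 / δ) * S ((R - δ + t) / δ)| ≤ C / δ := by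
      rw [abs_mul, abs_mul, abs_of_nonneg (h0 _), abs_div, abs_neg, abs_one, abs_of_pos hδ]
      calc _ ≤ C * (1 / δ) * 1 := by
            gcongr
            · exact h0 _
            · exact h1 _
        _ = C / δ := by ring
    have p2 : |S ((R - δ - t) / δ) * (deriv S ((R - δ + t) / δ) * (1 / δ))| ≤ C / δ := by
      rw [abs_mul, abs_mul, abs_of_nonneg (h0 _), abs_div, abs_one, abs_of_pos hδ]
      calc _ ≤ 1 * (C * (1 / δ)) := by
            gcongr
            exact h1 _
        _ = C / δ := by ring
    calc _ ≤ _ := abs_add_le _ _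
      _ ≤ C / δ + C / δ := add_le_add p1 p2
      _ = 2 * C / δ := by ring

namespace IsCutoff
variable {R C δ : ℝ} {χ : ℝ → ℝ}

theorem deriv_eq_zero (h : IsCutoff R C δ χ) {t : ℝ} (ht : |t| < R - 2 * δ) :
    deriv χ t = 0 := by
  have : χ =ᶠ[𝓝 t] fun _ => 1 := by
    filter_upwards [(continuous_abs.tendsto t).eventually_lt_const ht] with s hs
    exact h.eq_one s hs
  simp [this.deriv_eq]

theorem deriv_eq_zero' (h : IsCutoff R C δ χ) {t : ℝ} (ht : R - δ < |t|) :
    deriv χ t = 0 := by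
  have : χ =ᶠ[𝓝 t] fun _ => 0 := by
    filter_upwards [(continuous_abs.tendsto t).eventually_const_lt ht] with s hs
    exact h.eq_zero s hs
  simp [this.deriv_eq]

theorem integral_abs_le (h : IsCutoff R C δ χ) (hR : 0 < R) (hδ : 0 < δ) :
    ∫ t, |χ t| ≤ 2 * R := by
  have h1 : ∀ t, |χ t| ≤ (Icc (-R) R).indicator (fun _ => (1 : ℝ)) t := by
    intro t
    by_cases ht : t ∈ Icc (-R) R
    · rw [indicator_of_mem ht, abs_of_nonneg (h.nonneg t)]; exact h.le_one t
    · rw [indicator_of_notMem ht, h.eq_zero t, abs_zero]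
      rw [mem_Icc, ← abs_le, not_le] at ht
      linarith
  calc ∫ t, |χ t| ≤ ∫ t, (Icc (-R) R).indicator (fun _ => (1 : ℝ)) t := by
        refine integral_mono_of_nonneg (Eventually.of_forall fun t => abs_nonneg _) ?_
          (Eventually.of_forall h1)
        exact (integrable_indicator_iff measurableSet_Icc).2 (integrableOn_const (by simp))
    _ = 2 * R := by
        rw [integral_indicator measurableSet_Icc]
        simp [Measure.real]
        rw [ENNReal.toReal_ofReal (by linarith)]
        ring

/-- The slope is of order 1/δ, but it lives on two layers of total length at most 4δ, so the L¹ norm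
stays bounded as δ tends to zero. -/
theorem integral_abs_deriv_le (h : IsCutoff R C δ χ) (hC : 0 < C) (hδ : 0 < δ) :
    ∫ t, |deriv χ t| ≤ 4 * C := by
  set s := Icc (R - 2 * δ) R ∪ Icc (-R) (-(R - 2 * δ)) with hs
  have hsm : MeasurableSet s := measurableSet_Icc.union measurableSet_Icc
  have h1 : ∀ t, |deriv χ t| ≤ s.indicator (fun _ => C / δ) t := by
    intro t
    by_cases ht : t ∈ s
    · rw [indicator_of_mem ht]; exact h.deriv_le t
    · rw [indicator_of_notMem ht]
      refine le_of_eq (abs_eq_zero.2 ?_)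
      by_contra hne
      have ha : R - 2 * δ ≤ |t| := by
        by_contra hc; exact hne (h.deriv_eq_zero (not_le.1 hc))
      have hb : |t| ≤ R - δ := by
        by_contra hc; exact hne (h.deriv_eq_zero' (not_le.1 hc))
      refine ht ?_
      obtain ⟨hb1, hb2⟩ := abs_le.1 hb
      rcases le_abs.1 ha with h | h
      · exact Or.inl ⟨h, by linarith⟩
      · exact Or.inr ⟨by linarith, by linarith⟩
  have hvol : volume s ≤ ENNReal.ofReal (4 * δ) := by
    refine (measure_union_le _ _).trans ?_
    rw [Real.volume_Icc, Real.volume_Icc, ← ENNReal.ofReal_add (by linarith) (by linarith)]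
    exact ENNReal.ofReal_le_ofReal (by linarith)
  have hfin : volume s ≠ ⊤ := (hvol.trans_lt ENNReal.ofReal_lt_top).ne
  calc ∫ t, |deriv χ t| ≤ ∫ t, s.indicator (fun _ => C / δ) t := by
        refine integral_mono_of_nonneg (Eventually.of_forall fun t => abs_nonneg _) ?_
          (Eventually.of_forall h1)
        exact (integrable_indicator_iff hsm).2 (integrableOn_const hfin)
    _ = (volume s).toReal * (C / δ) := by
        rw [integral_indicator hsm]; simp [Measure.real]
    _ ≤ (4 * δ) * (C / δ) := by
        gcongr
        exact ENNReal.toReal_le_of_le_ofReal (by positivity) hvol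
    _ = 4 * C := by field_simp

end IsCutoff

end

section

/-! ### Integration by parts up to the boundary -/

/-- A sequence of cutoff functions whose transition zones shrink to the boundary. -/
theorem exists_cutoff_seq (R : ℝ) : ∃ (C : ℝ) (δ : ℕ → ℝ) (χ : ℕ → ℝ → ℝ),
    0 < C ∧ (∀ n, 0 < δ n) ∧ Tendsto δ atTop (𝓝 0) ∧ ∀ n, IsCutoff R C (δ n) (χ n) := by
  obtain ⟨C, hC, h⟩ := exists_isCutoff
  have hpos : ∀ n : ℕ, (0 : ℝ) < 1 / ((n : ℝ) + 1) := fun n => by positivity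
  choose χ hχ using fun n : ℕ => h R (1 / ((n : ℝ) + 1)) (hpos n)
  exact ⟨C, _, χ, hC, hpos, tendsto_one_div_add_atTop_nhds_zero_nat, hχ⟩

/-- The test function φ is multiplied by a cutoff θₙ tending to one. By dominated convergence every
term passes to the limit except the one with φ ∂ᵢθₙ u. Its decay is the only obstruction, and each
integration by parts below removes it by a different argument. -/
theorem WeakPartial.ibp_of_tendsto {R C : ℝ} {δ : ℕ → ℝ} {χ : ℕ → ℝ → ℝ}
    (hδ : ∀ n, 0 < δ n) (hδ0 : Tendsto δ atTop (𝓝 0)) (hχ : ∀ n, IsCutoff R C (δ n) (χ n))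
    {i : Fin 3} {u w : Coord → ℝ} (h : WeakPartial R i u w) (hu : IntegrableOn u (box R))
    (hw : IntegrableOn w (box R)) {φ : Coord → ℝ} (hφ : ContDiff ℝ ∞ φ)
    (hlim : Tendsto (fun n => ∫ x in box R, φ x * dd i (prodFn fun _ => χ n) x * u x)
      atTop (𝓝 0)) :
    ∫ x in box R, dd i φ x * u x = -∫ x in box R, φ x * w x := by
  set θ : ℕ → Coord → ℝ := fun n => prodFn fun _ => χ n with hθ
  have hθs : ∀ n, ContDiff ℝ ∞ (θ n) := fun n => contDiff_prodFn fun _ => (hχ n).smooth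
  have hθc := fun n => hasCompactSupport_prodFn (a := fun _ => χ n) (fun _ => (hχ n).eq_zero)
  have hθ1 : ∀ n x, |θ n x| ≤ 1 := by
    intro n x
    simp only [hθ, prodFn, Finset.abs_prod]
    refine Finset.prod_le_one (fun _ _ => abs_nonneg _) fun j _ => ?_
    rw [abs_of_nonneg ((hχ n).nonneg _)]
    exact (hχ n).le_one _
  have hθlim : ∀ x ∈ box R, Tendsto (fun n => θ n x) atTop (𝓝 1) := by
    intro x hx
    refine tendsto_const_nhds.congr' ?_
    have : ∀ j, ∀ᶠ n in atTop, |x j| < R - 2 * δ n := by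
      intro j
      have h1 : Tendsto (fun n => R - 2 * δ n) atTop (𝓝 (R - 2 * 0)) :=
        tendsto_const_nhds.sub (hδ0.const_mul 2)
      exact h1.eventually_const_lt (by simpa using mem_box.1 hx j)
    filter_upwards [eventually_all.2 this] with n hn
    simp [hθ, prodFn, (hχ n).eq_one _ (hn _)]
  have hkey : ∀ n, (∫ x in box R, θ n x * (dd i φ x * u x))
      + (∫ x in box R, φ x * dd i (θ n) x * u x) = -∫ x in box R, θ n x * (φ x * w x) := by
    intro n
    have hs := hφ.mul (hθs n)
    have ht : tsupport (fun x => φ x * θ n x) ⊆ box R := by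
      refine (tsupport_mul_subset_right (f := φ) (g := θ n)).trans ((hθc n).2.trans ?_)
      intro x hx
      rw [mem_box]
      intro j
      have := hδ n
      exact abs_lt.2 ⟨by linarith [hx.1 j], by linarith [hx.2 j]⟩
    have := h _ hs ((hθc n).1.mul_left) ht
    simp_rw [dd_mul i hφ (hθs n)] at this
    rw [← integral_add]
    · rw [← integral_neg] at this ⊢
      convert this using 2
      · funext x; ring_nf
      · funext x; ring_nf
    · exact integrableOn_box_mul (hθs n).continuous
        (integrableOn_box_mul (contDiff_dd i hφ).continuous hu)
    · exact integrableOn_box_mul (hφ.continuous.mul (contDiff_dd i (hθs n)).continuous) hu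
  have hdct : ∀ v : Coord → ℝ, IntegrableOn v (box R) →
      Tendsto (fun n => ∫ x in box R, θ n x * v x) atTop (𝓝 (∫ x in box R, v x)) := by
    intro v hv
    refine tendsto_integral_of_dominated_convergence (fun x => |v x|)
      (fun n => (hθs n).continuous.aestronglyMeasurable.mul hv.aestronglyMeasurable) hv.abs ?_ ?_
    · refine fun n => Eventually.of_forall fun x => ?_
      rw [Real.norm_eq_abs, abs_mul]
      exact mul_le_of_le_one_left (abs_nonneg _) (hθ1 n x)
    · filter_upwards [ae_restrict_mem (measurableSet_box R)] with x hx
      simpa using (hθlim x hx).mul_const (v x)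
  have l1 := (hdct _ (integrableOn_box_mul (contDiff_dd i hφ).continuous hu)).add hlim
  have l2 := (hdct _ (integrableOn_box_mul hφ.continuous hw)).neg
  rw [add_zero] at l1
  exact tendsto_nhds_unique (l1.congr hkey) l2

theorem mem_Icc_update {R : ℝ} {x : Coord} (hx : x ∈ Icc (fun _ => -R : Coord) fun _ => R)
    (i : Fin 3) {t : ℝ} (ht : |t| ≤ R) :
    Function.update x i t ∈ Icc (fun _ => -R : Coord) fun _ => R := by
  obtain ⟨h1, h2⟩ := abs_le.1 ht
  constructor
  · intro j
    by_cases hj : j = i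
    · subst hj; simpa using h1
    · simpa [hj] using hx.1 j
  · intro j
    by_cases hj : j = i
    · subst hj; simpa using h2
    · simpa [hj] using hx.2 j

/-- The projection of a point of the cube onto the nearest face orthogonal to the `i`-th
direction. -/
theorem exists_face_point {R : ℝ} {x : Coord}
    (hx : x ∈ Icc (fun _ => -R : Coord) fun _ => R) (i : Fin 3) :
    ∃ y ∈ Icc (fun _ => -R : Coord) fun _ => R, |y i| = R ∧ dist x y = R - |x i| := by
  have hR : 0 ≤ R := by have := hx.1 i; have := hx.2 i; simp at *; linarith
  have hxi : |x i| ≤ R := abs_le.2 ⟨hx.1 i, hx.2 i⟩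
  set s : ℝ := if 0 ≤ x i then R else -R with hs
  have hsa : |s| = R := by
    rw [hs]; split_ifs <;> simp [abs_of_nonneg hR]
  refine ⟨Function.update x i s, mem_Icc_update hx i hsa.le, by simpa using hsa, ?_⟩
  have hd : |x i - s| = R - |x i| := by
    rw [hs]
    split_ifs with h
    · rw [abs_of_nonneg h] at hxi ⊢
      rw [abs_of_nonpos (by linarith)]; ring
    · rw [abs_of_neg (not_le.1 h)] at hxi ⊢
      rw [abs_of_nonneg (by linarith)]; ring
  rw [← hd]
  apply le_antisymm
  · refine (dist_pi_le_iff (abs_nonneg _)).2 fun j => ?_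
    by_cases hj : j = i
    · subst hj; simp [Real.dist_eq]
    · simp [hj]
  · have := dist_le_pi_dist x (Function.update x i s) i
    simpa [Real.dist_eq] using this

/-- A weak derivative can be tested against smooth functions that vanish on the faces orthogonal to
the direction of differentiation. -/
theorem WeakPartial.integral_eq_of_vanishing {R : ℝ} (hR : 0 < R) {i : Fin 3}
    {u w : Coord → ℝ} (h : WeakPartial R i u w) (hu : IntegrableOn u (box R))
    (hw : IntegrableOn w (box R)) {φ : Coord → ℝ} (hφ : ContDiff ℝ ∞ φ)
    (hφ0 : ∀ x ∈ Icc (fun _ => -R : Coord) (fun _ => R), |x i| = R → φ x = 0) :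
    ∫ x in box R, dd i φ x * u x = -∫ x in box R, φ x * w x := by
  obtain ⟨C, δ, χ, hC, hδ, hδ0, hχ⟩ := exists_cutoff_seq R
  refine h.ibp_of_tendsto hδ hδ0 hχ hu hw hφ ?_
  obtain ⟨K, hK⟩ : ∃ K, ∀ x ∈ Icc (fun _ => -R : Coord) (fun _ => R), ‖fderiv ℝ φ x‖ ≤ K :=
    isCompact_Icc.exists_bound_of_continuousOn (hφ.continuous_fderiv (by simp)).continuousOn
  have hK0 : 0 ≤ K := (norm_nonneg _).trans (hK 0 ⟨fun _ => by simp [hR.le], fun _ => by simp [hR.le]⟩)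
  -- Mean value inequality on the segment to the nearest point of a face orthogonal to direction i,
  -- where φ vanishes.
  have hφb : ∀ x ∈ box R, |φ x| ≤ K * (R - |x i|) := by
    intro x hx
    have hx' := box_subset_Icc R hx
    obtain ⟨y, hy, hyi, hd⟩ := exists_face_point hx' i
    have := (convex_Icc (fun _ => -R : Coord) (fun _ => R)).norm_image_sub_le_of_norm_fderiv_le
      (fun z _ => hφ.differentiable (by simp) z) hK hy hx'
    rwa [hφ0 y hy hyi, sub_zero, ← dist_eq_norm, hd, Real.norm_eq_abs] at this
  have hdd : ∀ n x, dd i (prodFn fun _ => χ n) x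
      = deriv (χ n) (x i) * ∏ j ∈ Finset.univ.erase i, χ n (x j) := by
    intro n x
    rw [dd_prodFn fun _ => (hχ n).smooth, prodFn_update_left]
  have hprod : ∀ n (x : Coord), |∏ j ∈ Finset.univ.erase i, χ n (x j)| ≤ 1 := by
    intro n x
    rw [Finset.abs_prod]
    refine Finset.prod_le_one (fun _ _ => abs_nonneg _) fun j _ => ?_
    rw [abs_of_nonneg ((hχ n).nonneg _)]
    exact (hχ n).le_one _
  rw [show (0 : ℝ) = ∫ x in box R, (0 : ℝ) by simp]
  refine tendsto_integral_of_dominated_convergence (fun x => 2 * K * C * |u x|) ?_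
    (hu.abs.const_mul _) ?_ ?_
  · exact fun n => (hφ.continuous.mul (contDiff_dd i
      (contDiff_prodFn fun _ => (hχ n).smooth)).continuous).aestronglyMeasurable.mul
      hu.aestronglyMeasurable
  · intro n
    filter_upwards [ae_restrict_mem (measurableSet_box R)] with x hx
    rw [Real.norm_eq_abs, abs_mul]
    refine mul_le_mul_of_nonneg_right ?_ (abs_nonneg _)
    rw [hdd, abs_mul, abs_mul]
    have hp := hδ n
    by_cases hxi : |x i| < R - 2 * δ n
    · rw [(hχ n).deriv_eq_zero hxi]; simp; positivity
    · push Not at hxi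
      -- In the transition layer φ is at most 2Kδ, which cancels the slope C/δ. The resulting bound
      -- is uniform in n and serves as dominating constant.
      calc |φ x| * (|deriv (χ n) (x i)| * |∏ j ∈ Finset.univ.erase i, χ n (x j)|)
          ≤ (K * (2 * δ n)) * ((C / δ n) * 1) := by
            gcongr
            · exact (hφb x hx).trans (by gcongr; linarith)
            · exact (hχ n).deriv_le _
            · exact hprod n x
        _ = 2 * K * C := by field_simp
  · filter_upwards [ae_restrict_mem (measurableSet_box R)] with x hx
    refine tendsto_const_nhds.congr' ?_
    have h1 : Tendsto (fun n => R - 2 * δ n) atTop (𝓝 (R - 2 * 0)) :=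
      tendsto_const_nhds.sub (hδ0.const_mul 2)
    filter_upwards [h1.eventually_const_lt (show |x i| < _ by simpa using mem_box.1 hx i)] with n hn
    simp [hdd, (hχ n).deriv_eq_zero hn]

/-- `u` has a continuous representative on the closed cube that vanishes on the boundary. -/
def ZeroBoundary (R : ℝ) (u : Coord → ℝ) : Prop :=
  ∃ g : Coord → ℝ, ContinuousOn g (Icc (fun _ => -R) fun _ => R) ∧
    (∀ᵐ x ∂(volume.restrict (box R)), u x = g x) ∧
    ∀ x ∈ Icc (fun _ => -R : Coord) (fun _ => R), (∃ i, |x i| = R) → g x = 0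

/-- Functions vanishing on the boundary do not see bounded masses concentrating there. -/
theorem ZeroBoundary.tendsto_integral {R : ℝ} {u : Coord → ℝ} (hu : ZeroBoundary R u)
    {δ : ℕ → ℝ} (hδ0 : Tendsto δ atTop (𝓝 0)) {k : ℕ → Coord → ℝ} {K : ℝ} (i : Fin 3)
    (hk : ∀ n, Integrable (k n)) (hK : ∀ n, ∫ x, |k n x| ≤ K)
    (hk0 : ∀ n, ∀ x ∈ box R, |x i| < R - 2 * δ n → k n x = 0) :
    Tendsto (fun n => ∫ x in box R, k n x * u x) atTop (𝓝 0) := by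
  obtain ⟨g, hg, hug, hg0⟩ := hu
  have huc := isCompact_Icc.uniformContinuousOn_of_continuous hg
  rw [Metric.uniformContinuousOn_iff] at huc
  rw [Metric.tendsto_atTop]
  intro ε hε
  have hKpos : 0 ≤ K := (integral_nonneg fun _ => abs_nonneg _).trans (hK 0)
  -- K + 1 instead of K allows K = 0. Below, δₙ < τ/2 is required because the layer has width 2δₙ.
  obtain ⟨τ, hτ, huc⟩ := huc (ε / (K + 1)) (by positivity)
  obtain ⟨n0, hn0⟩ := (hδ0.eventually_lt_const (show (0 : ℝ) < τ / 2 by positivity)).exists_forall_of_atTop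
  refine ⟨n0, fun n hn => ?_⟩
  have hδn := hn0 n hn
  have hb : ∀ x ∈ box R, |k n x * g x| ≤ |k n x| * (ε / (K + 1)) := by
    intro x hx
    rw [abs_mul]
    by_cases hxi : |x i| < R - 2 * δ n
    · simp [hk0 n x hx hxi]
    · push Not at hxi
      refine mul_le_mul_of_nonneg_left ?_ (abs_nonneg _)
      obtain ⟨y, hy, hyi, hd⟩ := exists_face_point (box_subset_Icc R hx) i
      have := huc x (box_subset_Icc R hx) y hy (by rw [hd]; linarith)
      rw [hg0 y hy ⟨i, hyi⟩, dist_zero_right] at this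
      exact this.le
  rw [dist_zero_right]
  have e1 : ∫ x in box R, k n x * u x = ∫ x in box R, k n x * g x := by
    refine integral_congr_ae ?_
    filter_upwards [hug] with x hx using by rw [hx]
  rw [e1]
  calc ‖∫ x in box R, k n x * g x‖ ≤ ∫ x in box R, |k n x| * (ε / (K + 1)) := by
        refine norm_integral_le_of_norm_le ((hk n).abs.mul_const _).integrableOn ?_
        filter_upwards [ae_restrict_mem (measurableSet_box R)] with x hx using hb x hx
    _ = (∫ x in box R, |k n x|) * (ε / (K + 1)) := integral_mul_const _ _
    _ ≤ K * (ε / (K + 1)) := by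
        refine mul_le_mul_of_nonneg_right (le_trans ?_ (hK n)) (by positivity)
        exact setIntegral_le_integral (hk n).abs (Eventually.of_forall fun _ => abs_nonneg _)
    _ < ε := by
        rw [← mul_div_assoc, div_lt_iff₀ (by positivity)]
        nlinarith

theorem integrable_prodFn_of_isCutoff {R C δ : ℝ} {χ : ℝ → ℝ} (h : IsCutoff R C δ χ) :
    ∀ a : Fin 3 → ℝ → ℝ, (∀ j, a j = χ ∨ a j = deriv χ) →
      (∀ j, ContDiff ℝ ∞ (a j)) ∧ Integrable (prodFn a) := by
  intro a ha
  have hd : ContDiff ℝ ∞ (deriv χ) := (contDiff_infty_iff_deriv.1 h.smooth).2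
  have h1 : ∀ j, ContDiff ℝ ∞ (a j) := fun j => by
    rcases ha j with h' | h' <;> rw [h']
    exacts [h.smooth, hd]
  refine ⟨h1, (contDiff_prodFn h1).continuous.integrable_of_hasCompactSupport ?_⟩
  refine (hasCompactSupport_prodFn (r := R - δ) fun j t ht => ?_).1
  rcases ha j with h' | h' <;> rw [h']
  exacts [h.eq_zero t ht, h.deriv_eq_zero' ht]

/-- The L¹ norm factors over the coordinates, so mixed derivatives of the cutoff stay bounded in L¹
as long as no coordinate is differentiated twice. -/
theorem integral_abs_prodFn_le {R C δ : ℝ} {χ : ℝ → ℝ} (h : IsCutoff R C δ χ) (hR : 0 < R)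
    (hC : 0 < C) (hδ : 0 < δ) (a : Fin 3 → ℝ → ℝ) (ha : ∀ j, a j = χ ∨ a j = deriv χ) :
    ∫ x, |prodFn a x| ≤ (2 * R + 4 * C) ^ 3 := by
  rw [integral_abs_prodFn]
  calc ∏ j, ∫ t, |a j t| ≤ ∏ _j : Fin 3, (2 * R + 4 * C) := by
        refine Finset.prod_le_prod (fun _ _ => integral_nonneg fun _ => abs_nonneg _) fun j _ => ?_
        rcases ha j with h' | h' <;> rw [h']
        · linarith [h.integral_abs_le hR hδ]
        · linarith [h.integral_abs_deriv_le hC hδ]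
    _ = _ := by simp

theorem integrable_mul_prodFn {R C δ : ℝ} {χ : ℝ → ℝ} (h : IsCutoff R C δ χ) (hδ : 0 < δ)
    {a : Fin 3 → ℝ → ℝ} (ha : ∀ j, a j = χ ∨ a j = deriv χ) {φ : Coord → ℝ}
    (hφ : Continuous φ) {B : ℝ}
    (hB : ∀ x ∈ Icc (fun _ => -R : Coord) (fun _ => R), |φ x| ≤ B) (hBpos : 0 ≤ B)
    (hR : 0 < R) (hC : 0 < C) :
    Integrable (fun x => φ x * prodFn a x) ∧
      ∫ x, |φ x * prodFn a x| ≤ B * (2 * R + 4 * C) ^ 3 := by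
  obtain ⟨h1, h2⟩ := integrable_prodFn_of_isCutoff h a ha
  have hcs := hasCompactSupport_prodFn (a := a) (r := R - δ) fun j t ht => by
    rcases ha j with h' | h' <;> rw [h']
    exacts [h.eq_zero t ht, h.deriv_eq_zero' ht]
  have hb : ∀ x, |φ x * prodFn a x| ≤ B * |prodFn a x| := by
    intro x
    rw [abs_mul]
    by_cases hx : x ∈ Icc (fun _ => -R : Coord) (fun _ => R)
    · exact mul_le_mul_of_nonneg_right (hB x hx) (abs_nonneg _)
    · have : prodFn a x = 0 := by
        refine image_eq_zero_of_notMem_tsupport fun hx' => hx ?_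
        have := hcs.2 hx'
        exact ⟨fun j => by have := this.1 j; simp at *; linarith,
          fun j => by have := this.2 j; simp at *; linarith⟩
      simp [this]
  have hint : Integrable (fun x => φ x * prodFn a x) :=
    (hφ.mul (contDiff_prodFn h1).continuous).integrable_of_hasCompactSupport hcs.1.mul_left
  refine ⟨hint, ?_⟩
  calc ∫ x, |φ x * prodFn a x| ≤ ∫ x, B * |prodFn a x| :=
        integral_mono hint.abs (h2.abs.const_mul _) hb
    _ = B * ∫ x, |prodFn a x| := integral_const_mul _ _
    _ ≤ _ := mul_le_mul_of_nonneg_left (integral_abs_prodFn_le h hR hC hδ a ha) hBpos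

theorem prodFn_cutoff_eq_zero {R C δ : ℝ} {χ : ℝ → ℝ} (h : IsCutoff R C δ χ)
    {a : Fin 3 → ℝ → ℝ} {i : Fin 3} (ha : a i = deriv χ) {x : Coord}
    (hx : |x i| < R - 2 * δ) : prodFn a x = 0 :=
  Finset.prod_eq_zero (Finset.mem_univ i) (by rw [ha]; exact h.deriv_eq_zero hx)

theorem update_cutoff_cases {χ : ℝ → ℝ} {a : Fin 3 → ℝ → ℝ} (ha : ∀ j, a j = χ ∨ a j = deriv χ)
    {i : Fin 3} (hi : a i = χ) :
    ∀ j, Function.update a i (deriv (a i)) j = χ ∨ Function.update a i (deriv (a i)) j = deriv χ := by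
  intro j
  by_cases hj : j = i
  · subst hj; simp [hi]
  · simpa [hj] using ha j

/-- The weak derivatives of a function that vanishes on the boundary can be tested against all
smooth functions. -/
theorem WeakPartial.strong_of_zeroBoundary {R : ℝ} (hR : 0 < R) {i : Fin 3}
    {u w : Coord → ℝ} (h : WeakPartial R i u w) (hu : IntegrableOn u (box R))
    (hw : IntegrableOn w (box R)) (hu0 : ZeroBoundary R u) : StrongPartial R i u w := by
  intro φ hφ
  obtain ⟨C, δ, χ, hC, hδ, hδ0, hχ⟩ := exists_cutoff_seq R
  refine h.ibp_of_tendsto hδ hδ0 hχ hu hw hφ ?_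
  obtain ⟨B, hB, hφB⟩ := exists_bound_Icc hφ.continuous R
  have ha : ∀ n, ∀ j : Fin 3, (fun _ : Fin 3 => χ n) j = χ n ∨ (fun _ : Fin 3 => χ n) j = deriv (χ n) :=
    fun n j => Or.inl rfl
  have hI := fun n => integrable_mul_prodFn (hχ n) (hδ n)
    (update_cutoff_cases (ha n) (i := i) rfl) hφ.continuous hφB hB.le hR hC
  refine hu0.tendsto_integral hδ0 (K := B * (2 * R + 4 * C) ^ 3) i ?_ ?_ ?_
  · intro n
    rw [dd_prodFn fun _ => (hχ n).smooth]
    exact (hI n).1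
  · intro n
    rw [dd_prodFn fun _ => (hχ n).smooth]
    exact (hI n).2
  · intro n x _ hxi
    rw [dd_prodFn fun _ => (hχ n).smooth, prodFn_cutoff_eq_zero (hχ n) (i := i) (by simp) hxi,
      mul_zero]

/-- The tangential derivatives of a function that vanishes on the boundary vanish there, in the
weak sense. -/
theorem WeakPartial.strong_of_tangential {R : ℝ} (hR : 0 < R) {i j : Fin 3} (hij : i ≠ j)
    {u v w : Coord → ℝ} (huv : WeakPartial R i u v) (hvw : WeakPartial R j v w)
    (hv : IntegrableOn v (box R)) (hw : IntegrableOn w (box R))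
    (hu0 : ZeroBoundary R u) : StrongPartial R j v w := by
  intro φ hφ
  obtain ⟨C, δ, χ, hC, hδ, hδ0, hχ⟩ := exists_cutoff_seq R
  refine hvw.ibp_of_tendsto hδ hδ0 hχ hv hw hφ ?_
  set a : ℕ → Fin 3 → ℝ → ℝ := fun n => Function.update (fun _ => χ n) j (deriv (χ n)) with ha
  set b : ℕ → Fin 3 → ℝ → ℝ := fun n => Function.update (a n) i (deriv (a n i)) with hb
  have hai : ∀ n, a n i = χ n := fun n => by simp [ha, hij]
  have hca : ∀ n k, a n k = χ n ∨ a n k = deriv (χ n) :=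
    fun n => update_cutoff_cases (a := fun _ => χ n) (fun _ => Or.inl rfl) rfl
  have hcb : ∀ n k, b n k = χ n ∨ b n k = deriv (χ n) :=
    fun n => update_cutoff_cases (hca n) (hai n)
  have haj : ∀ n, a n j = deriv (χ n) := fun n => by simp [ha]
  have hbj : ∀ n, b n j = deriv (χ n) := fun n => by
    simp [hb, Function.update_of_ne hij.symm, haj]
  have hsa : ∀ n k, ContDiff ℝ ∞ (a n k) := fun n =>
    (integrable_prodFn_of_isCutoff (hχ n) _ (hca n)).1
  have hdd : ∀ n, dd j (prodFn fun _ => χ n) = prodFn (a n) := fun n =>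
    dd_prodFn (fun _ => (hχ n).smooth) j
  have hdd2 : ∀ n, dd i (prodFn (a n)) = prodFn (b n) := fun n => dd_prodFn (hsa n) i
  -- The weak derivative v = ∂ᵢu is moved back onto the kernel, leaving u, which vanishes on the
  -- boundary. Since i ≠ j, the new kernel contains ∂ᵢ∂ⱼ of the cutoff but no second derivative in a
  -- single coordinate, so its L¹ norm is uniformly bounded.
  have e : ∀ n, -∫ x in box R, (dd i φ x * prodFn (a n) x + φ x * prodFn (b n) x) * u x
      = ∫ x in box R, φ x * dd j (prodFn fun _ => χ n) x * v x := by
    intro n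
    rw [hdd]
    have h1 := huv _ (hφ.mul (contDiff_prodFn (hsa n))) ?_ ?_
    · simp_rw [dd_mul i hφ (contDiff_prodFn (hsa n)), hdd2] at h1
      rw [h1, neg_neg]
    all_goals
      have hcs := hasCompactSupport_prodFn (a := a n) (r := R - δ n) fun k t ht => by
        rcases hca n k with h' | h' <;> rw [h']
        exacts [(hχ n).eq_zero t ht, (hχ n).deriv_eq_zero' ht]
    · exact hcs.1.mul_left
    · refine (tsupport_mul_subset_right (f := φ) (g := prodFn (a n))).trans (hcs.2.trans ?_)
      intro x hx
      rw [mem_box]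
      intro k
      have := hδ n
      exact abs_lt.2 ⟨by linarith [hx.1 k], by linarith [hx.2 k]⟩
  refine Tendsto.congr e ?_
  rw [show (0 : ℝ) = -0 by simp]
  refine Tendsto.neg ?_
  obtain ⟨B, hB, hφB⟩ := exists_bound_Icc hφ.continuous R
  obtain ⟨B', hB', hφB'⟩ := exists_bound_Icc (contDiff_dd i hφ).continuous R
  have hIa := fun n => integrable_mul_prodFn (hχ n) (hδ n) (hca n)
    (contDiff_dd i hφ).continuous hφB' hB'.le hR hC
  have hIb := fun n => integrable_mul_prodFn (hχ n) (hδ n) (hcb n)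
    hφ.continuous hφB hB.le hR hC
  refine hu0.tendsto_integral hδ0 (K := (B' + B) * (2 * R + 4 * C) ^ 3) j ?_ ?_ ?_
  · exact fun n => (hIa n).1.add (hIb n).1
  · intro n
    calc _ ≤ ∫ x, (|dd i φ x * prodFn (a n) x| + |φ x * prodFn (b n) x|) :=
          integral_mono ((hIa n).1.add (hIb n).1).abs ((hIa n).1.abs.add (hIb n).1.abs)
            fun x => abs_add_le _ _
      _ = (∫ x, |dd i φ x * prodFn (a n) x|) + ∫ x, |φ x * prodFn (b n) x| :=
          integral_add (hIa n).1.abs (hIb n).1.abs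
      _ ≤ _ := by rw [add_mul]; exact add_le_add (hIa n).2 (hIb n).2
  · intro n x _ hxi
    rw [prodFn_cutoff_eq_zero (hχ n) (haj n) hxi, prodFn_cutoff_eq_zero (hχ n) (hbj n) hxi]
    simp

end

section

/-! ### Smoothing operators -/

theorem contDiff_integral_smul {E : Type} [NormedAddCommGroup E] [NormedSpace ℝ E]
    [CompleteSpace E] {R : ℝ} {f : Coord → ℝ} (hf : IntegrableOn f (box R))
    {K : Coord → Coord → E} (hK : ContDiff ℝ ∞ (Function.uncurry K)) (x : Coord) :
    HasFDerivAt (fun x => ∫ y in box R, f y • K x y)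
      (∫ y in box R, f y • fderiv ℝ (fun x => K x y) x) x := by
  have hK' : ContDiff ℝ ∞ fun q : Coord × Coord => fderiv ℝ (fun x => K x q.2) q.1 := by
    refine ContDiff.fderiv (m := ∞) (n := ∞) (f := fun (q : Coord × Coord) x => K x q.2) ?_
      contDiff_fst (by simp)
    exact hK.comp (contDiff_snd.prodMk (contDiff_snd.comp contDiff_fst))
  obtain ⟨C, hC⟩ := ((isCompact_closedBall x 1).prod
    (isCompact_Icc (a := (fun _ => -R : Coord)) (b := fun _ => R))).exists_bound_of_continuousOn
    hK'.continuous.continuousOn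
  have hcont : ∀ x, Continuous fun y => K x y := fun x =>
    hK.continuous.comp (Continuous.prodMk_right x)
  have hint : ∀ x, Integrable (fun y => f y • K x y) (volume.restrict (box R)) := by
    intro x
    obtain ⟨B, hB⟩ := (isCompact_Icc (a := (fun _ => -R : Coord))
      (b := fun _ => R)).exists_bound_of_continuousOn (hcont x).continuousOn
    refine Integrable.mono' (hf.abs.mul_const B)
      (hf.aestronglyMeasurable.smul (hcont x).aestronglyMeasurable) ?_
    filter_upwards [ae_restrict_mem (measurableSet_box R)] with y hy
    rw [norm_smul, Real.norm_eq_abs]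
    exact mul_le_mul_of_nonneg_left (hB y (box_subset_Icc R hy)) (abs_nonneg _)
  refine hasFDerivAt_integral_of_dominated_of_fderiv_le (s := Metric.closedBall x 1)
    (F' := fun x y => f y • fderiv ℝ (fun x => K x y) x) (bound := fun y => |f y| * C)
    (Metric.closedBall_mem_nhds x one_pos) (Eventually.of_forall fun x => (hint x).1) (hint x)
    ?_ ?_ (hf.abs.mul_const C) ?_
  · exact hf.aestronglyMeasurable.smul
      (hK'.continuous.comp (Continuous.prodMk_right x)).aestronglyMeasurable
  · filter_upwards [ae_restrict_mem (measurableSet_box R)] with y hy z hz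
    rw [norm_smul, Real.norm_eq_abs]
    exact mul_le_mul_of_nonneg_left (hC (z, y) ⟨hz, box_subset_Icc R hy⟩) (abs_nonneg _)
  · refine Eventually.of_forall fun y z _ => ?_
    have : ContDiff ℝ ∞ fun x => K x y := hK.comp (contDiff_prodMk_left y)
    exact ((this.differentiable (by simp) z).hasFDerivAt).const_smul (f y)

/-- The target space is quantified inside the induction because the derivative is an integral of the
same form whose kernel takes values in a space of linear maps. -/
theorem contDiff_integral_smul_nat {R : ℝ} {f : Coord → ℝ} (hf : IntegrableOn f (box R)) (n : ℕ) :
    ∀ {E : Type} [NormedAddCommGroup E] [NormedSpace ℝ E] [CompleteSpace E]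
      {K : Coord → Coord → E}, ContDiff ℝ ∞ (Function.uncurry K) →
      ContDiff ℝ n (fun x => ∫ y in box R, f y • K x y) := by
  induction n with
  | zero =>
    intro E _ _ _ K hK
    have h0 : Differentiable ℝ (fun x => ∫ y in box R, f y • K x y) := fun x =>
      (contDiff_integral_smul hf hK x).differentiableAt
    exact contDiff_zero.2 h0.continuous
  | succ n ih =>
    intro E _ _ _ K hK
    refine contDiff_succ_iff_hasFDerivAt.2
      ⟨fun x => ∫ y in box R, f y • fderiv ℝ (fun x => K x y) x, ih ?_,
        fun x => contDiff_integral_smul hf hK x⟩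
    refine ContDiff.fderiv (m := ∞) (n := ∞) (f := fun (q : Coord × Coord) x => K x q.2) ?_
      contDiff_fst (by simp)
    exact hK.comp (contDiff_snd.prodMk (contDiff_snd.comp contDiff_fst))

/-- `η` is an even mollifier on the real line with support in `[-ε, ε]`. -/
structure IsMollifier (ε : ℝ) (η : ℝ → ℝ) : Prop where
  smooth : ContDiff ℝ ∞ η
  nonneg : ∀ t, 0 ≤ η t
  even : ∀ t, η (-t) = η t
  eq_zero : ∀ t, ε ≤ |t| → η t = 0
  integrable : Integrable η
  integral_eq_one : ∫ t, η t = 1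

theorem exists_isMollifier {ε : ℝ} (hε : 0 < ε) : ∃ η, IsMollifier ε η := by
  let b : ContDiffBump (0 : ℝ) := ⟨ε / 2, ε, by positivity, by linarith⟩
  refine ⟨b.normed volume, ContDiffBump.contDiff_normed (n := ⊤) b, b.nonneg_normed, b.normed_neg,
    fun t ht => ?_, b.integrable_normed, b.integral_normed⟩
  by_contra h
  have : t ∈ Function.support (b.normed volume) := h
  rw [b.support_normed_eq, mem_ball_zero_iff, Real.norm_eq_abs] at this
  exact absurd this (not_lt.2 ht)

/-- The reflected kernel on `(-R, R)`; it satisfies the Dirichlet condition at `±R` for `σ = -1` and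
the Neumann condition for `σ = 1`. -/
def refKernel (R : ℝ) (η : ℝ → ℝ) (σ s t : ℝ) : ℝ :=
  η (s - t) + σ * (η (s + t - 2 * R) + η (s + t + 2 * R))

/-- The product kernel on the cube. -/
def refKernelProd (R : ℝ) (η : ℝ → ℝ) (σ : Fin 3 → ℝ) (x y : Coord) : ℝ :=
  ∏ j, refKernel R η (σ j) (x j) (y j)

/-- The smoothing operator with the product kernel. -/
noncomputable def smoothing (R : ℝ) (η : ℝ → ℝ) (σ : Fin 3 → ℝ) (f : Coord → ℝ) (x : Coord) : ℝ :=
  ∫ y in box R, f y * refKernelProd R η σ x y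

/-- The change of sign of the `i`-th component. -/
def flip (i : Fin 3) (σ : Fin 3 → ℝ) : Fin 3 → ℝ := Function.update σ i (-σ i)

section
variable {R ε : ℝ} {η : ℝ → ℝ} {σ : Fin 3 → ℝ}

theorem contDiff_refKernelProd (hη : IsMollifier ε η) :
    ContDiff ℝ ∞ (Function.uncurry (refKernelProd R η σ)) := by
  have := hη.smooth
  unfold Function.uncurry refKernelProd refKernel
  refine contDiff_prod fun j _ => ?_
  have h1 : ContDiff ℝ ∞ fun q : Coord × Coord => q.1 j := (contDiff_apply ℝ ℝ j).comp contDiff_fst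
  have h2 : ContDiff ℝ ∞ fun q : Coord × Coord => q.2 j := (contDiff_apply ℝ ℝ j).comp contDiff_snd
  exact (this.comp (h1.sub h2)).add (contDiff_const.mul
    ((this.comp ((h1.add h2).sub contDiff_const)).add (this.comp ((h1.add h2).add contDiff_const))))

theorem contDiff_smoothing (hη : IsMollifier ε η) {f : Coord → ℝ} (hf : IntegrableOn f (box R)) :
    ContDiff ℝ ∞ (smoothing R η σ f) :=
  contDiff_infty.2 fun n =>
    contDiff_integral_smul_nat hf n (E := ℝ) (contDiff_refKernelProd (σ := σ) (R := R) hη)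

theorem contDiff_refKernel_right (hη : IsMollifier ε η) (τ s : ℝ) :
    ContDiff ℝ ∞ (refKernel R η τ s) := by
  have := hη.smooth
  unfold refKernel
  fun_prop

theorem contDiff_refKernel_left (hη : IsMollifier ε η) (τ t : ℝ) :
    ContDiff ℝ ∞ (fun s => refKernel R η τ s t) := by
  have := hη.smooth
  unfold refKernel
  fun_prop

/-- The direct term η(s - t) changes sign when differentiation moves from s to t, and the reflected
terms do not. This mismatch is absorbed by reversing the sign of the reflection, which is why
differentiation exchanges the Dirichlet and Neumann kernels. -/
theorem deriv_refKernel (hη : IsMollifier ε η) (τ s t : ℝ) :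
    deriv (fun s => refKernel R η τ s t) s = -deriv (refKernel R η (-τ) s) t := by
  have hd : ∀ u, HasDerivAt η (deriv η u) u := fun u =>
    (hη.smooth.differentiable (by simp) u).hasDerivAt
  have h1 : HasDerivAt (fun s => refKernel R η τ s t)
      (deriv η (s - t) + τ * (deriv η (s + t - 2 * R) + deriv η (s + t + 2 * R))) s := by
    have a1 := (hd (s - t)).comp_sub_const s t
    have a2 : HasDerivAt (fun s => η (s + t - 2 * R)) (deriv η (s + t - 2 * R)) s := by
      have := (hd (s + t - 2 * R)).comp s (((hasDerivAt_id s).add_const t).sub_const (2 * R))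
      simpa using! this
    have a3 : HasDerivAt (fun s => η (s + t + 2 * R)) (deriv η (s + t + 2 * R)) s := by
      have := (hd (s + t + 2 * R)).comp s (((hasDerivAt_id s).add_const t).add_const (2 * R))
      simpa using! this
    exact a1.add ((a2.add a3).const_mul τ)
  have h2 : HasDerivAt (refKernel R η (-τ) s)
      (-deriv η (s - t) + -τ * (deriv η (s + t - 2 * R) + deriv η (s + t + 2 * R))) t := by
    have a1 : HasDerivAt (fun t => η (s - t)) (-deriv η (s - t)) t := by
      have := (hd (s - t)).comp t ((hasDerivAt_id t).const_sub s)
      simpa using! this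
    have a2 : HasDerivAt (fun t => η (s + t - 2 * R)) (deriv η (s + t - 2 * R)) t := by
      have := (hd (s + t - 2 * R)).comp t (((hasDerivAt_id t).const_add s).sub_const (2 * R))
      simpa using! this
    have a3 : HasDerivAt (fun t => η (s + t + 2 * R)) (deriv η (s + t + 2 * R)) t := by
      have := (hd (s + t + 2 * R)).comp t (((hasDerivAt_id t).const_add s).add_const (2 * R))
      simpa using! this
    exact a1.add ((a2.add a3).const_mul (-τ))
  rw [h1.deriv, h2.deriv]
  ring

/-- At an endpoint the reflection in that endpoint cancels the direct term, by evenness of η, while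
the reflection in the other endpoint is at distance at least R > ε. -/
theorem refKernel_eq_zero (hη : IsMollifier ε η) (hε : ε < R) {s t : ℝ} (hs : |s| = R)
    (ht : |t| ≤ R) : refKernel R η (-1) s t = 0 := by
  obtain ⟨h1, h2⟩ := abs_le.1 ht
  have hR : 0 ≤ R := hs ▸ abs_nonneg s
  unfold refKernel
  rcases (abs_eq hR).1 hs with rfl | rfl
  · rw [hη.eq_zero (s + t + 2 * s) (by rw [abs_of_nonneg] <;> linarith),
      show s + t - 2 * s = -(s - t) by ring, hη.even]
    ring
  · rw [hη.eq_zero (-R + t - 2 * R) (by rw [abs_of_nonpos] <;> linarith),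
      show -R + t + 2 * R = -(-R - t) by ring, hη.even]
    ring

theorem refKernel_comm (hη : IsMollifier ε η) (τ s t : ℝ) :
    refKernel R η τ s t = refKernel R η τ t s := by
  unfold refKernel
  rw [show s - t = -(t - s) by ring, hη.even, add_comm s t]

theorem refKernelProd_eq_zero (hη : IsMollifier ε η) (hε : ε < R) {x y : Coord} {j : Fin 3}
    (hσ : σ j = -1) (hx : |x j| = R) (hy : |y j| ≤ R) : refKernelProd R η σ x y = 0 :=
  Finset.prod_eq_zero (Finset.mem_univ j) (by rw [hσ]; exact refKernel_eq_zero hη hε hx hy)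

theorem smoothing_eq_zero (hη : IsMollifier ε η) (hε : ε < R) {f : Coord → ℝ} {x : Coord}
    {j : Fin 3} (hσ : σ j = -1) (hx : |x j| = R) : smoothing R η σ f x = 0 := by
  refine setIntegral_eq_zero_of_forall_eq_zero fun y hy => ?_
  rw [refKernelProd_eq_zero hη hε hσ hx (mem_box.1 hy j).le, mul_zero]

theorem dd_refKernelProd (hη : IsMollifier ε η) (i : Fin 3) (x y : Coord) :
    dd i (fun x => refKernelProd R η σ x y) x = -dd i (refKernelProd R η (flip i σ) x) y := by
  have e1 : (fun x => refKernelProd R η σ x y)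
      = prodFn fun j s => refKernel R η (σ j) s (y j) := rfl
  have e2 : refKernelProd R η (flip i σ) x = prodFn fun j => refKernel R η (flip i σ j) (x j) := rfl
  rw [e1, e2, dd_prodFn fun j => contDiff_refKernel_left hη _ _,
    dd_prodFn fun j => contDiff_refKernel_right hη _ _, prodFn_update_left, prodFn_update_left,
    deriv_refKernel hη, flip]
  simp only [Function.update_self, neg_mul]
  congr 2
  refine Finset.prod_congr rfl fun j hj => ?_
  rw [Function.update_of_ne (Finset.ne_of_mem_erase hj)]

theorem dd_smoothing_eq (hη : IsMollifier ε η) {f : Coord → ℝ} (hf : IntegrableOn f (box R))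
    (i : Fin 3) (x : Coord) :
    dd i (smoothing R η σ f) x
      = -∫ y in box R, dd i (refKernelProd R η (flip i σ) x) y * f y := by
  have h := contDiff_integral_smul hf (contDiff_refKernelProd (R := R) (σ := σ) hη) x
  have e : dd i (smoothing R η σ f) x
      = (∫ y in box R, f y • fderiv ℝ (fun x => refKernelProd R η σ x y) x) (Pi.single i 1) :=
    dd_eq_of_hasFDerivAt i h
  have hcd := contDiff_refKernelProd (R := R) (σ := σ) hη
  have hK' : ContDiff ℝ ∞ fun y : Coord => fderiv ℝ (fun x => refKernelProd R η σ x y) x :=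
    ContDiff.fderiv (m := ∞) (n := ∞) (f := fun (y : Coord) x => refKernelProd R η σ x y)
      (hcd.comp (contDiff_snd.prodMk contDiff_fst)) contDiff_const (by simp)
  obtain ⟨B, hB⟩ := (isCompact_Icc (a := (fun _ => -R : Coord))
      (b := fun _ => R)).exists_bound_of_continuousOn hK'.continuous.continuousOn
  have hint : IntegrableOn (fun y => f y • fderiv ℝ (fun x => refKernelProd R η σ x y) x)
      (box R) := by
    refine Integrable.mono' (hf.abs.mul_const B)
      (hf.aestronglyMeasurable.smul hK'.continuous.aestronglyMeasurable) ?_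
    filter_upwards [ae_restrict_mem (measurableSet_box R)] with y hy
    rw [norm_smul, Real.norm_eq_abs]
    exact mul_le_mul_of_nonneg_left (hB y (box_subset_Icc R hy)) (abs_nonneg _)
  rw [e, ContinuousLinearMap.integral_apply hint, ← integral_neg]
  refine integral_congr_ae (Eventually.of_forall fun y => ?_)
  have := dd_refKernelProd (R := R) (σ := σ) hη i x y
  simp only [dd, _root_.smul_apply, smul_eq_mul] at this ⊢
  rw [this]
  ring

theorem contDiff_refKernelProd_right (hη : IsMollifier ε η) (x : Coord) :
    ContDiff ℝ ∞ (refKernelProd R η σ x) :=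
  contDiff_prodFn fun _ => contDiff_refKernel_right hη _ _

/-- Smoothing commutes with weak derivatives in Neumann directions. -/
theorem WeakPartial.dd_smoothing (hη : IsMollifier ε η) (hε : ε < R) (hR : 0 < R) {i : Fin 3}
    {u w : Coord → ℝ} (h : WeakPartial R i u w) (hu : IntegrableOn u (box R))
    (hw : IntegrableOn w (box R)) (hσ : σ i = 1) {x : Coord} (hx : |x i| ≤ R) :
    dd i (smoothing R η σ u) x = smoothing R η (flip i σ) w x := by
  rw [dd_smoothing_eq hη hu, h.integral_eq_of_vanishing hR hu hw
    (contDiff_refKernelProd_right hη x), neg_neg]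
  · simp_rw [mul_comm]; rfl
  -- With σ i = 1 the flipped kernel is of Dirichlet type in direction i. It vanishes on those faces
  -- as a function of y, so no boundary information on u is required.
  · intro y hy hyi
    refine Finset.prod_eq_zero (Finset.mem_univ i) ?_
    rw [flip, Function.update_self, hσ, refKernel_comm hη]
    exact refKernel_eq_zero hη hε hyi hx

/-- Smoothing commutes with strong derivatives. -/
theorem StrongPartial.dd_smoothing (hη : IsMollifier ε η) {i : Fin 3}
    {u w : Coord → ℝ} (h : StrongPartial R i u w) (hu : IntegrableOn u (box R)) :
    dd i (smoothing R η σ u) = smoothing R η (flip i σ) w := by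
  funext x
  rw [dd_smoothing_eq hη hu, h _ (contDiff_refKernelProd_right hη x), neg_neg]
  simp_rw [mul_comm]; rfl

end

end

section

/-! ### Mapping properties of the smoothing operators -/

section
variable {R ε : ℝ} {η : ℝ → ℝ} {σ : Fin 3 → ℝ}

theorem refKernel_nonneg (hη : IsMollifier ε η) (s t : ℝ) : 0 ≤ refKernel R η 1 s t := by
  have := hη.nonneg
  unfold refKernel
  have h1 := this (s - t)
  have h2 := this (s + t - 2 * R)
  have h3 := this (s + t + 2 * R)
  linarith

theorem abs_refKernel_le (hη : IsMollifier ε η) {τ : ℝ} (hτ : |τ| ≤ 1) (s t : ℝ) :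
    |refKernel R η τ s t| ≤ refKernel R η 1 s t := by
  unfold refKernel
  have h1 := hη.nonneg (s - t)
  have h2 := hη.nonneg (s + t - 2 * R)
  have h3 := hη.nonneg (s + t + 2 * R)
  refine (abs_add_le _ _).trans ?_
  rw [abs_of_nonneg h1, abs_mul, abs_of_nonneg (add_nonneg h2 h3)]
  gcongr

/-- Three translates of η, each of mass one. In three coordinates this produces the factor 27 = 3³
in all bounds for the smoothing operators. -/
theorem integral_refKernel (hη : IsMollifier ε η) (s : ℝ) :
    Integrable (refKernel R η 1 s) ∧ ∫ t, refKernel R η 1 s t = 3 := by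
  have i1 : Integrable fun t => η (s - t) := hη.integrable.comp_sub_left s
  have i2 : Integrable fun t => η (s + t - 2 * R) := by
    have := hη.integrable.comp_add_left (s - 2 * R)
    refine this.congr (Eventually.of_forall fun t => ?_)
    simp only
    ring_nf
  have i3 : Integrable fun t => η (s + t + 2 * R) := by
    have := hη.integrable.comp_add_left (s + 2 * R)
    refine this.congr (Eventually.of_forall fun t => ?_)
    simp only
    ring_nf
  have e1 : ∫ t, η (s - t) = 1 := by
    rw [integral_sub_left_eq_self η volume s, hη.integral_eq_one]
  have e2 : ∫ t, η (s + t - 2 * R) = 1 := by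
    rw [← hη.integral_eq_one, ← integral_add_left_eq_self η (s - 2 * R)]
    congr 1; funext t; ring_nf
  have e3 : ∫ t, η (s + t + 2 * R) = 1 := by
    rw [← hη.integral_eq_one, ← integral_add_left_eq_self η (s + 2 * R)]
    congr 1; funext t; ring_nf
  refine ⟨i1.add ((i2.add i3).const_mul 1), ?_⟩
  have h : ∫ t, refKernel R η 1 s t
      = (∫ t, η (s - t)) + ∫ t, 1 * (η (s + t - 2 * R) + η (s + t + 2 * R)) :=
    integral_add i1 ((i2.add i3).const_mul 1)
  rw [h, integral_const_mul, integral_add i2 i3, e1, e2, e3]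
  norm_num

/-- The nonnegative majorant of the product kernels. -/
def majKernel (R : ℝ) (η : ℝ → ℝ) (x y : Coord) : ℝ := refKernelProd R η (fun _ => 1) x y

theorem majKernel_nonneg (hη : IsMollifier ε η) (x y : Coord) : 0 ≤ majKernel R η x y := by
  unfold majKernel refKernelProd
  exact Finset.prod_nonneg fun _ _ => refKernel_nonneg hη _ _

theorem majKernel_comm (hη : IsMollifier ε η) (x y : Coord) :
    majKernel R η x y = majKernel R η y x := by
  unfold majKernel refKernelProd
  exact Finset.prod_congr rfl fun _ _ => refKernel_comm hη _ _ _

theorem abs_refKernelProd_le (hη : IsMollifier ε η) (hσ : ∀ j, |σ j| ≤ 1) (x y : Coord) :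
    |refKernelProd R η σ x y| ≤ majKernel R η x y := by
  unfold majKernel refKernelProd
  rw [Finset.abs_prod]
  exact Finset.prod_le_prod (fun _ _ => abs_nonneg _) fun j _ => abs_refKernel_le hη (hσ j) _ _

theorem integral_majKernel (hη : IsMollifier ε η) (x : Coord) :
    Integrable (majKernel R η x) ∧ ∫ y, majKernel R η x y = 27 := by
  constructor
  · exact Integrable.fintype_prod (f := fun j => refKernel R η 1 (x j))
      fun j => (integral_refKernel hη (x j)).1
  · calc ∫ y, majKernel R η x y = ∏ j : Fin 3, ∫ t, refKernel R η 1 (x j) t :=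
          integral_fintype_prod_volume_eq_prod fun j => refKernel R η 1 (x j)
      _ = 27 := by
          simp_rw [(integral_refKernel hη _).2]
          norm_num

theorem lintegral_majKernel_le (hη : IsMollifier ε η) (x : Coord) :
    ∫⁻ y in box R, ENNReal.ofReal (majKernel R η x y) ≤ 27 := by
  obtain ⟨h1, h2⟩ := integral_majKernel (R := R) hη x
  calc _ ≤ ∫⁻ y, ENNReal.ofReal (majKernel R η x y) := setLIntegral_le_lintegral _ _
    _ = ENNReal.ofReal (∫ y, majKernel R η x y) :=
        (ofReal_integral_eq_lintegral_ofReal h1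
          (Eventually.of_forall fun y => majKernel_nonneg hη x y)).symm
    _ = 27 := by rw [h2]; norm_num

theorem continuous_majKernel (hη : IsMollifier ε η) :
    Continuous (Function.uncurry (majKernel R η)) :=
  (contDiff_refKernelProd (R := R) (σ := fun _ => 1) hη).continuous

theorem enorm_smoothing_le (hη : IsMollifier ε η) (hσ : ∀ j, |σ j| ≤ 1) (f : Coord → ℝ)
    (x : Coord) : ‖smoothing R η σ f x‖ₑ
      ≤ ∫⁻ y in box R, ENNReal.ofReal (majKernel R η x y) * ‖f y‖ₑ := by
  refine (enorm_integral_le_lintegral_enorm _).trans (lintegral_mono fun y => ?_)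
  rw [enorm_mul, mul_comm]
  refine mul_le_mul_left ?_ _
  rw [← ofReal_norm]
  exact ENNReal.ofReal_le_ofReal (abs_refKernelProd_le hη hσ x y)

/-- The smoothing operators are bounded in `Lᵖ`, uniformly in the mollifier. -/
theorem lintegral_smoothing_le (hη : IsMollifier ε η) (hσ : ∀ j, |σ j| ≤ 1) {f : Coord → ℝ}
    (hf : AEStronglyMeasurable f (volume.restrict (box R))) {p : ℝ} (hp : 1 ≤ p) :
    ∫⁻ x in box R, ‖smoothing R η σ f x‖ₑ ^ p ≤ 27 ^ p * ∫⁻ y in box R, ‖f y‖ₑ ^ p := by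
  have hp0 : 0 < p := by linarith
  set k : Coord → Coord → ENNReal := fun x y => ENNReal.ofReal (majKernel R η x y) with hk
  have hkm : Measurable (Function.uncurry k) :=
    ENNReal.measurable_ofReal.comp (continuous_majKernel hη).measurable
  have hkx : ∀ x, Measurable (k x) := fun x => hkm.comp measurable_prodMk_left
  have hfm : AEMeasurable (fun y => ‖f y‖ₑ) (volume.restrict (box R)) := hf.enorm
  have h1 : ∀ x, ‖smoothing R η σ f x‖ₑ ^ p
      ≤ 27 ^ (p - 1) * ∫⁻ y in box R, k x y * ‖f y‖ₑ ^ p := by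
    intro x
    -- Schur's test: one factor k is written as k^(1-1/p) k^(1/p) and Hölder's inequality is
    -- applied. The mass bound in y then yields 27^(p-1), and after Fubini the symmetry of the
    -- kernel gives one more factor 27.
    have hH := ENNReal.lintegral_mul_norm_pow_le (μ := volume.restrict (box R))
      (f := k x) (g := fun y => k x y * ‖f y‖ₑ ^ p) (p := 1 - 1 / p) (q := 1 / p)
      (hkx x).aemeasurable ((hkx x).aemeasurable.mul (hfm.pow_const p))
      (by rw [sub_nonneg, div_le_one hp0]; exact hp) (by positivity) (by ring)
    have e : ∀ y, k x y ^ (1 - 1 / p) * (k x y * ‖f y‖ₑ ^ p) ^ (1 / p) = k x y * ‖f y‖ₑ := by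
      intro y
      rw [ENNReal.mul_rpow_of_nonneg _ _ (by positivity), ← ENNReal.rpow_mul, ← mul_assoc,
        ← ENNReal.rpow_add_of_nonneg _ _ (by rw [sub_nonneg, div_le_one hp0]; exact hp)
          (by positivity), mul_one_div_cancel hp0.ne']
      simp
    simp_rw [e] at hH
    calc ‖smoothing R η σ f x‖ₑ ^ p ≤ (∫⁻ y in box R, k x y * ‖f y‖ₑ) ^ p := by
          gcongr; exact enorm_smoothing_le hη hσ f x
      _ ≤ ((∫⁻ y in box R, k x y) ^ (1 - 1 / p)
            * (∫⁻ y in box R, k x y * ‖f y‖ₑ ^ p) ^ (1 / p)) ^ p := by gcongr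
      _ = (∫⁻ y in box R, k x y) ^ (p - 1) * ∫⁻ y in box R, k x y * ‖f y‖ₑ ^ p := by
          rw [ENNReal.mul_rpow_of_nonneg _ _ hp0.le, ← ENNReal.rpow_mul, ← ENNReal.rpow_mul,
            one_div_mul_cancel hp0.ne', ENNReal.rpow_one]
          congr 2
          field_simp
      _ ≤ _ := by
          refine mul_le_mul_left ?_ _
          exact ENNReal.rpow_le_rpow (lintegral_majKernel_le hη x) (by linarith)
  calc _ ≤ ∫⁻ x in box R, 27 ^ (p - 1) * ∫⁻ y in box R, k x y * ‖f y‖ₑ ^ p :=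
        lintegral_mono fun x => h1 x
    _ = 27 ^ (p - 1) * ∫⁻ x in box R, ∫⁻ y in box R, k x y * ‖f y‖ₑ ^ p :=
        lintegral_const_mul' _ _ (ENNReal.rpow_ne_top_of_nonneg (by linarith) (by simp))
    _ = 27 ^ (p - 1) * ∫⁻ y in box R, ∫⁻ x in box R, k x y * ‖f y‖ₑ ^ p := by
        rw [lintegral_lintegral_swap]
        exact hkm.aemeasurable.mul (hfm.comp_snd.pow_const p)
    _ ≤ 27 ^ (p - 1) * ∫⁻ y in box R, 27 * ‖f y‖ₑ ^ p := by
        gcongr with y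
        rw [lintegral_mul_const'' (f := fun x => k x y) _ (hkm.comp measurable_prodMk_right).aemeasurable]
        gcongr
        have : ∀ x, k x y = k y x := fun x => by simp only [hk, majKernel_comm hη x y]
        simp_rw [this]
        exact lintegral_majKernel_le hη y
    _ = _ := by
        rw [lintegral_const_mul' _ _ (by simp), ← mul_assoc]
        congr 1
        conv_lhs => rw [← ENNReal.rpow_one 27, ← ENNReal.rpow_mul, one_mul]
        rw [← ENNReal.rpow_add _ _ (by simp) (by simp)]
        simp

theorem eLpNorm_smoothing_le (hη : IsMollifier ε η) (hσ : ∀ j, |σ j| ≤ 1) {f : Coord → ℝ}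
    (hf : AEStronglyMeasurable f (volume.restrict (box R))) {p : ℝ} (hp : 1 ≤ p) :
    eLpNorm (smoothing R η σ f) (ENNReal.ofReal p) (volume.restrict (box R))
      ≤ 27 * eLpNorm f (ENNReal.ofReal p) (volume.restrict (box R)) := by
  have hp0 : 0 < p := by linarith
  have h2 := lintegral_smoothing_le hη hσ hf hp
  have hp0' : ENNReal.ofReal p ≠ 0 := by simpa using hp0
  rw [eLpNorm_eq_lintegral_rpow_enorm_toReal hp0' ENNReal.ofReal_ne_top,
    eLpNorm_eq_lintegral_rpow_enorm_toReal hp0' ENNReal.ofReal_ne_top,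
    ENNReal.toReal_ofReal hp0.le]
  calc _ ≤ (27 ^ p * ∫⁻ y in box R, ‖f y‖ₑ ^ p) ^ (1 / p) := by gcongr
    _ = _ := by
        rw [ENNReal.mul_rpow_of_nonneg _ _ (by positivity), ← ENNReal.rpow_mul,
          mul_one_div_cancel hp0.ne', ENNReal.rpow_one]

theorem integrable_mul_refKernelProd (hη : IsMollifier ε η) {f : Coord → ℝ}
    (hf : IntegrableOn f (box R)) (x : Coord) :
    IntegrableOn (fun y => f y * refKernelProd R η σ x y) (box R) := by
  exact (integrableOn_box_mul (contDiff_refKernelProd_right (σ := σ) hη x).continuous hf).congr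
    (Eventually.of_forall fun y => mul_comm _ _)

theorem smoothing_sub (hη : IsMollifier ε η) {f g : Coord → ℝ} (hf : IntegrableOn f (box R))
    (hg : IntegrableOn g (box R)) :
    smoothing R η σ (f - g) = smoothing R η σ f - smoothing R η σ g := by
  funext x
  simp only [smoothing, Pi.sub_apply, sub_mul]
  exact integral_sub (integrable_mul_refKernelProd hη hf x) (integrable_mul_refKernelProd hη hg x)

/-- The kernels are concentrated near the diagonal. -/
theorem refKernelProd_eq_zero_of_dist (hη : IsMollifier ε η) (hε0 : 0 ≤ ε) {x y : Coord}
    (hx : x ∈ Icc (fun _ => -R : Coord) fun _ => R) (hy : y ∈ box R) (hd : ε < dist y x) :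
    refKernelProd R η σ x y = 0 := by
  have : ∃ j, ε < dist (y j) (x j) := by
    by_contra hc
    push Not at hc
    exact absurd ((dist_pi_le_iff hε0).2 hc) (not_le.2 hd)
  obtain ⟨j, hj⟩ := this
  rw [Real.dist_eq] at hj
  refine Finset.prod_eq_zero (Finset.mem_univ j) ?_
  have hyj := abs_lt.1 (mem_box.1 hy j)
  have hx1 := hx.1 j
  have hx2 := hx.2 j
  simp only at hx1 hx2
  unfold refKernel
  -- For two points of [-R, R], reflecting one of them in an endpoint never brings it closer to the
  -- other, so the reflected terms vanish along with the direct one.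
  have a2 : ε ≤ |x j + y j - 2 * R| := by
    refine hj.le.trans (abs_le.2 ?_)
    rw [abs_of_nonpos (by linarith)]
    constructor <;> linarith
  have a3 : ε ≤ |x j + y j + 2 * R| := by
    refine hj.le.trans (abs_le.2 ?_)
    rw [abs_of_nonneg (by linarith)]
    constructor <;> linarith
  rw [hη.eq_zero _ (by rw [abs_sub_comm]; exact hj.le), hη.eq_zero _ a2, hη.eq_zero _ a3]
  simp

/-- The smoothing operators obey a local maximum principle. -/
theorem abs_smoothing_le (hη : IsMollifier ε η) (hσ : ∀ j, |σ j| ≤ 1) (hε0 : 0 ≤ ε)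
    {f : Coord → ℝ} {x : Coord} (hx : x ∈ Icc (fun _ => -R : Coord) fun _ => R) {τ : ℝ}
    (hτ : 0 ≤ τ) (hf : ∀ᵐ y ∂(volume.restrict (box R)), dist y x ≤ ε → |f y| ≤ τ) :
    |smoothing R η σ f x| ≤ 27 * τ := by
  obtain ⟨h1, h2⟩ := integral_majKernel (R := R) hη x
  calc |smoothing R η σ f x| ≤ ∫ y in box R, majKernel R η x y * τ := by
        rw [smoothing, ← Real.norm_eq_abs]
        refine norm_integral_le_of_norm_le (h1.integrableOn.mul_const τ) ?_
        filter_upwards [ae_restrict_mem (measurableSet_box R), hf] with y hy hfy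
        rw [Real.norm_eq_abs, abs_mul, mul_comm]
        by_cases hd : dist y x ≤ ε
        · exact mul_le_mul (abs_refKernelProd_le hη hσ x y) (hfy hd) (abs_nonneg _)
            (majKernel_nonneg hη x y)
        · rw [refKernelProd_eq_zero_of_dist hη hε0 hx hy (not_le.1 hd)]
          simp only [abs_zero, zero_mul]
          exact mul_nonneg (majKernel_nonneg hη x y) hτ
    _ = (∫ y in box R, majKernel R η x y) * τ := integral_mul_const _ _
    _ ≤ 27 * τ := by
        refine mul_le_mul_of_nonneg_right ?_ hτ
        rw [← h2]
        exact setIntegral_le_integral h1 (Eventually.of_forall fun y => majKernel_nonneg hη x y)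

theorem integral_prod_translate (hη : IsMollifier ε η) (x : Coord) :
    Integrable (fun y : Coord => ∏ j, η (x j - y j)) ∧
      ∫ y : Coord, ∏ j, η (x j - y j) = 1 := by
  constructor
  · exact Integrable.fintype_prod (f := fun j t => η (x j - t))
      fun j => hη.integrable.comp_sub_left (x j)
  · rw [integral_fintype_prod_volume_eq_prod fun j t => η (x j - t)]
    exact Finset.prod_eq_one fun j _ => by rw [integral_sub_left_eq_self η volume, hη.integral_eq_one]

/-- Far from the boundary the smoothing operators reproduce constants. -/
theorem integral_refKernelProd (hη : IsMollifier ε η) {x : Coord}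
    (hx : ∀ j, |x j| ≤ R - ε) : ∫ y in box R, refKernelProd R η σ x y = 1 := by
  have e : ∀ y ∈ box R, refKernelProd R η σ x y = ∏ j, η (x j - y j) := by
    intro y hy
    refine Finset.prod_congr rfl fun j _ => ?_
    have hyj := abs_lt.1 (mem_box.1 hy j)
    have hxj := abs_le.1 (hx j)
    unfold refKernel
    rw [hη.eq_zero (x j + y j - 2 * R), hη.eq_zero (x j + y j + 2 * R)]
    · ring
    · rw [le_abs]; left; linarith
    · rw [le_abs]; right; linarith
  rw [setIntegral_congr_fun (measurableSet_box R) e, setIntegral_eq_integral_of_forall_compl_eq_zero,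
    (integral_prod_translate hη x).2]
  intro y hy
  rw [mem_box] at hy
  push Not at hy
  obtain ⟨j, hj⟩ := hy
  refine Finset.prod_eq_zero (Finset.mem_univ j) (hη.eq_zero _ ?_)
  have hxj := hx j
  have := abs_sub_abs_le_abs_sub (y j) (x j)
  rw [abs_sub_comm] at this
  linarith

theorem abs_smoothing_sub_le (hη : IsMollifier ε η) (hσ : ∀ j, |σ j| ≤ 1) (hε0 : 0 ≤ ε)
    {f : Coord → ℝ} (hf : IntegrableOn f (box R)) {x : Coord} (hx : ∀ j, |x j| ≤ R - ε) {τ : ℝ}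
    (hτ : 0 ≤ τ) (hfx : ∀ y ∈ box R, dist y x ≤ ε → |f y - f x| ≤ τ) :
    |smoothing R η σ f x - f x| ≤ 27 * τ := by
  have hxI : x ∈ Icc (fun _ => -R : Coord) fun _ => R :=
    ⟨fun j => by have := abs_le.1 (hx j); simp only; linarith,
     fun j => by have := abs_le.1 (hx j); simp only; linarith⟩
  have e : smoothing R η σ f x - f x = smoothing R η σ (f - fun _ => f x) x := by
    rw [smoothing_sub hη hf (by simp [IntegrableOn]), Pi.sub_apply]
    congr 1
    simp only [smoothing]
    rw [integral_const_mul, integral_refKernelProd hη hx, mul_one]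
  rw [e]
  refine abs_smoothing_le hη hσ hε0 hxI hτ ?_
  filter_upwards [ae_restrict_mem (measurableSet_box R)] with y hy hd using hfx y hy hd

theorem memLp_smoothing (hη : IsMollifier ε η) {f : Coord → ℝ}
    (hf : IntegrableOn f (box R)) (p : ENNReal) :
    MemLp (smoothing R η σ f) p (volume.restrict (box R)) := by
  have hc := (contDiff_smoothing (σ := σ) hη hf).continuous
  obtain ⟨C, -, hC⟩ := exists_bound_box hc R
  refine MemLp.of_bound hc.aestronglyMeasurable C ?_
  filter_upwards [ae_restrict_mem (measurableSet_box R)] with y hy using hC y hy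

/-- Convergence is pointwise at interior points, where the reflected terms are eventually inactive,
and the smoothings are uniformly bounded. Dominated convergence suffices. Uniform convergence up to
the boundary would fail for odd reflection. -/
theorem tendsto_smoothing_of_continuous {ε : ℕ → ℝ} {η : ℕ → ℝ → ℝ} (hε : Tendsto ε atTop (𝓝 0))
    (hε0 : ∀ n, 0 ≤ ε n) (hη : ∀ n, IsMollifier (ε n) (η n)) (hσ : ∀ j, |σ j| ≤ 1)
    {g : Coord → ℝ} (hg : Continuous g) :
    Tendsto (fun n => eLpNorm (smoothing R (η n) σ g - g) 2 (volume.restrict (box R)))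
      atTop (𝓝 0) := by
  obtain ⟨C, hC0, hC⟩ := exists_bound_box hg R
  have hgi : IntegrableOn g (box R) := by
    refine Integrable.mono' (integrable_const C) hg.aestronglyMeasurable ?_
    filter_upwards [ae_restrict_mem (measurableSet_box R)] with y hy using hC y hy
  have hb : ∀ n, ∀ x ∈ box R, |smoothing R (η n) σ g x - g x| ≤ 28 * C := by
    intro n x hx
    have h1 : |smoothing R (η n) σ g x| ≤ 27 * C := by
      refine abs_smoothing_le (hη n) hσ (hε0 n) (box_subset_Icc R hx) hC0.le ?_
      filter_upwards [ae_restrict_mem (measurableSet_box R)] with y hy _ using hC y hy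
    have h2 := hC x hx
    have := abs_sub (smoothing R (η n) σ g x) (g x)
    linarith
  have hlim : ∀ x ∈ box R, Tendsto (fun n => smoothing R (η n) σ g x - g x) atTop (𝓝 0) := by
    intro x hx
    rw [Metric.tendsto_atTop]
    intro τ hτ
    obtain ⟨d, hd, hcont⟩ := Metric.continuous_iff.1 hg x (τ / 28) (by positivity)
    have h1 : ∀ᶠ n in atTop, ε n < d := hε.eventually_lt_const hd
    have h2 : ∀ᶠ n in atTop, ∀ j, |x j| ≤ R - ε n := by
      refine eventually_all.2 fun j => ?_
      have h3 : Tendsto (fun n => R - ε n) atTop (𝓝 (R - 0)) := tendsto_const_nhds.sub hε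
      filter_upwards [h3.eventually_const_lt (show |x j| < _ by simpa using mem_box.1 hx j)]
        with n hn using hn.le
    obtain ⟨n0, hn0⟩ := (h1.and h2).exists_forall_of_atTop
    refine ⟨n0, fun n hn => ?_⟩
    rw [dist_zero_right, Real.norm_eq_abs]
    refine (abs_smoothing_sub_le (hη n) hσ (hε0 n) hgi (hn0 n hn).2 (τ := τ / 28)
      (by positivity) fun y _ hy => ?_).trans_lt (by linarith)
    exact (hcont y (hy.trans_lt (hn0 n hn).1)).le
  have e : ∀ n, eLpNorm (smoothing R (η n) σ g - g) 2 (volume.restrict (box R))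
      = (∫⁻ x in box R, ‖smoothing R (η n) σ g x - g x‖ₑ ^ (2 : ℝ)) ^ (1 / 2 : ℝ) := by
    intro n
    rw [eLpNorm_eq_lintegral_rpow_enorm_toReal (by simp) (by simp)]
    simp
  simp_rw [e]
  have hl : Tendsto (fun n => ∫⁻ x in box R, ‖smoothing R (η n) σ g x - g x‖ₑ ^ (2 : ℝ)) atTop
      (𝓝 (∫⁻ _x in box R, 0)) := by
    refine tendsto_lintegral_of_dominated_convergence' (fun _ => ENNReal.ofReal (28 * C) ^ (2 : ℝ))
      (fun n => ?_) (fun n => ?_) ?_ ?_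
    · exact (((contDiff_smoothing (hη n) hgi).continuous.sub hg).enorm.measurable.pow_const
        _).aemeasurable
    · filter_upwards [ae_restrict_mem (measurableSet_box R)] with x hx
      gcongr
      rw [← ofReal_norm]
      exact ENNReal.ofReal_le_ofReal (hb n x hx)
    · simp only [lintegral_const]
      exact ENNReal.mul_ne_top (ENNReal.rpow_ne_top_of_nonneg (by norm_num) ENNReal.ofReal_ne_top)
        (measure_ne_top _ _)
    · filter_upwards [ae_restrict_mem (measurableSet_box R)] with x hx
      have := (ENNReal.continuous_rpow_const (y := 2)).tendsto (‖(0 : ℝ)‖ₑ)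
      simpa [Function.comp_def] using this.comp ((continuous_enorm.tendsto _).comp (hlim x hx))
  have := ((ENNReal.continuous_rpow_const (y := 1 / 2)).tendsto _).comp hl
  simpa [Function.comp_def] using this

theorem integrableOn_of_memLp_two {f : Coord → ℝ} (hf : MemLp f 2 (volume.restrict (box R))) :
    IntegrableOn f (box R) := hf.integrable (by norm_num)

/-- The smoothing operators form an approximate identity in `L²`. -/
theorem tendsto_smoothing {ε : ℕ → ℝ} {η : ℕ → ℝ → ℝ} (hε : Tendsto ε atTop (𝓝 0))
    (hε0 : ∀ n, 0 ≤ ε n) (hη : ∀ n, IsMollifier (ε n) (η n)) (hσ : ∀ j, |σ j| ≤ 1)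
    {f : Coord → ℝ} (hf : MemLp f 2 (volume.restrict (box R))) :
    Tendsto (fun n => eLpNorm (smoothing R (η n) σ f - f) 2 (volume.restrict (box R)))
      atTop (𝓝 0) := by
  rw [ENNReal.tendsto_atTop_zero]
  intro τ hτ
  by_cases hτt : τ = ⊤
  · exact ⟨0, fun n _ => by simp [hτt]⟩
  -- The choice τ/56 balances the budget 27·τ/56 + τ/2 + τ/56 = τ, where 27 is the operator bound.
  obtain ⟨g, -, hfg, hg, hgm⟩ := hf.exists_hasCompactSupport_eLpNorm_sub_le (by simp)
    (ε := τ / 56) (by simpa using hτ.ne')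
  obtain ⟨n0, hn0⟩ := (ENNReal.tendsto_atTop_zero.1
    (tendsto_smoothing_of_continuous (R := R) hε hε0 hη hσ hg)) (τ / 2) (by simpa using hτ.ne')
  refine ⟨n0, fun n hn => ?_⟩
  have hfi := integrableOn_of_memLp_two hf
  have hgi := integrableOn_of_memLp_two hgm
  have h1 : eLpNorm (smoothing R (η n) σ (f - g)) 2 (volume.restrict (box R)) ≤ 27 * (τ / 56) := by
    have := eLpNorm_smoothing_le (hη n) hσ (hf.1.sub hgm.1) (p := 2) (by norm_num)
    simp only [ENNReal.ofReal_ofNat] at this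
    exact this.trans (by gcongr)
  have e : smoothing R (η n) σ f - f
      = smoothing R (η n) σ (f - g) + (smoothing R (η n) σ g - g) - (f - g) := by
    rw [smoothing_sub (hη n) hfi hgi]; abel
  have m1 := (memLp_smoothing (σ := σ) (hη n) (hfi.sub hgi) 2).1
  have m2 := ((memLp_smoothing (σ := σ) (hη n) hgi 2).sub hgm).1
  rw [e]
  calc _ ≤ eLpNorm (smoothing R (η n) σ (f - g) + (smoothing R (η n) σ g - g)) 2
            (volume.restrict (box R)) + eLpNorm (f - g) 2 (volume.restrict (box R)) :=
        eLpNorm_sub_le (m1.add m2) (hf.1.sub hgm.1) (by norm_num)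
    _ ≤ (27 * (τ / 56) + τ / 2) + τ / 56 := by
        refine add_le_add ((eLpNorm_add_le m1 m2 (by norm_num)).trans ?_) hfg
        exact add_le_add h1 (hn0 n hn)
    _ = τ := by
        lift τ to NNReal using hτt
        have : ((56 : NNReal) : ENNReal) = 56 := by norm_num
        rw [← this, ← ENNReal.coe_ofNat, ← ENNReal.coe_ofNat, ← ENNReal.coe_div (by norm_num),
          ← ENNReal.coe_div (by norm_num)]
        norm_cast
        ext
        push_cast
        ring

end

theorem exists_isMollifier_seq {R : ℝ} (hR : 0 < R) : ∃ (ε : ℕ → ℝ) (η : ℕ → ℝ → ℝ),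
    Tendsto ε atTop (𝓝 0) ∧ (∀ n, 0 ≤ ε n) ∧ (∀ n, ε n < R) ∧ ∀ n, IsMollifier (ε n) (η n) := by
  have hpos : ∀ n : ℕ, 0 < R / ((n : ℝ) + 2) := fun n => by positivity
  choose η hη using fun n : ℕ => exists_isMollifier (hpos n)
  refine ⟨_, η, ?_, fun n => (hpos n).le, fun n => ?_, hη⟩
  · have h := (tendsto_const_div_atTop_nhds_zero_nat R).comp (tendsto_add_atTop_nat 2)
    refine h.congr fun n => ?_
    simp
  · rw [div_lt_iff₀ (by positivity)]
    nlinarith [(Nat.cast_nonneg n : (0 : ℝ) ≤ n)]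

end

section

/-! ### Sobolev inequalities on the cube -/

/-- The value at a point exceeds the mean over the interval by at most the total variation. -/
theorem le_integral_add_abs_deriv {R : ℝ} (hR : 0 < R) {g g' : ℝ → ℝ}
    (hg : ∀ t, HasDerivAt g (g' t) t) (hg' : Continuous g') {x : ℝ} (hx : |x| ≤ R) :
    g x ≤ ∫ t in Ioo (-R) R, (g t / (2 * R) + |g' t|) := by
  have hgc : Continuous g := continuous_iff_continuousAt.2 fun t => (hg t).continuousAt
  have hii : ∀ {h : ℝ → ℝ}, Continuous h → IntegrableOn h (Ioo (-R) R) := fun hh =>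
    (hh.continuousOn.integrableOn_compact isCompact_Icc).mono_set Ioo_subset_Icc_self
  set A := ∫ t in Ioo (-R) R, |g' t| with hA
  have hxI := abs_le.1 hx
  have h1 : ∀ s ∈ Ioo (-R) R, g x - A ≤ g s := by
    intro s hs
    have e := intervalIntegral.integral_eq_sub_of_hasDerivAt (a := s) (b := x)
      (fun t _ => hg t) (hg'.intervalIntegrable _ _)
    have h2 : |∫ t in s..x, g' t| ≤ A := by
      rw [← Real.norm_eq_abs]
      refine (intervalIntegral.norm_integral_le_integral_norm_uIoc).trans ?_
      rw [hA, ← integral_Icc_eq_integral_Ioo]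
      refine setIntegral_mono_set (hg'.abs.continuousOn.integrableOn_compact isCompact_Icc)
        (Eventually.of_forall fun _ => abs_nonneg _) (LE.le.eventuallyLE ?_)
      refine uIoc_subset_uIcc.trans (uIcc_subset_Icc ⟨hs.1.le, hs.2.le⟩ ⟨hxI.1, hxI.2⟩)
    rw [e] at h2
    linarith [le_abs_self (g x - g s)]
  have h3 : ∫ _t in Ioo (-R) R, (g x - A) ≤ ∫ t in Ioo (-R) R, g t :=
    setIntegral_mono_on (by simp [IntegrableOn]) (hii hgc) measurableSet_Ioo h1
  have h4 : volume.real (Ioo (-R) R) = 2 * R := by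
    simp [Measure.real]
    rw [ENNReal.toReal_ofReal (by linarith)]; ring
  rw [setIntegral_const, h4, smul_eq_mul] at h3
  rw [integral_add ((hii hgc).div_const _) (hii hg'.abs), integral_div, ← hA]
  rw [← sub_le_iff_le_add, le_div_iff₀ (by positivity)]
  linarith

theorem mem_box_update {R : ℝ} {x : Coord} (hx : x ∈ box R) (i : Fin 3) {t : ℝ}
    (ht : t ∈ Ioo (-R) R) : Function.update x i t ∈ box R := by
  intro j _
  by_cases hj : j = i
  · subst hj; simpa using ht
  · simpa [hj] using hx j trivial

theorem lintegral_enorm_pow_lt_top {R : ℝ} {f : Coord → ℝ} (hf : Continuous f) (n : ℕ) :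
    ∫⁻ x in box R, ‖f x‖ₑ ^ n < ⊤ := by
  obtain ⟨C, -, hC⟩ := exists_bound_box hf R
  calc _ ≤ ∫⁻ _x in box R, ENNReal.ofReal C ^ n := by
        refine setLIntegral_mono' (measurableSet_box R) fun x hx => ?_
        gcongr
        rw [← ofReal_norm]
        exact ENNReal.ofReal_le_ofReal (hC x hx)
    _ < ⊤ := by
        simp only [lintegral_const]
        exact ENNReal.mul_lt_top (by simp) (measure_lt_top _ _)

/-- The sum of the squared `L²` norms of a function and its first derivatives. -/
noncomputable def sumSq (R : ℝ) (u : Coord → ℝ) (w : Fin 3 → Coord → ℝ) : ENNReal :=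
  (∫⁻ x in box R, ‖u x‖ₑ ^ 2) + ∑ i, ∫⁻ x in box R, ‖w i x‖ₑ ^ 2

theorem lintegral_pow_three_mul_le {R : ℝ} {f w : Coord → ℝ} (hf : Continuous f)
    (hw : Continuous w) : ∫⁻ x in box R, ‖f x‖ₑ ^ 3 * ‖w x‖ₑ
      ≤ (∫⁻ x in box R, ‖f x‖ₑ ^ 6) ^ (1 / 2 : ℝ) * (∫⁻ x in box R, ‖w x‖ₑ ^ 2) ^ (1 / 2 : ℝ) := by
  have h := ENNReal.lintegral_mul_norm_pow_le (μ := volume.restrict (box R))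
    (f := fun x => ‖f x‖ₑ ^ 6) (g := fun x => ‖w x‖ₑ ^ 2) (p := 1 / 2) (q := 1 / 2)
    (hf.enorm.measurable.pow_const _).aemeasurable (hw.enorm.measurable.pow_const _).aemeasurable
    (by norm_num) (by norm_num) (by norm_num)
  have e : ∀ x, (‖f x‖ₑ ^ 6) ^ (1 / 2 : ℝ) * (‖w x‖ₑ ^ 2) ^ (1 / 2 : ℝ) = ‖f x‖ₑ ^ 3 * ‖w x‖ₑ := by
    intro x
    rw [← ENNReal.rpow_natCast, ← ENNReal.rpow_natCast ‖w x‖ₑ, ← ENNReal.rpow_mul,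
      ← ENNReal.rpow_mul, ← ENNReal.rpow_natCast ‖f x‖ₑ 3]
    norm_num
  simpa only [e] using h

/-- The Sobolev inequality `‖f‖₆ ≤ C ‖f‖_{H¹}` for smooth functions. -/
theorem lintegral_pow_six_le_of_smooth {R : ℝ} (hR : 0 < R) {f : Coord → ℝ}
    (hf : ContDiff ℝ ∞ f) : ∫⁻ x in box R, ‖f x‖ₑ ^ 6
      ≤ (ENNReal.ofReal (1 / (2 * R)) + 12) ^ 6 * sumSq R f (fun i => dd i f) ^ 3 := by
  set a : ENNReal := ENNReal.ofReal (1 / (2 * R)) with ha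
  have hfc := hf.continuous
  have hdc : ∀ i, Continuous (dd i f) := fun i => (contDiff_dd i hf).continuous
  -- The method of Gagliardo and Nirenberg: F is built so that its integral along every line
  -- parallel to an axis bounds the function |f|⁴ on that line. The terms are the mean value of |f|⁴
  -- and the derivative 4|f|³|∂ᵢf|.
  set F : Coord → ENNReal := (box R).indicator fun x =>
    a * (‖f x‖ₑ ^ 3 * ‖f x‖ₑ) + 4 * ∑ i, ‖f x‖ₑ ^ 3 * ‖dd i f x‖ₑ with hF
  have hFm : Measurable F := by
    refine Measurable.indicator ?_ (measurableSet_box R)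
    have h1 := hfc.enorm.measurable
    have h2 := fun i => (hdc i).enorm.measurable
    exact (((h1.pow_const 3).mul h1).const_mul a).add
      ((Finset.measurable_sum _ fun i _ => (h1.pow_const 3).mul (h2 i)).const_mul 4)
  have hline : ∀ x ∈ box R, ∀ i, ‖f x‖ₑ ^ 4 ≤ ∫⁻ t, F (Function.update x i t) := by
    intro x hx i
    have hd : ∀ t, HasDerivAt (fun t => f (Function.update x i t) ^ 4)
        (4 * f (Function.update x i t) ^ 3 * dd i f (Function.update x i t)) t := by
      intro t
      have h := hasDerivAt_update_dd i (hf.differentiable (by simp) (Function.update x i t))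
      simp only [Function.update_idem, Function.update_self] at h
      simpa using h.fun_pow 4
    have hcu : Continuous fun t => Function.update x i t :=
      continuous_const.update i continuous_id
    have h := le_integral_add_abs_deriv hR hd (by
      exact (continuous_const.mul ((hfc.comp hcu).pow 3)).mul ((hdc i).comp hcu))
      (x := x i) (mem_box.1 hx i).le
    simp only [Function.update_eq_self] at h
    calc ‖f x‖ₑ ^ 4 = ENNReal.ofReal (f x ^ 4) := by
          rw [← ofReal_norm, ← ENNReal.ofReal_pow (norm_nonneg _), Real.norm_eq_abs,
            Even.pow_abs (by decide)]
      _ ≤ ENNReal.ofReal _ := ENNReal.ofReal_le_ofReal h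
      _ ≤ ‖∫ t in Ioo (-R) R, (f (Function.update x i t) ^ 4 / (2 * R)
            + |4 * f (Function.update x i t) ^ 3 * dd i f (Function.update x i t)|)‖ₑ :=
          Real.ofReal_le_enorm _
      _ ≤ _ := enorm_integral_le_lintegral_enorm _
      _ ≤ ∫⁻ t in Ioo (-R) R, F (Function.update x i t) := by
          refine setLIntegral_mono' measurableSet_Ioo fun t ht => ?_
          rw [hF, indicator_of_mem (mem_box_update hx i ht)]
          refine (enorm_add_le _ _).trans (add_le_add (le_of_eq ?_) ?_)
          · rw [div_eq_inv_mul, ← one_div, enorm_mul, ha, Real.enorm_eq_ofReal (by positivity),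
              enorm_pow, pow_succ]
          · rw [← Real.norm_eq_abs, enorm_norm, enorm_mul, enorm_mul, enorm_pow, mul_assoc]
            have : ‖(4 : ℝ)‖ₑ = 4 := by
              rw [Real.enorm_eq_ofReal (by norm_num)]; norm_num
            rw [this]
            gcongr
            exact Finset.single_le_sum
              (f := fun i => ‖f (Function.update x _ t)‖ₑ ^ 3 * ‖dd i f (Function.update x _ t)‖ₑ)
              (fun _ _ => zero_le) (Finset.mem_univ i)
      _ ≤ _ := setLIntegral_le_lintegral _ _
  set I := ∫⁻ x in box R, ‖f x‖ₑ ^ 6 with hI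
  set H := sumSq R f (fun i => dd i f) with hH
  have hIfin : I < ⊤ := lintegral_enorm_pow_lt_top hfc 6
  -- A Loomis–Whitney type inequality for the three families of lines. Each line integral is at
  -- least |f|⁴ and enters with power 1/2, and three such factors make |f|⁶.
  have hLW : I ≤ (∫⁻ x, F x) ^ (3 / 2 : ℝ) := by
    have hconj : Real.HolderConjugate (Fintype.card (Fin 3) : ℝ) (3 / 2) := by
      rw [Real.holderConjugate_iff]; norm_num
    refine le_trans ?_ (lintegral_prod_lintegral_pow_le (fun _ : Fin 3 => volume) hconj hFm)
    refine le_trans ?_ (setLIntegral_le_lintegral (box R) _)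
    refine setLIntegral_mono' (measurableSet_box R) fun x hx => ?_
    calc ‖f x‖ₑ ^ 6 = ∏ _i : Fin 3, (‖f x‖ₑ ^ 4) ^ (1 / 2 : ℝ) := by
          rw [Finset.prod_const, Finset.card_univ, Fintype.card_fin,
            ← ENNReal.rpow_natCast (‖f x‖ₑ) 4, ← ENNReal.rpow_mul, ← ENNReal.rpow_natCast _ 3,
            ← ENNReal.rpow_mul, ← ENNReal.rpow_natCast]
          norm_num
      _ ≤ _ := by
          refine Finset.prod_le_prod' fun i _ => ?_
          have : (1 : ℝ) / ((Fintype.card (Fin 3) : ℝ) - 1) = 1 / 2 := by norm_num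
          rw [this]
          gcongr
          exact hline x hx i
  have hS : ∀ w : Coord → ℝ, Continuous w → (∫⁻ x in box R, ‖w x‖ₑ ^ 2) ≤ H →
      ∫⁻ x in box R, ‖f x‖ₑ ^ 3 * ‖w x‖ₑ ≤ I ^ (1 / 2 : ℝ) * H ^ (1 / 2 : ℝ) := by
    intro w hw hwH
    refine (lintegral_pow_three_mul_le hfc hw).trans ?_
    gcongr
  have hFint : ∫⁻ x, F x ≤ (a + 12) * (I ^ (1 / 2 : ℝ) * H ^ (1 / 2 : ℝ)) := by
    have h1 := hfc.enorm.measurable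
    have h2 := fun i => (hdc i).enorm.measurable
    have m1 : Measurable fun x => ‖f x‖ₑ ^ 3 * ‖f x‖ₑ := (h1.pow_const 3).mul h1
    have m2 : ∀ i, Measurable fun x => ‖f x‖ₑ ^ 3 * ‖dd i f x‖ₑ := fun i =>
      (h1.pow_const 3).mul (h2 i)
    have m3 : Measurable fun x => a * (‖f x‖ₑ ^ 3 * ‖f x‖ₑ) := m1.const_mul a
    rw [hF, lintegral_indicator (measurableSet_box R), lintegral_add_left m3,
      lintegral_const_mul a m1, lintegral_const_mul 4 (Finset.measurable_fun_sum _ fun i _ => m2 i),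
      lintegral_finsetSum _ fun i _ => m2 i, add_mul]
    have h3 : ∑ i, ∫⁻ x in box R, ‖f x‖ₑ ^ 3 * ‖dd i f x‖ₑ
        ≤ ∑ _i : Fin 3, I ^ (1 / 2 : ℝ) * H ^ (1 / 2 : ℝ) := by
      refine Finset.sum_le_sum fun i _ => hS _ (hdc i) ?_
      exact (Finset.single_le_sum (f := fun i => ∫⁻ x in box R, ‖dd i f x‖ₑ ^ 2)
        (fun _ _ => zero_le) (Finset.mem_univ i)).trans le_add_self
    refine add_le_add (mul_le_mul_right (hS f hfc le_self_add) _) ?_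
    calc _ ≤ 4 * ∑ _i : Fin 3, I ^ (1 / 2 : ℝ) * H ^ (1 / 2 : ℝ) := by gcongr
      _ = _ := by
          rw [Finset.sum_const, Finset.card_univ, Fintype.card_fin, nsmul_eq_mul, ← mul_assoc]
          norm_num
  by_cases hI0 : I = 0
  · rw [hI0]; exact zero_le
  -- Cauchy–Schwarz has bounded the integral of F by a multiple of I^(1/2) H^(1/2), so the previous
  -- inequality contains I^(3/4) on the right. That factor may be cancelled because I is neither
  -- zero nor infinite.
  have hkey : I ^ (3 / 4 : ℝ) * I ^ (1 / 4 : ℝ)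
      ≤ I ^ (3 / 4 : ℝ) * ((a + 12) ^ (3 / 2 : ℝ) * H ^ (3 / 4 : ℝ)) := by
    rw [← ENNReal.rpow_add _ _ hI0 hIfin.ne]
    norm_num
    refine hLW.trans ((ENNReal.rpow_le_rpow hFint (by norm_num)).trans (le_of_eq ?_))
    rw [ENNReal.mul_rpow_of_nonneg _ _ (by norm_num), ENNReal.mul_rpow_of_nonneg _ _ (by norm_num),
      ← ENNReal.rpow_mul, ← ENNReal.rpow_mul]
    norm_num
    ring
  have hc0 : I ^ (3 / 4 : ℝ) ≠ 0 := by
    simp only [ne_eq, ENNReal.rpow_eq_zero_iff, hI0, false_and, false_or, not_and]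
    exact fun h => absurd h hIfin.ne
  have hct : I ^ (3 / 4 : ℝ) ≠ ⊤ := ENNReal.rpow_ne_top_of_nonneg (by norm_num) hIfin.ne
  have hfin := (ENNReal.mul_le_mul_iff_right hc0 hct).1 hkey
  calc I = (I ^ (1 / 4 : ℝ)) ^ (4 : ℝ) := by rw [← ENNReal.rpow_mul]; norm_num
    _ ≤ ((a + 12) ^ (3 / 2 : ℝ) * H ^ (3 / 4 : ℝ)) ^ (4 : ℝ) := by gcongr
    _ = _ := by
        rw [ENNReal.mul_rpow_of_nonneg _ _ (by norm_num), ← ENNReal.rpow_mul, ← ENNReal.rpow_mul,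
          ← ENNReal.rpow_natCast, ← ENNReal.rpow_natCast]
        norm_num

theorem lintegral_smoothing_sq_le {R ε : ℝ} {η : ℝ → ℝ} {σ : Fin 3 → ℝ} (hη : IsMollifier ε η)
    (hσ : ∀ j, |σ j| ≤ 1) {f : Coord → ℝ}
    (hf : AEStronglyMeasurable f (volume.restrict (box R))) (n : ℕ) (hn : 1 ≤ n) :
    ∫⁻ x in box R, ‖smoothing R η σ f x‖ₑ ^ n ≤ 27 ^ n * ∫⁻ y in box R, ‖f y‖ₑ ^ n := by
  have := lintegral_smoothing_le (p := n) hη hσ hf (by exact_mod_cast hn)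
  simpa only [ENNReal.rpow_natCast] using this

theorem abs_one_le (j : Fin 3) : |(fun _ => 1 : Fin 3 → ℝ) j| ≤ 1 := by simp

theorem abs_flip_le {σ : Fin 3 → ℝ} (hσ : ∀ j, |σ j| ≤ 1) (i j : Fin 3) : |flip i σ j| ≤ 1 := by
  unfold flip
  by_cases hj : j = i
  · subst hj; simpa using hσ j
  · simpa [hj] using hσ j

/-- Pointwise almost everywhere convergence of the smoothings along a subsequence. -/
theorem exists_smoothing_seq {R : ℝ} (hR : 0 < R) {u : Coord → ℝ} {w : Fin 3 → Coord → ℝ}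
    (hu : MemLp u 2 (volume.restrict (box R))) (hw : ∀ i, MemLp (w i) 2 (volume.restrict (box R)))
    (h : ∀ i, WeakPartial R i u (w i)) :
    ∃ f : ℕ → Coord → ℝ, (∀ n, ContDiff ℝ ∞ (f n)) ∧
      (∀ᵐ x ∂(volume.restrict (box R)), Tendsto (fun n => f n x) atTop (𝓝 (u x))) ∧
      (∀ n k, 1 ≤ k → ∫⁻ x in box R, ‖f n x‖ₑ ^ k ≤ 27 ^ k * ∫⁻ x in box R, ‖u x‖ₑ ^ k) ∧
      ∀ n k i, 1 ≤ k → ∫⁻ x in box R, ‖dd i (f n) x‖ₑ ^ k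
        ≤ 27 ^ k * ∫⁻ x in box R, ‖w i x‖ₑ ^ k := by
  obtain ⟨ε, η, hε, hε0, hεR, hη⟩ := exists_isMollifier_seq hR
  have hui := integrableOn_of_memLp_two hu
  have hlim := tendsto_smoothing hε hε0 hη abs_one_le hu
  have hmeas := tendstoInMeasure_of_tendsto_eLpNorm (by norm_num)
    (fun n => (memLp_smoothing (σ := fun _ => 1) (hη n) hui 2).1) hu.1 hlim
  obtain ⟨ns, -, hns⟩ := hmeas.exists_seq_tendsto_ae
  refine ⟨fun n => smoothing R (η (ns n)) (fun _ => 1) u, fun n => contDiff_smoothing (hη _) hui,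
    hns, fun n k hk => lintegral_smoothing_sq_le (hη _) abs_one_le hu.1 k hk, fun n k i hk => ?_⟩
  refine le_trans (le_of_eq ?_) (lintegral_smoothing_sq_le (hη (ns n))
    (abs_flip_le abs_one_le i) (hw i).1 k hk)
  refine setLIntegral_congr_fun (measurableSet_box R) fun x hx => ?_
  simp only
  rw [(h i).dd_smoothing (hη _) (hεR _) hR hui (integrableOn_of_memLp_two (hw i)) rfl
    (mem_box.1 hx i).le]

/-- The Sobolev inequality `‖u‖₆ ≤ C ‖u‖_{H¹}` on the cube. -/
theorem exists_sobolev_six {R : ℝ} (hR : 0 < R) : ∃ K : ENNReal, K ≠ ⊤ ∧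
    ∀ (u : Coord → ℝ) (w : Fin 3 → Coord → ℝ), MemLp u 2 (volume.restrict (box R)) →
      (∀ i, MemLp (w i) 2 (volume.restrict (box R))) → (∀ i, WeakPartial R i u (w i)) →
      ∫⁻ x in box R, ‖u x‖ₑ ^ 6 ≤ K * sumSq R u w ^ 3 := by
  refine ⟨(ENNReal.ofReal (1 / (2 * R)) + 12) ^ 6 * (27 ^ 2) ^ 3, by finiteness, ?_⟩
  intro u w hu hw h
  obtain ⟨f, hf, hlim, h0, h1⟩ := exists_smoothing_seq hR hu hw h
  have hb : ∀ n, ∫⁻ x in box R, ‖f n x‖ₑ ^ 6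
      ≤ (ENNReal.ofReal (1 / (2 * R)) + 12) ^ 6 * (27 ^ 2) ^ 3 * sumSq R u w ^ 3 := by
    intro n
    refine (lintegral_pow_six_le_of_smooth hR (hf n)).trans ?_
    rw [mul_assoc, ← mul_pow (27 ^ 2)]
    gcongr
    rw [sumSq, sumSq, mul_add, Finset.mul_sum]
    exact add_le_add (h0 n 2 (by norm_num)) (Finset.sum_le_sum fun i _ => h1 n 2 i (by norm_num))
  -- Fatou's lemma along an almost everywhere convergent sequence of smoothings. No convergence in
  -- L⁶ is assumed.
  calc ∫⁻ x in box R, ‖u x‖ₑ ^ 6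
      = ∫⁻ x in box R, liminf (fun n => ‖f n x‖ₑ ^ 6) atTop := by
        refine lintegral_congr_ae ?_
        filter_upwards [hlim] with x hx
        refine (Tendsto.liminf_eq ?_).symm
        exact ((ENNReal.continuous_pow 6).tendsto _).comp ((continuous_enorm.tendsto _).comp hx)
    _ ≤ liminf (fun n => ∫⁻ x in box R, ‖f n x‖ₑ ^ 6) atTop :=
        lintegral_liminf_le fun n => ((hf n).continuous.enorm.measurable.pow_const 6)
    _ ≤ _ := by
        refine liminf_le_of_frequently_le' (Frequently.of_forall hb)

/-! ### Morrey's inequality by averaging over segments -/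

theorem lintegral_comp_add_smul {G : Coord → ENNReal} (hG : Measurable G) (c : Coord) {s : ℝ}
    (hs : s ≠ 0) : ∫⁻ y, G (c + s • y) = ENNReal.ofReal (|(s ^ 3)⁻¹|) * ∫⁻ y, G y := by
  have h1 : ∫⁻ y, G (c + s • y) = ∫⁻ z, G (c + z) ∂(Measure.map (s • ·) (volume : Measure Coord)) :=
    (lintegral_map (hG.comp (measurable_const_add c)) (measurable_const_smul s)).symm
  rw [h1, Measure.map_addHaar_smul _ hs, lintegral_smul_measure, lintegral_add_left_eq_self G c]
  simp

theorem lintegral_le_pow_six {R : ℝ} {g : Coord → ENNReal} (hg : Measurable g) :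
    ∫⁻ y in box R, g y
      ≤ volume (box R) ^ (5 / 6 : ℝ) * (∫⁻ y in box R, g y ^ 6) ^ (1 / 6 : ℝ) := by
  have h := ENNReal.lintegral_mul_norm_pow_le (μ := volume.restrict (box R))
    (f := fun _ => (1 : ENNReal)) (g := fun y => g y ^ 6) (p := 5 / 6) (q := 1 / 6)
    aemeasurable_const (hg.pow_const _).aemeasurable (by norm_num) (by norm_num) (by norm_num)
  have e : ∀ y, (1 : ENNReal) ^ (5 / 6 : ℝ) * (g y ^ 6) ^ (1 / 6 : ℝ) = g y := by
    intro y
    rw [ENNReal.one_rpow, one_mul, ← ENNReal.rpow_natCast, ← ENNReal.rpow_mul]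
    norm_num
  simp only [e] at h
  simpa using h

theorem convex_box (R : ℝ) : Convex ℝ (box R) := convex_pi fun _ _ => convex_Ioo _ _

/-- Integrals over the homothetic images of the cube with respect to one of its points. -/
theorem lintegral_homothety_le {R : ℝ} {w : Coord → ℝ} (hw : Continuous w) {x : Coord}
    (hx : x ∈ box R) {s : ℝ} (hs : s ∈ Ioo (0 : ℝ) 1) :
    ∫⁻ y in box R, ‖w (x + s • (y - x))‖ₑ ≤ ENNReal.ofReal (s ^ (-(1 / 2) : ℝ))
      * (volume (box R) ^ (5 / 6 : ℝ) * (∫⁻ y in box R, ‖w y‖ₑ ^ 6) ^ (1 / 6 : ℝ)) := by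
  have hm : Measurable fun y => ‖w (x + s • (y - x))‖ₑ := by
    have : Continuous fun y => w (x + s • (y - x)) := hw.comp (by fun_prop)
    exact this.enorm.measurable
  set G : Coord → ENNReal := (box R).indicator fun z => ‖w z‖ₑ ^ 6 with hG
  have hGm : Measurable G := (hw.enorm.measurable.pow_const 6).indicator (measurableSet_box R)
  have h1 : ∫⁻ y in box R, ‖w (x + s • (y - x))‖ₑ ^ 6
      ≤ ENNReal.ofReal (|(s ^ 3)⁻¹|) * ∫⁻ y in box R, ‖w y‖ₑ ^ 6 := by
    calc _ ≤ ∫⁻ y in box R, G ((x - s • x) + s • y) := by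
          refine setLIntegral_mono' (measurableSet_box R) fun y hy => ?_
          have e : x + s • (y - x) = (x - s • x) + s • y := by module
          have hmem : (x - s • x) + s • y ∈ box R := by
            have := convex_box R hx hy (a := 1 - s) (b := s) (by linarith [hs.2]) hs.1.le (by ring)
            convert this using 1
            module
          rw [e, hG, indicator_of_mem hmem]
      _ ≤ ∫⁻ y, G ((x - s • x) + s • y) := setLIntegral_le_lintegral _ _
      _ = _ := by
          rw [lintegral_comp_add_smul hGm _ hs.1.ne', hG, lintegral_indicator (measurableSet_box R)]
  refine (lintegral_le_pow_six hm).trans ?_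
  have h2 := ENNReal.rpow_le_rpow h1 (show (0 : ℝ) ≤ 1 / 6 by norm_num)
  rw [ENNReal.mul_rpow_of_nonneg _ _ (by norm_num)] at h2
  -- The homothety of ratio s has Jacobian s³. After the sixth root it costs s^(-1/2), which is
  -- integrable at zero; this is where an exponent above the dimension 3 is used.
  have e : ENNReal.ofReal (|(s ^ 3)⁻¹|) ^ (1 / 6 : ℝ) = ENNReal.ofReal (s ^ (-(1 / 2) : ℝ)) := by
    have hp : 0 < s := hs.1
    rw [ENNReal.ofReal_rpow_of_nonneg (abs_nonneg _) (by norm_num), abs_of_pos (by positivity),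
      ← Real.rpow_natCast, ← Real.rpow_neg hp.le, ← Real.rpow_mul hp.le]
    norm_num
  rw [e] at h2
  calc _ ≤ volume (box R) ^ (5 / 6 : ℝ) * (ENNReal.ofReal (s ^ (-(1 / 2) : ℝ))
        * (∫⁻ y in box R, ‖w y‖ₑ ^ 6) ^ (1 / 6 : ℝ)) := by gcongr
    _ = _ := by ring

theorem lintegral_rpow_neg_half_lt_top :
    ∫⁻ s in Ioo (0 : ℝ) 1, ENNReal.ofReal (s ^ (-(1 / 2) : ℝ)) < ⊤ := by
  have h : IntegrableOn (fun s : ℝ => s ^ (-(1 / 2) : ℝ)) (Ioo 0 1) :=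
    (intervalIntegral.integrableOn_Ioo_rpow_iff one_pos).2 (by norm_num)
  exact h.lintegral_lt_top

/-- The fundamental theorem of calculus on a segment in the cube. -/
theorem enorm_le_segment {R : ℝ} {f : Coord → ℝ} (hf : ContDiff ℝ ∞ f) {x y : Coord}
    (hx : x ∈ box R) (hy : y ∈ box R) : ‖f x‖ₑ ≤ ‖f y‖ₑ
      + ENNReal.ofReal (2 * R) * ∑ i, ∫⁻ s in Ioo (0 : ℝ) 1, ‖dd i f (x + s • (y - x))‖ₑ := by
  have hd : ∀ s : ℝ, HasDerivAt (fun s : ℝ => f (x + s • (y - x)))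
      (∑ i, (y - x) i * dd i f (x + s • (y - x))) s := by
    intro s
    have h1 : HasDerivAt (fun s : ℝ => x + s • (y - x)) (y - x) s := by
      simpa using ((hasDerivAt_id s).smul_const (y - x)).const_add x
    have h2 := (hf.differentiable (by simp) (x + s • (y - x))).hasFDerivAt.comp_hasDerivAt s h1
    rwa [fderiv_apply_eq_sum_dd] at h2
  have hc : ∀ i, Continuous fun s : ℝ => dd i f (x + s • (y - x)) := fun i =>
    (contDiff_dd i hf).continuous.comp (by fun_prop)
  have e := intervalIntegral.integral_eq_sub_of_hasDerivAt (a := 0) (b := 1) (fun t _ => hd t)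
    ((continuous_finsetSum _ fun i _ => continuous_const.mul (hc i)).intervalIntegrable _ _)
  simp only [one_smul, add_sub_cancel, zero_smul, add_zero] at e
  have hle : f x = f y - ∫ s in (0 : ℝ)..1, ∑ i, (y - x) i * dd i f (x + s • (y - x)) := by
    rw [e]; ring
  rw [hle]
  refine (enorm_sub_le).trans (add_le_add le_rfl ?_)
  rw [intervalIntegral.integral_of_le zero_le_one, integral_Ioc_eq_integral_Ioo]
  refine (enorm_integral_le_lintegral_enorm _).trans ?_
  rw [Finset.mul_sum]
  calc _ ≤ ∫⁻ s in Ioo (0 : ℝ) 1, ∑ i, ENNReal.ofReal (2 * R) * ‖dd i f (x + s • (y - x))‖ₑ := by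
        refine lintegral_mono fun s => (enorm_sum_le _ _).trans (Finset.sum_le_sum fun i _ => ?_)
        rw [enorm_mul]
        gcongr
        rw [← ofReal_norm]
        refine ENNReal.ofReal_le_ofReal ?_
        have h1 := abs_lt.1 (mem_box.1 hx i)
        have h2 := abs_lt.1 (mem_box.1 hy i)
        rw [Real.norm_eq_abs, Pi.sub_apply]
        exact abs_le.2 ⟨by linarith, by linarith⟩
    _ = _ := by
        rw [lintegral_finsetSum _ fun i _ => (hc i).enorm.measurable.const_mul _]
        exact Finset.sum_congr rfl fun i _ => lintegral_const_mul _ (hc i).enorm.measurable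

/-- Morrey's inequality for smooth functions on the cube. -/
theorem exists_morrey_of_smooth {R : ℝ} (hR : 0 < R) : ∃ K : ENNReal, K ≠ ⊤ ∧
    ∀ f : Coord → ℝ, ContDiff ℝ ∞ f → ∀ x ∈ box R,
      ‖f x‖ₑ ≤ K * ((∫⁻ y in box R, ‖f y‖ₑ ^ 6) ^ (1 / 6 : ℝ)
        + ∑ i, (∫⁻ y in box R, ‖dd i f y‖ₑ ^ 6) ^ (1 / 6 : ℝ)) := by
  set v := volume (box R) with hv
  have hv0 : v ≠ 0 := by
    have : (0 : Coord) ∈ box R := mem_box.2 fun i => by simpa using hR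
    exact ((isOpen_box R).measure_pos volume ⟨0, this⟩).ne'
  have hvt : v ≠ ⊤ := (volume_box_lt_top R).ne
  set c := ∫⁻ s in Ioo (0 : ℝ) 1, ENNReal.ofReal (s ^ (-(1 / 2) : ℝ)) with hc
  have hct : c ≠ ⊤ := lintegral_rpow_neg_half_lt_top.ne
  set q := v ^ (5 / 6 : ℝ) with hq
  have hqt : q ≠ ⊤ := ENNReal.rpow_ne_top_of_nonneg (by norm_num) hvt
  refine ⟨v⁻¹ * (q * (1 + ENNReal.ofReal (2 * R) * c)), ?_, ?_⟩
  · exact ENNReal.mul_ne_top (ENNReal.inv_ne_top.2 hv0) (by finiteness)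
  intro f hf x hx
  have hdc : ∀ i, Continuous (dd i f) := fun i => (contDiff_dd i hf).continuous
  set A := (∫⁻ y in box R, ‖f y‖ₑ ^ 6) ^ (1 / 6 : ℝ) with hA
  set B : Fin 3 → ENNReal := fun i => (∫⁻ y in box R, ‖dd i f y‖ₑ ^ 6) ^ (1 / 6 : ℝ) with hB
  have hcm : ∀ i, Continuous (Function.uncurry fun (y : Coord) (s : ℝ) =>
      dd i f (x + s • (y - x))) := fun i => (hdc i).comp (by fun_prop)
  -- The estimate along the segment from x to y is integrated over all y in the cube, and the order
  -- of integration in y and s is exchanged.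
  have h1 : v * ‖f x‖ₑ ≤ q * A + ENNReal.ofReal (2 * R) * ∑ i, c * (q * B i) := by
    calc v * ‖f x‖ₑ = ∫⁻ _y in box R, ‖f x‖ₑ := by
          rw [lintegral_const, Measure.restrict_apply_univ, mul_comm]
      _ ≤ ∫⁻ y in box R, (‖f y‖ₑ + ENNReal.ofReal (2 * R)
            * ∑ i, ∫⁻ s in Ioo (0 : ℝ) 1, ‖dd i f (x + s • (y - x))‖ₑ) :=
          setLIntegral_mono' (measurableSet_box R) fun y hy => enorm_le_segment hf hx hy
      _ = (∫⁻ y in box R, ‖f y‖ₑ) + ENNReal.ofReal (2 * R)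
            * ∑ i, ∫⁻ y in box R, ∫⁻ s in Ioo (0 : ℝ) 1, ‖dd i f (x + s • (y - x))‖ₑ := by
          rw [lintegral_add_left hf.continuous.enorm.measurable, lintegral_const_mul' _ _ ENNReal.ofReal_ne_top,
            lintegral_finsetSum]
          exact fun i _ => (hcm i).enorm.measurable.lintegral_prod_right'
      _ ≤ _ := by
          refine add_le_add (lintegral_le_pow_six hf.continuous.enorm.measurable) ?_
          refine mul_le_mul_right (Finset.sum_le_sum fun i _ => ?_) _
          rw [lintegral_lintegral_swap (hcm i).enorm.measurable.aemeasurable]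
          calc _ ≤ ∫⁻ s in Ioo (0 : ℝ) 1, ENNReal.ofReal (s ^ (-(1 / 2) : ℝ)) * (q * B i) :=
                setLIntegral_mono' measurableSet_Ioo fun s hs =>
                  lintegral_homothety_le (hdc i) hx hs
            _ ≤ _ := by
                rw [lintegral_mul_const]
                fun_prop
  calc ‖f x‖ₑ = v⁻¹ * (v * ‖f x‖ₑ) := by
        rw [← mul_assoc, ENNReal.inv_mul_cancel hv0 hvt, one_mul]
    _ ≤ v⁻¹ * (q * A + ENNReal.ofReal (2 * R) * ∑ i, c * (q * B i)) := by gcongr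
    _ ≤ v⁻¹ * ((q * (1 + ENNReal.ofReal (2 * R) * c)) * (A + ∑ i, B i)) := by
        gcongr
        rw [← Finset.mul_sum, ← Finset.mul_sum]
        calc _ ≤ q * A + ENNReal.ofReal (2 * R) * (c * (q * ∑ i, B i))
              + (q * (ENNReal.ofReal (2 * R) * c) * A + q * ∑ i, B i) := le_self_add
          _ = _ := by ring
    _ = _ := by ring

/-- Functions with second weak derivatives in `L²` are bounded. -/
theorem exists_sobolev_bounded {R : ℝ} (hR : 0 < R) : ∃ K : ENNReal, K ≠ ⊤ ∧
    ∀ (u : Coord → ℝ) (w : Fin 3 → Coord → ℝ) (w' : Fin 3 → Fin 3 → Coord → ℝ),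
      MemLp u 2 (volume.restrict (box R)) → (∀ i, MemLp (w i) 2 (volume.restrict (box R))) →
      (∀ i j, MemLp (w' i j) 2 (volume.restrict (box R))) → (∀ i, WeakPartial R i u (w i)) →
      (∀ i j, WeakPartial R j (w i) (w' i j)) → ∀ᵐ x ∂(volume.restrict (box R)),
        ‖u x‖ₑ ≤ K * (sumSq R u w ^ (1 / 2 : ℝ) + ∑ i, sumSq R (w i) (w' i) ^ (1 / 2 : ℝ)) := by
  obtain ⟨K, hK, hsob⟩ := exists_sobolev_six hR
  obtain ⟨K', hK', hmor⟩ := exists_morrey_of_smooth hR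
  refine ⟨K' * (27 * K ^ (1 / 6 : ℝ)), by finiteness, ?_⟩
  intro u w w' hu hw hw' h1 h2
  obtain ⟨f, hf, hlim, h3, h4⟩ := exists_smoothing_seq hR hu hw h1
  have hr : ∀ {A B H : ENNReal}, A ≤ 27 ^ 6 * B → B ≤ K * H ^ 3 →
      A ^ (1 / 6 : ℝ) ≤ 27 * K ^ (1 / 6 : ℝ) * H ^ (1 / 2 : ℝ) := by
    intro A B H hAB hBH
    calc A ^ (1 / 6 : ℝ) ≤ (27 ^ 6 * (K * H ^ 3)) ^ (1 / 6 : ℝ) := by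
          gcongr
          exact hAB.trans (by gcongr)
      _ = _ := by
          rw [ENNReal.mul_rpow_of_nonneg _ _ (by norm_num),
            ENNReal.mul_rpow_of_nonneg _ _ (by norm_num), ← ENNReal.rpow_natCast,
            ← ENNReal.rpow_natCast H, ← ENNReal.rpow_mul, ← ENNReal.rpow_mul, ← mul_assoc]
          norm_num
  -- Morrey's inequality asks for L⁶ bounds of fₙ and its gradient. Smoothing is bounded in L⁶, and
  -- the Sobolev inequality applied to u and to each first derivative supplies them.
  have hb : ∀ n, ∀ x ∈ box R, ‖f n x‖ₑ ≤ K' * (27 * K ^ (1 / 6 : ℝ))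
      * (sumSq R u w ^ (1 / 2 : ℝ) + ∑ i, sumSq R (w i) (w' i) ^ (1 / 2 : ℝ)) := by
    intro n x hx
    refine (hmor (f n) (hf n) x hx).trans ?_
    rw [mul_assoc]
    gcongr
    rw [mul_add, Finset.mul_sum]
    refine add_le_add (hr (h3 n 6 (by norm_num)) (hsob u w hu hw h1))
      (Finset.sum_le_sum fun i _ => ?_)
    exact hr (h4 n 6 i (by norm_num)) (hsob (w i) (w' i) (hw i) (hw' i) (h2 i))
  filter_upwards [hlim, ae_restrict_mem (measurableSet_box R)] with x hx hxb
  exact le_of_tendsto ((continuous_enorm.tendsto _).comp hx) (Eventually.of_forall fun n => hb n x hxb)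

end

section

/-! ### The Carleman estimate for smooth functions -/

theorem box_ae_eq_Icc (R : ℝ) :
    box R =ᵐ[volume] Icc (fun _ => -R : Coord) (fun _ => R) :=
  Measure.univ_pi_Ioo_ae_eq_Icc (μ := fun _ : Fin 3 => volume)

theorem integrableOn_box_of_continuous {f : Coord → ℝ} (hf : Continuous f) (R : ℝ) :
    IntegrableOn f (box R) :=
  (hf.continuousOn.integrableOn_compact isCompact_Icc).mono_set (box_subset_Icc R)

theorem integral_face_le {R B : ℝ} (hR : 0 < R) {g : (Fin 2 → ℝ) → ℝ} (hg : Continuous g)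
    (h : ∀ y ∈ Icc (fun _ => -R : Fin 2 → ℝ) (fun _ => R), g y ≤ B) :
    ∫ y in Icc (fun _ => -R : Fin 2 → ℝ) (fun _ => R), g y ≤ (2 * R) ^ 2 * B := by
  have hint := hg.continuousOn.integrableOn_compact (μ := volume)
    (isCompact_Icc (a := (fun _ => -R : Fin 2 → ℝ)) (b := fun _ => R))
  calc _ ≤ ∫ _y in Icc (fun _ => -R : Fin 2 → ℝ) (fun _ => R), B :=
        setIntegral_mono_on hint (integrableOn_const isCompact_Icc.measure_lt_top.ne) measurableSet_Icc h
    _ = _ := by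
        rw [setIntegral_const, smul_eq_mul, Measure.real, Real.volume_Icc_pi_toReal]
        · simp only [sub_neg_eq_add, Finset.prod_const, Finset.card_univ, Fintype.card_fin]
          ring
        · intro i; simp only; linarith

/-- The integral of a divergence whose flux through the lower face is bounded. -/
theorem le_integral_divergence {R B : ℝ} (hR : 0 < R) {G : Fin 3 → Coord → ℝ}
    (hG : ∀ i, ContDiff ℝ ∞ (G i))
    (h0 : ∀ x ∈ Icc (fun _ => -R : Coord) (fun _ => R), |x 0| = R → G 0 x = 0)
    (h1 : ∀ x ∈ Icc (fun _ => -R : Coord) (fun _ => R), |x 1| = R → G 1 x = 0)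
    (h2 : ∀ x ∈ Icc (fun _ => -R : Coord) (fun _ => R), x 2 = R → 0 ≤ G 2 x)
    (h3 : ∀ x ∈ Icc (fun _ => -R : Coord) (fun _ => R), x 2 = -R → G 2 x ≤ B) :
    -((2 * R) ^ 2 * B) ≤ ∫ x in box R, ∑ i, dd i (G i) x := by
  have hle : (fun _ => -R : Coord) ≤ fun _ => R := fun _ => by simp only; linarith
  have hd := integral_divergence_of_hasFDerivAt_off_countable' (fun _ => -R : Fin 3 → ℝ)
    (fun _ => R) hle G (fun i => fderiv ℝ (G i)) ∅ countable_empty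
    (fun i => (hG i).continuous.continuousOn)
    (fun x _ i => ((hG i).differentiable (by simp) x).hasFDerivAt)
    (by
      refine Continuous.integrableOn_Icc ?_
      exact continuous_finsetSum _ fun i _ => (contDiff_dd i (hG i)).continuous)
  -- The divergence theorem is available on the closed cube, which differs from the open one by a
  -- null set.
  rw [setIntegral_congr_set (box_ae_eq_Icc R)]
  change (∫ x in Icc (fun _ => -R : Coord) (fun _ => R), ∑ i, dd i (G i) x) = _ at hd
  rw [hd, Fin.sum_univ_three]
  have hmem : ∀ (i : Fin 3) (s : ℝ), |s| = R → ∀ y ∈ Icc (fun _ => -R : Fin 2 → ℝ) (fun _ => R),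
      (i.insertNth s y : Coord) ∈ Icc (fun _ => -R : Coord) (fun _ => R) := by
    intro i s hs y hy
    obtain ⟨hs1, hs2⟩ := abs_le.1 hs.le
    refine ⟨fun j => ?_, fun j => ?_⟩
    · rcases eq_or_ne j i with rfl | hj
      · simpa using hs1
      · obtain ⟨k, rfl⟩ := Fin.exists_succAbove_eq hj
        simpa using hy.1 k
    · rcases eq_or_ne j i with rfl | hj
      · simpa using hs2
      · obtain ⟨k, rfl⟩ := Fin.exists_succAbove_eq hj
        simpa using hy.2 k
  have habs : |R| = R := abs_of_pos hR
  have habs' : |-R| = R := by rw [abs_neg, habs]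
  have hcomp : ∀ (i : Fin 3) (c : ℝ), ((fun _ => c : Fin 3 → ℝ) ∘ i.succAbove) = fun _ => c :=
    fun i c => rfl
  have hz : ∀ (i : Fin 3) (s : ℝ), |s| = R →
      (∀ x ∈ Icc (fun _ => -R : Coord) (fun _ => R), |x i| = R → G i x = 0) →
      ∫ y in Icc (fun _ => -R : Fin 2 → ℝ) (fun _ => R), G i (i.insertNth s y) = 0 := by
    intro i s hs h
    refine setIntegral_eq_zero_of_forall_eq_zero fun y hy => h _ (hmem i s hs y hy) ?_
    simpa using hs
  have hcont : ∀ (i : Fin 3) (s : ℝ), Continuous fun y : Fin 2 → ℝ => G i (i.insertNth s y) :=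
    fun i s => (hG i).continuous.comp (continuous_const.finInsertNth i continuous_id)
  simp only [hcomp]
  rw [hz 0 R habs h0, hz 0 (-R) habs' h0, hz 1 R habs h1, hz 1 (-R) habs' h1]
  have t1 : 0 ≤ ∫ y in Icc (fun _ => -R : Fin 2 → ℝ) (fun _ => R),
      G 2 ((2 : Fin 3).insertNth R y) :=
    setIntegral_nonneg measurableSet_Icc fun y hy => h2 _ (hmem 2 R habs y hy) (by simp)
  have t2 : ∫ y in Icc (fun _ => -R : Fin 2 → ℝ) (fun _ => R),
      G 2 ((2 : Fin 3).insertNth (-R) y) ≤ (2 * R) ^ 2 * B :=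
    integral_face_le hR (hcont 2 (-R)) fun y hy => h3 _ (hmem 2 (-R) habs' y hy) (by simp)
  linarith

theorem dd_eq_of_hasDerivAt {f : Coord → ℝ} {x : Coord} {i : Fin 3} {d : ℝ}
    (hf : ContDiff ℝ ∞ f) (h : HasDerivAt (fun t => f (Function.update x i t)) d (x i)) :
    dd i f x = d :=
  (hasDerivAt_update_dd i (hf.differentiable (by simp) x)).unique h

theorem dd_comm {f : Coord → ℝ} (hf : ContDiff ℝ ∞ f) (i j : Fin 3) (x : Coord) :
    dd i (dd j f) x = dd j (dd i f) x := by
  have hs : IsSymmSndFDerivAt ℝ f x := hf.contDiffAt.isSymmSndFDerivAt (by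
    simp only [minSmoothness_of_isRCLikeNormedField]; exact WithTop.coe_le_coe.2 le_top)
  have key : ∀ i j : Fin 3, dd i (dd j f) x
      = fderiv ℝ (fderiv ℝ f) x (Pi.single i 1) (Pi.single j 1) := by
    intro i j
    have h1 : ContDiff ℝ ∞ (fderiv ℝ f) := hf.fderiv_right (by simp)
    have h2 := (h1.differentiable (by simp) x).hasFDerivAt
    have h3 : HasFDerivAt (dd j f) ((ContinuousLinearMap.apply ℝ ℝ (Pi.single j (1 : ℝ) : Coord)).comp
        (fderiv ℝ (fderiv ℝ f) x)) x :=
      ((ContinuousLinearMap.apply ℝ ℝ (Pi.single j (1 : ℝ) : Coord)).hasFDerivAt).comp x h2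
    rw [dd_eq_of_hasFDerivAt i h3]
    rfl
  rw [key, key, hs.eq]

/-- Tangential derivatives of functions that vanish on planes vanish there. -/
theorem dd_eq_zero_of_vanishing {R : ℝ} {f : Coord → ℝ} (hf : ContDiff ℝ ∞ f) {i j : Fin 3}
    (hij : j ≠ i) (h : ∀ x, |x i| = R → f x = 0) : ∀ x, |x i| = R → dd j f x = 0 := by
  intro x hx
  refine dd_eq_of_hasDerivAt hf ?_
  have : (fun t => f (Function.update x j t)) = fun _ => 0 := by
    funext t
    exact h _ (by rw [Function.update_of_ne hij.symm]; exact hx)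
  rw [this]
  exact hasDerivAt_const _ _

/-- The Carleman weight. -/
noncomputable def wt (lam r : ℝ) (x : Coord) : ℝ := Real.exp (2 * lam * (x 2 - r) ^ 2)

/-- The logarithmic derivative of the square root of the Carleman weight. -/
def wp (lam r : ℝ) (x : Coord) : ℝ := 2 * lam * (x 2 - r)

theorem contDiff_wt (lam r : ℝ) : ContDiff ℝ ∞ (wt lam r) := by
  unfold wt
  have : ContDiff ℝ ∞ fun x : Coord => x 2 := contDiff_apply ℝ ℝ 2
  fun_prop

theorem contDiff_wp (lam r : ℝ) : ContDiff ℝ ∞ (wp lam r) := by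
  unfold wp
  have : ContDiff ℝ ∞ fun x : Coord => x 2 := contDiff_apply ℝ ℝ 2
  fun_prop

theorem wt_pos (lam r : ℝ) (x : Coord) : 0 < wt lam r x := Real.exp_pos _

section line
variable (lam r : ℝ) (x : Coord)

theorem hasDerivAt_wp_two :
    HasDerivAt (fun t => wp lam r (Function.update x 2 t)) (2 * lam) (x 2) := by
  unfold wp
  simp only [Function.update_self]
  simpa using ((hasDerivAt_id (x 2)).sub_const r).const_mul (2 * lam)

theorem hasDerivAt_wt_two :
    HasDerivAt (fun t => wt lam r (Function.update x 2 t)) (2 * wp lam r x * wt lam r x) (x 2) := by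
  unfold wp wt
  simp only [Function.update_self]
  have h1 : HasDerivAt (fun t : ℝ => 2 * lam * (t - r) ^ 2) (2 * lam * (2 * (x 2 - r))) (x 2) := by
    simpa using (((hasDerivAt_id (x 2)).sub_const r).fun_pow 2).const_mul (2 * lam)
  convert h1.exp using 1
  ring

theorem hasDerivAt_wp_of_ne {i : Fin 3} (hi : i ≠ 2) :
    HasDerivAt (fun t => wp lam r (Function.update x i t)) 0 (x i) := by
  unfold wp
  simp only [Function.update_of_ne hi.symm]
  exact hasDerivAt_const _ _

theorem hasDerivAt_wt_of_ne {i : Fin 3} (hi : i ≠ 2) :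
    HasDerivAt (fun t => wt lam r (Function.update x i t)) 0 (x i) := by
  unfold wt
  simp only [Function.update_of_ne hi.symm]
  exact hasDerivAt_const _ _

end line

/-- The flux in the first order Carleman estimate. -/
noncomputable def fluxA (lam r : ℝ) (h : Coord → ℝ) : Fin 3 → Coord → ℝ :=
  ![fun x => wt lam r x * (-2 * wp lam r x * dd 0 h x * (dd 2 h x + wp lam r x * h x)
      - 4 * lam * h x * dd 0 h x),
    fun x => wt lam r x * (-2 * wp lam r x * dd 1 h x * (dd 2 h x + wp lam r x * h x)
      - 4 * lam * h x * dd 1 h x),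
    fun x => wt lam r x * (-wp lam r x * (dd 2 h x + wp lam r x * h x) ^ 2
      + wp lam r x * dd 0 h x ^ 2 + wp lam r x * dd 1 h x ^ 2
      - 4 * lam * h x * (dd 2 h x + wp lam r x * h x) - wp lam r x ^ 3 * h x ^ 2
      - 2 * lam * wp lam r x * h x ^ 2)]

theorem contDiff_fluxA (lam r : ℝ) {h : Coord → ℝ} (hh : ContDiff ℝ ∞ h) (i : Fin 3) :
    ContDiff ℝ ∞ (fluxA lam r h i) := by
  have h1 := contDiff_wt lam r
  have h2 := contDiff_wp lam r
  have h3 := fun i => contDiff_dd i hh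
  have h30 := h3 0
  have h31 := h3 1
  have h32 := h3 2
  fin_cases i <;> simp only [fluxA] <;> dsimp <;> fun_prop

/-- Put v = e^φ h with φ = λ(z - r)², so that p = `wp` is φ′ and p′ = 2λ. Then e^φ Δh = S - Y with S
= Δv + (p² + 2λ)v and Y = 2p ∂_z v + 4λv, and e^φ (∂_z h + p h) = ∂_z v. The identity is (S - Y)² =
(S + Y)² - 4SY, in which -4SY is written as a divergence plus quadratic terms. The zero order
coefficient 4λ of Y is chosen so that all squared derivatives of h or v come with a positive sign.
-/
theorem div_fluxA (lam r : ℝ) {h : Coord → ℝ} (hh : ContDiff ℝ ∞ h) (x : Coord) :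
    wt lam r x * (∑ i, dd i (dd i h) x) ^ 2
      = 4 * (wt lam r x * (6 * lam * (dd 2 h x + wp lam r x * h x) ^ 2
          + 2 * lam * (dd 0 h x ^ 2 + dd 1 h x ^ 2) + 2 * lam * wp lam r x ^ 2 * h x ^ 2
          - 4 * lam ^ 2 * h x ^ 2))
        + 4 * (∑ i, dd i (fluxA lam r h i) x)
        + wt lam r x * ((∑ i, dd i (dd i h) x) + 4 * wp lam r x * dd 2 h x
          + 4 * wp lam r x ^ 2 * h x + 8 * lam * h x) ^ 2 := by
  have dh : ∀ i, HasDerivAt (fun t => h (Function.update x i t)) (dd i h x) (x i) := fun i =>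
    hasDerivAt_update_dd i (hh.differentiable (by simp) x)
  have ddh : ∀ i j, HasDerivAt (fun t => dd j h (Function.update x i t)) (dd i (dd j h) x) (x i) :=
    fun i j => hasDerivAt_update_dd i ((contDiff_dd j hh).differentiable (by simp) x)
  have hlat : ∀ i : Fin 3, i ≠ 2 → dd i (fun x => wt lam r x *
      (-2 * wp lam r x * dd i h x * (dd 2 h x + wp lam r x * h x) - 4 * lam * h x * dd i h x)) x
      = wt lam r x * (-2 * wp lam r x * dd i (dd i h) x * (dd 2 h x + wp lam r x * h x)
        - 2 * wp lam r x * dd i h x * (dd i (dd 2 h) x + wp lam r x * dd i h x)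
        - 4 * lam * dd i h x * dd i h x - 4 * lam * h x * dd i (dd i h) x) := by
    intro i hi
    have hp := hasDerivAt_wp_of_ne lam r x hi
    have hm := hasDerivAt_wt_of_ne lam r x hi
    have hc : ContDiff ℝ ∞ fun x => wt lam r x *
      (-2 * wp lam r x * dd i h x * (dd 2 h x + wp lam r x * h x) - 4 * lam * h x * dd i h x) := by
      have h1 := contDiff_wt lam r
      have h2 := contDiff_wp lam r
      have h3 := contDiff_dd i hh
      have h4 := contDiff_dd 2 hh
      fun_prop
    rw [dd_eq_of_hasDerivAt hc (hm.fun_mul ((((hp.const_mul (-2)).fun_mul (ddh i i)).fun_mul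
      ((ddh i 2).fun_add (hp.fun_mul (dh i)))).fun_sub (((dh i).const_mul (4 * lam)).fun_mul (ddh i i))))]
    simp only [Function.update_eq_self]
    ring
  have hz : dd 2 (fluxA lam r h 2) x
      = wt lam r x * (2 * wp lam r x * (-wp lam r x * (dd 2 h x + wp lam r x * h x) ^ 2
      + wp lam r x * dd 0 h x ^ 2 + wp lam r x * dd 1 h x ^ 2
      - 4 * lam * h x * (dd 2 h x + wp lam r x * h x) - wp lam r x ^ 3 * h x ^ 2
      - 2 * lam * wp lam r x * h x ^ 2)
      + (-(2 * lam) * (dd 2 h x + wp lam r x * h x) ^ 2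
      - 2 * wp lam r x * (dd 2 h x + wp lam r x * h x) *
        (dd 2 (dd 2 h) x + 2 * lam * h x + wp lam r x * dd 2 h x)
      + 2 * lam * dd 0 h x ^ 2 + 2 * wp lam r x * dd 0 h x * dd 2 (dd 0 h) x
      + 2 * lam * dd 1 h x ^ 2 + 2 * wp lam r x * dd 1 h x * dd 2 (dd 1 h) x
      - 4 * lam * dd 2 h x * (dd 2 h x + wp lam r x * h x)
      - 4 * lam * h x * (dd 2 (dd 2 h) x + 2 * lam * h x + wp lam r x * dd 2 h x)
      - 6 * lam * wp lam r x ^ 2 * h x ^ 2 - 2 * wp lam r x ^ 3 * h x * dd 2 h x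
      - 4 * lam ^ 2 * h x ^ 2 - 4 * lam * wp lam r x * h x * dd 2 h x)) := by
    have hp := hasDerivAt_wp_two lam r x
    have hm := hasDerivAt_wt_two lam r x
    have hq := (ddh 2 2).fun_add (hp.fun_mul (dh 2))
    rw [dd_eq_of_hasDerivAt (contDiff_fluxA lam r hh 2) (hm.fun_mul (((((hp.fun_neg.fun_mul (hq.fun_pow 2)).fun_add
      (hp.fun_mul ((ddh 2 0).fun_pow 2))).fun_add (hp.fun_mul ((ddh 2 1).fun_pow 2))).fun_sub
      (((dh 2).const_mul (4 * lam)).fun_mul hq)).fun_sub ((hp.fun_pow 3).fun_mul ((dh 2).fun_pow 2)) |>.fun_sub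
      ((hp.const_mul (2 * lam)).fun_mul ((dh 2).fun_pow 2))))]
    simp only [Function.update_eq_self]
    norm_num
    ring
  rw [Fin.sum_univ_three (fun i => dd i (fluxA lam r h i) x), Fin.sum_univ_three]
  have e0 : dd 0 (fluxA lam r h 0) x = _ := hlat 0 (by decide)
  have e1 : dd 1 (fluxA lam r h 1) x = _ := hlat 1 (by decide)
  rw [e0, e1, hz, dd_comm hh 2 0, dd_comm hh 2 1]
  ring

/-- The flux in the estimate of the second derivatives. -/
noncomputable def fluxB (lam r : ℝ) (h : Coord → ℝ) : Fin 3 → Coord → ℝ :=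
  ![fun x => wt lam r x * (dd 0 h x * dd 1 (dd 1 h) x + dd 0 h x * dd 2 (dd 2 h) x),
    fun x => wt lam r x * (dd 1 h x * dd 2 (dd 2 h) x - dd 0 h x * dd 1 (dd 0 h) x),
    fun x => wt lam r x * (-(dd 0 h x * dd 2 (dd 0 h) x) - dd 1 h x * dd 2 (dd 1 h) x)]

theorem contDiff_fluxB (lam r : ℝ) {h : Coord → ℝ} (hh : ContDiff ℝ ∞ h) (i : Fin 3) :
    ContDiff ℝ ∞ (fluxB lam r h i) := by
  have h1 := contDiff_wt lam r
  have h30 := contDiff_dd 0 hh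
  have h31 := contDiff_dd 1 hh
  have h411 := contDiff_dd 1 (contDiff_dd 1 hh)
  have h422 := contDiff_dd 2 (contDiff_dd 2 hh)
  have h410 := contDiff_dd 1 (contDiff_dd 0 hh)
  have h420 := contDiff_dd 2 (contDiff_dd 0 hh)
  have h421 := contDiff_dd 2 (contDiff_dd 1 hh)
  fin_cases i <;> simp only [fluxB] <;> dsimp <;> fun_prop

/-- The products of pure second derivatives are turned into squares of mixed ones by two
integrations by parts. Since the weight depends on z only, the sole error is the term with 4p. -/
theorem div_fluxB (lam r : ℝ) {h : Coord → ℝ} (hh : ContDiff ℝ ∞ h) (x : Coord) :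
    wt lam r x * (∑ i, dd i (dd i h) x) ^ 2
      = wt lam r x * (dd 0 (dd 0 h) x ^ 2 + dd 1 (dd 1 h) x ^ 2 + dd 2 (dd 2 h) x ^ 2
          + 2 * dd 1 (dd 0 h) x ^ 2 + 2 * dd 2 (dd 0 h) x ^ 2 + 2 * dd 2 (dd 1 h) x ^ 2
          + 4 * wp lam r x * (dd 0 h x * dd 2 (dd 0 h) x + dd 1 h x * dd 2 (dd 1 h) x))
        + 2 * (∑ i, dd i (fluxB lam r h i) x) := by
  have ddh : ∀ i j, HasDerivAt (fun t => dd j h (Function.update x i t)) (dd i (dd j h) x) (x i) :=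
    fun i j => hasDerivAt_update_dd i ((contDiff_dd j hh).differentiable (by simp) x)
  have dddh : ∀ i j k, HasDerivAt (fun t => dd k (dd j h) (Function.update x i t))
      (dd i (dd k (dd j h)) x) (x i) := fun i j k =>
    hasDerivAt_update_dd i ((contDiff_dd k (contDiff_dd j hh)).differentiable (by simp) x)
  have m0 := hasDerivAt_wt_of_ne lam r x (i := 0) (by decide)
  have m1 := hasDerivAt_wt_of_ne lam r x (i := 1) (by decide)
  have m2 := hasDerivAt_wt_two lam r x
  have e0 := dd_eq_of_hasDerivAt (contDiff_fluxB lam r hh 0) (m0.fun_mul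
    (((ddh 0 0).fun_mul (dddh 0 1 1)).fun_add ((ddh 0 0).fun_mul (dddh 0 2 2))))
  have e1 := dd_eq_of_hasDerivAt (contDiff_fluxB lam r hh 1) (m1.fun_mul
    (((ddh 1 1).fun_mul (dddh 1 2 2)).fun_sub ((ddh 1 0).fun_mul (dddh 1 0 1))))
  have e2 := dd_eq_of_hasDerivAt (contDiff_fluxB lam r hh 2) (m2.fun_mul
    (((ddh 2 0).fun_mul (dddh 2 0 2)).fun_neg.fun_sub ((ddh 2 1).fun_mul (dddh 2 1 2))))
  simp only [Function.update_eq_self] at e0 e1 e2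
  have c3 : ∀ i j k, dd i (dd j (dd k h)) x = dd j (dd k (dd i h)) x := by
    intro i j k
    rw [dd_comm (contDiff_dd k hh)]
    congr 1
    funext y
    exact dd_comm hh i k y
  rw [Fin.sum_univ_three (fun i => dd i (fluxB lam r h i) x), Fin.sum_univ_three, e0, e1, e2,
    c3 0 1 1, c3 0 2 2, c3 1 2 2]
  ring

/-- Bounds for the logarithmic derivative of the weight. -/
theorem wp_bounds {R r lam : ℝ} (hr : R < r) (hlam : 0 < lam) {x : Coord}
    (hx : x ∈ Icc (fun _ => -R : Coord) fun _ => R) :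
    wp lam r x < 0 ∧ -(2 * lam * (R + r)) ≤ wp lam r x ∧
      4 * lam ^ 2 * (r - R) ^ 2 ≤ wp lam r x ^ 2 ∧
      wp lam r x ^ 2 ≤ 4 * lam ^ 2 * (R + r) ^ 2 := by
  have h1 := hx.1 2
  have h2 := hx.2 2
  simp only at h1 h2
  unfold wp
  refine ⟨by nlinarith, by nlinarith, ?_, ?_⟩
  · rw [show (2 * lam * (x 2 - r)) ^ 2 = 4 * lam ^ 2 * (r - x 2) ^ 2 by ring]
    have : (r - R) ^ 2 ≤ (r - x 2) ^ 2 := pow_le_pow_left₀ (by linarith) (by linarith) 2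
    gcongr
  · rw [show (2 * lam * (x 2 - r)) ^ 2 = 4 * lam ^ 2 * (r - x 2) ^ 2 by ring]
    have : (r - x 2) ^ 2 ≤ (R + r) ^ 2 := pow_le_pow_left₀ (by linarith) (by linarith) 2
    gcongr

theorem wt_le {R r lam : ℝ} (hr : R < r) (hlam : 0 < lam) {x : Coord}
    (hx : x ∈ Icc (fun _ => -R : Coord) fun _ => R) :
    wt lam r x ≤ Real.exp (2 * lam * (R + r) ^ 2) := by
  have h1 := hx.1 2
  have h2 := hx.2 2
  simp only at h1 h2
  unfold wt
  have : (x 2 - r) ^ 2 ≤ (R + r) ^ 2 := by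
    rw [show (x 2 - r) ^ 2 = (r - x 2) ^ 2 by ring]
    exact pow_le_pow_left₀ (by linarith) (by linarith) 2
  gcongr

/-- The contribution of the lower face to the Carleman estimate. -/
noncomputable def faceErr (R r lam τ : ℝ) : ℝ :=
  4 * ((2 * R) ^ 2 * (2 * lam * (R + r) * Real.exp (2 * lam * (R + r) ^ 2) * τ ^ 2))

/-- On the boundary h and its tangential derivatives vanish, which kills the lateral fluxes and
reduces the vertical flux to -μ p (∂_z h)². As p < 0, the upper face contributes with the favourable
sign, and the lower face is paid for by `faceErr`. -/
theorem carleman_smooth_first {R r lam τ : ℝ} (hR : 0 < R) (hr : R < r) (hlam : 0 < lam)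
    (hlam' : 1 ≤ lam * (r - R) ^ 2) {h : Coord → ℝ} (hh : ContDiff ℝ ∞ h)
    (h0 : ∀ x, (∃ i, |x i| = R) → h x = 0)
    (hτ : ∀ x ∈ Icc (fun _ => -R : Coord) (fun _ => R), x 2 = -R → |dd 2 h x| ≤ τ) :
    (lam * ∫ x in box R, wt lam r x * ∑ i, dd i h x ^ 2)
      + 8 * (r - R) ^ 2 * lam ^ 3 * (∫ x in box R, wt lam r x * h x ^ 2)
      ≤ (∫ x in box R, wt lam r x * (∑ i, dd i (dd i h) x) ^ 2) + faceErr R r lam τ := by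
  have hv : ∀ i x, |x i| = R → h x = 0 := fun i x hx => h0 x ⟨i, hx⟩
  have ht : ∀ i j, j ≠ i → ∀ x, |x i| = R → dd j h x = 0 := fun i j hij =>
    dd_eq_zero_of_vanishing hh hij (hv i)
  have hcw := (contDiff_wt lam r).continuous
  have hc := hh.continuous
  have hcd := fun i => (contDiff_dd i hh).continuous
  have hcdd := fun i => (contDiff_dd i (contDiff_dd i hh)).continuous
  have hflux : -((2 * R) ^ 2 * (2 * lam * (R + r) * Real.exp (2 * lam * (R + r) ^ 2) * τ ^ 2))
      ≤ ∫ x in box R, ∑ i, dd i (fluxA lam r h i) x := by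
    have hR' : |R| = R := abs_of_pos hR
    have hR'' : |-R| = R := by rw [abs_neg, hR']
    refine le_integral_divergence hR (contDiff_fluxA lam r hh) ?_ ?_ ?_ ?_
    · intro x _ hx
      simp [fluxA, hv 0 x hx, ht 0 2 (by decide) x hx]
    · intro x _ hx
      simp [fluxA, hv 1 x hx, ht 1 2 (by decide) x hx]
    · intro x hxI hx
      have hx2 : |x 2| = R := by rw [hx, hR']
      simp only [fluxA, Matrix.cons_val]
      rw [hv 2 x hx2, ht 2 0 (by decide) x hx2, ht 2 1 (by decide) x hx2]
      have := (wp_bounds hr hlam hxI).1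
      have hw := wt_pos lam r x
      simp only [mul_zero, add_zero, ne_eq, OfNat.ofNat_ne_zero, not_false_eq_true, zero_pow,
        zero_mul, sub_zero]
      refine mul_nonneg hw.le (mul_nonneg (by linarith) (sq_nonneg _))
    · intro x hxI hx
      have hx2 : |x 2| = R := by rw [hx, hR'']
      simp only [fluxA, Matrix.cons_val]
      rw [hv 2 x hx2, ht 2 0 (by decide) x hx2, ht 2 1 (by decide) x hx2]
      obtain ⟨hp1, hp2, -, -⟩ := wp_bounds hr hlam hxI
      have hw := wt_pos lam r x
      have hw2 := wt_le hr hlam hxI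
      simp only [mul_zero, add_zero, ne_eq, OfNat.ofNat_ne_zero, not_false_eq_true, zero_pow,
        zero_mul, sub_zero]
      have hd : dd 2 h x ^ 2 ≤ τ ^ 2 := sq_le_sq' (abs_le.1 (hτ x hxI hx)).1 (abs_le.1 (hτ x hxI hx)).2
      calc wt lam r x * (-wp lam r x * dd 2 h x ^ 2)
          ≤ Real.exp (2 * lam * (R + r) ^ 2) * (2 * lam * (R + r) * τ ^ 2) := by
            have : -wp lam r x ≤ 2 * lam * (R + r) := by linarith
            have h3 : 0 ≤ -wp lam r x := by linarith
            have h4 : 0 ≤ 2 * lam * (R + r) := h3.trans this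
            gcongr
        _ = _ := by ring
  have hpt : ∀ x ∈ box R, lam * (wt lam r x * ∑ i, dd i h x ^ 2)
      + 8 * (r - R) ^ 2 * lam ^ 3 * (wt lam r x * h x ^ 2) + 4 * (∑ i, dd i (fluxA lam r h i) x)
      ≤ wt lam r x * (∑ i, dd i (dd i h) x) ^ 2 := by
    intro x hx
    obtain ⟨-, -, hp, -⟩ := wp_bounds hr hlam (box_subset_Icc R hx)
    have hw := wt_pos lam r x
    rw [div_fluxA lam r hh x, Fin.sum_univ_three (fun i => dd i h x ^ 2)]
    set p := wp lam r x
    set μ := wt lam r x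
    have hsq := mul_nonneg hw.le (sq_nonneg ((∑ i, dd i (dd i h) x) + 4 * p * dd 2 h x
          + 4 * p ^ 2 * h x + 8 * lam * h x))
    have hq : 4 * lam ≤ p ^ 2 := by nlinarith
    -- Of the positive term 8λp²h², the negative term -16λ²h² consumes 4λp²h² because 4λ ≤ p².
    -- Bounding (∂_z h)² by 2(∂_z h + p h)² + 2p²h² takes 2λp²h², and the rest is at least 8(r -
    -- R)²λ³h².
    have key : lam * (dd 0 h x ^ 2 + dd 1 h x ^ 2 + dd 2 h x ^ 2)
        + 8 * (r - R) ^ 2 * lam ^ 3 * h x ^ 2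
        ≤ 4 * (6 * lam * (dd 2 h x + p * h x) ^ 2
          + 2 * lam * (dd 0 h x ^ 2 + dd 1 h x ^ 2) + 2 * lam * p ^ 2 * h x ^ 2
          - 4 * lam ^ 2 * h x ^ 2) := by
      have a1 : dd 2 h x ^ 2 ≤ 2 * (dd 2 h x + p * h x) ^ 2 + 2 * (p ^ 2 * h x ^ 2) := by
        nlinarith [sq_nonneg (dd 2 h x + 2 * (p * h x))]
      have a2 : 4 * lam * h x ^ 2 ≤ p ^ 2 * h x ^ 2 := by gcongr
      have a3 : 4 * lam ^ 2 * (r - R) ^ 2 * h x ^ 2 ≤ p ^ 2 * h x ^ 2 := by gcongr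
      have a1' := mul_le_mul_of_nonneg_left a1 hlam.le
      have a2' := mul_le_mul_of_nonneg_left a2 hlam.le
      have a3' := mul_le_mul_of_nonneg_left a3 hlam.le
      have b0 := mul_nonneg hlam.le (sq_nonneg (dd 0 h x))
      have b1 := mul_nonneg hlam.le (sq_nonneg (dd 1 h x))
      have b2 := mul_nonneg hlam.le (sq_nonneg (dd 2 h x + p * h x))
      nlinarith
    have := mul_le_mul_of_nonneg_left key hw.le
    nlinarith
  have i1 : IntegrableOn (fun x => wt lam r x * ∑ i, dd i h x ^ 2) (box R) :=
    integrableOn_box_of_continuous (hcw.mul (continuous_finsetSum _ fun i _ => (hcd i).pow 2)) R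
  have i2 : IntegrableOn (fun x => wt lam r x * h x ^ 2) (box R) :=
    integrableOn_box_of_continuous (hcw.mul (hc.pow 2)) R
  have i3 : IntegrableOn (fun x => ∑ i, dd i (fluxA lam r h i) x) (box R) :=
    integrableOn_box_of_continuous (continuous_finsetSum _ fun i _ =>
      (contDiff_dd i (contDiff_fluxA lam r hh i)).continuous) R
  have i4 : IntegrableOn (fun x => wt lam r x * (∑ i, dd i (dd i h) x) ^ 2) (box R) :=
    integrableOn_box_of_continuous (hcw.mul ((continuous_finsetSum _ fun i _ => hcdd i).pow 2)) R
  have := setIntegral_mono_on (((i1.const_mul lam).add (i2.const_mul _)).add (i3.const_mul 4)) i4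
    (measurableSet_box R) hpt
  simp only [Pi.add_apply] at this
  rw [integral_add, integral_add, integral_const_mul, integral_const_mul, integral_const_mul] at this
  · unfold faceErr
    linarith
  · exact i1.const_mul lam
  · exact i2.const_mul _
  · exact (i1.const_mul lam).add (i2.const_mul _)
  · exact i3.const_mul 4

/-- Every term of the second flux contains, on each face, a tangential derivative of first or second
order, so all fluxes vanish. No condition on the normal derivative is used. -/
theorem carleman_smooth_second {R r lam : ℝ} (hR : 0 < R) (hr : R < r) (hlam : 0 < lam)
    {h : Coord → ℝ} (hh : ContDiff ℝ ∞ h) (h0 : ∀ x, (∃ i, |x i| = R) → h x = 0) :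
    ∫ x in box R, wt lam r x * ∑ i, ∑ j, dd j (dd i h) x ^ 2
      ≤ 2 * (∫ x in box R, wt lam r x * (∑ i, dd i (dd i h) x) ^ 2)
        + 32 * lam ^ 2 * (R + r) ^ 2 * ∫ x in box R, wt lam r x * ∑ i, dd i h x ^ 2 := by
  have hv : ∀ i x, |x i| = R → h x = 0 := fun i x hx => h0 x ⟨i, hx⟩
  have ht : ∀ i j, j ≠ i → ∀ x, |x i| = R → dd j h x = 0 := fun i j hij =>
    dd_eq_zero_of_vanishing hh hij (hv i)
  have htt : ∀ i j, j ≠ i → ∀ x, |x i| = R → dd j (dd j h) x = 0 := fun i j hij =>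
    dd_eq_zero_of_vanishing (contDiff_dd j hh) hij (ht i j hij)
  have hcw := (contDiff_wt lam r).continuous
  have hcd := fun i => (contDiff_dd i hh).continuous
  have hcdd := fun i j => (contDiff_dd j (contDiff_dd i hh)).continuous
  have hR' : |R| = R := abs_of_pos hR
  have hR'' : |-R| = R := by rw [abs_neg, hR']
  have hflux : -((2 * R) ^ 2 * 0) ≤ ∫ x in box R, ∑ i, dd i (fluxB lam r h i) x := by
    refine le_integral_divergence hR (contDiff_fluxB lam r hh) ?_ ?_ ?_ ?_
    · intro x _ hx
      simp [fluxB, htt 0 1 (by decide) x hx, htt 0 2 (by decide) x hx]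
    · intro x _ hx
      simp [fluxB, ht 1 0 (by decide) x hx, htt 1 2 (by decide) x hx]
    · intro x _ hx
      have hx2 : |x 2| = R := by rw [hx, hR']
      simp [fluxB, ht 2 0 (by decide) x hx2, ht 2 1 (by decide) x hx2]
    · intro x _ hx
      have hx2 : |x 2| = R := by rw [hx, hR'']
      simp [fluxB, ht 2 0 (by decide) x hx2, ht 2 1 (by decide) x hx2]
  have hpt : ∀ x ∈ box R, (wt lam r x * ∑ i, ∑ j, dd j (dd i h) x ^ 2)
      + 4 * (∑ i, dd i (fluxB lam r h i) x)
      ≤ 2 * (wt lam r x * (∑ i, dd i (dd i h) x) ^ 2)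
        + 32 * lam ^ 2 * (R + r) ^ 2 * (wt lam r x * ∑ i, dd i h x ^ 2) := by
    intro x hx
    obtain ⟨-, -, -, hp⟩ := wp_bounds hr hlam (box_subset_Icc R hx)
    have hw := wt_pos lam r x
    rw [div_fluxB lam r hh x]
    generalize ∑ i, dd i (fluxB lam r h i) x = D
    simp only [Fin.sum_univ_three]
    rw [dd_comm hh 0 1, dd_comm hh 0 2, dd_comm hh 1 2]
    set p := wp lam r x
    set μ := wt lam r x
    -- Completing the square (b + 2pa)², with p² bounded by 4λ²(R + r)². It absorbs the cross terms
    -- of the identity into half of the mixed derivatives.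
    have key : ∀ a b : ℝ, 0 ≤ b ^ 2 + 4 * p * (a * b) + 4 * (4 * lam ^ 2 * (R + r) ^ 2) * a ^ 2 := by
      intro a b
      have : p ^ 2 * a ^ 2 ≤ (4 * lam ^ 2 * (R + r) ^ 2) * a ^ 2 := by gcongr
      nlinarith [sq_nonneg (b + 2 * p * a)]
    have k0 := mul_nonneg hw.le (key (dd 0 h x) (dd 2 (dd 0 h) x))
    have k1 := mul_nonneg hw.le (key (dd 1 h x) (dd 2 (dd 1 h) x))
    have p0 := mul_nonneg hw.le (sq_nonneg (dd 0 (dd 0 h) x))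
    have p1 := mul_nonneg hw.le (sq_nonneg (dd 1 (dd 1 h) x))
    have p2 := mul_nonneg hw.le (sq_nonneg (dd 2 (dd 2 h) x))
    have p3 := mul_nonneg hw.le (sq_nonneg (dd 1 (dd 0 h) x))
    have p4 : 0 ≤ lam ^ 2 * (R + r) ^ 2 * (μ * dd 2 h x ^ 2) := by positivity
    nlinarith
  have i1 : IntegrableOn (fun x => wt lam r x * ∑ i, dd i h x ^ 2) (box R) :=
    integrableOn_box_of_continuous (hcw.mul (continuous_finsetSum _ fun i _ => (hcd i).pow 2)) R
  have i2 : IntegrableOn (fun x => wt lam r x * ∑ i, ∑ j, dd j (dd i h) x ^ 2) (box R) :=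
    integrableOn_box_of_continuous (hcw.mul (continuous_finsetSum _ fun i _ =>
      continuous_finsetSum _ fun j _ => (hcdd i j).pow 2)) R
  have i3 : IntegrableOn (fun x => ∑ i, dd i (fluxB lam r h i) x) (box R) :=
    integrableOn_box_of_continuous (continuous_finsetSum _ fun i _ =>
      (contDiff_dd i (contDiff_fluxB lam r hh i)).continuous) R
  have i4 : IntegrableOn (fun x => wt lam r x * (∑ i, dd i (dd i h) x) ^ 2) (box R) :=
    integrableOn_box_of_continuous (hcw.mul ((continuous_finsetSum _ fun i _ => hcdd i i).pow 2)) R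
  have := setIntegral_mono_on (i2.add (i3.const_mul 4)) ((i4.const_mul 2).add (i1.const_mul _))
    (measurableSet_box R) hpt
  simp only [Pi.add_apply] at this
  rw [integral_add i2 (i3.const_mul 4), integral_add (i4.const_mul 2) (i1.const_mul _),
    integral_const_mul, integral_const_mul, integral_const_mul] at this
  linarith

end

section

/-! ### The Carleman estimate for Sobolev functions -/

/-- Convergence in `L²` of the cube. -/
def TendstoL2 (R : ℝ) (f : ℕ → Coord → ℝ) (g : Coord → ℝ) : Prop :=
  (∀ n, MemLp (f n) 2 (volume.restrict (box R))) ∧ MemLp g 2 (volume.restrict (box R)) ∧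
    Tendsto (fun n => eLpNorm (f n - g) 2 (volume.restrict (box R))) atTop (𝓝 0)

namespace TendstoL2

variable {R : ℝ} {f f' : ℕ → Coord → ℝ} {g g' : Coord → ℝ}

theorem add (h : TendstoL2 R f g) (h' : TendstoL2 R f' g') :
    TendstoL2 R (fun n => f n + f' n) (g + g') := by
  refine ⟨fun n => (h.1 n).add (h'.1 n), h.2.1.add h'.2.1, ?_⟩
  have := h.2.2.add h'.2.2
  rw [add_zero] at this
  refine tendsto_of_tendsto_of_tendsto_of_le_of_le tendsto_const_nhds this (fun n => zero_le)
    fun n => ?_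
  rw [show f n + f' n - (g + g') = (f n - g) + (f' n - g') by ring]
  exact eLpNorm_add_le ((h.1 n).1.sub h.2.1.1) ((h'.1 n).1.sub h'.2.1.1) (by norm_num)

theorem finset_sum {ι : Type*} (s : Finset ι) {f : ι → ℕ → Coord → ℝ} {g : ι → Coord → ℝ}
    (h : ∀ i ∈ s, TendstoL2 R (f i) (g i)) :
    TendstoL2 R (fun n => ∑ i ∈ s, f i n) (∑ i ∈ s, g i) := by
  classical
  induction s using Finset.induction_on with
  | empty => exact ⟨fun n => by simp, by simp, by simp⟩
  | insert a s ha ih =>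
    simp only [Finset.sum_insert ha]
    exact (h a (Finset.mem_insert_self a s)).add
      (ih fun i hi => h i (Finset.mem_insert_of_mem hi))

theorem mul_continuous (h : TendstoL2 R f g) {c : Coord → ℝ} (hc : Continuous c) :
    TendstoL2 R (fun n => c * f n) (c * g) := by
  obtain ⟨C, hC0, hC⟩ := exists_bound_box hc R
  have hb : ∀ {u : Coord → ℝ}, MemLp u 2 (volume.restrict (box R)) →
      ∀ᵐ x ∂(volume.restrict (box R)), ‖(c * u) x‖ ≤ C * ‖u x‖ := by
    intro u _
    filter_upwards [ae_restrict_mem (measurableSet_box R)] with x hx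
    rw [Pi.mul_apply, norm_mul]
    exact mul_le_mul_of_nonneg_right (hC x hx) (norm_nonneg _)
  have hm : ∀ {u : Coord → ℝ}, MemLp u 2 (volume.restrict (box R)) →
      MemLp (c * u) 2 (volume.restrict (box R)) := fun hu =>
    hu.of_le_mul (hc.aestronglyMeasurable.mul hu.1) (hb hu)
  refine ⟨fun n => hm (h.1 n), hm h.2.1, ?_⟩
  have hlim := ENNReal.Tendsto.const_mul (a := ENNReal.ofReal C) h.2.2
    (Or.inr ENNReal.ofReal_ne_top)
  rw [mul_zero] at hlim
  refine tendsto_of_tendsto_of_tendsto_of_le_of_le tendsto_const_nhds hlim (fun n => zero_le)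
    fun n => ?_
  rw [← mul_sub]
  exact eLpNorm_le_mul_eLpNorm_of_ae_le_mul (hb ((h.1 n).sub h.2.1)) 2

theorem integral_mul (h : TendstoL2 R f g) (h' : TendstoL2 R f' g') :
    Tendsto (fun n => ∫ x in box R, f n x * f' n x) atTop (𝓝 (∫ x in box R, g x * g' x)) := by
  have key : ∀ {u v : Coord → ℝ} (hu : MemLp u 2 (volume.restrict (box R)))
      (hv : MemLp v 2 (volume.restrict (box R))),
      ∫ x in box R, u x * v x = inner ℝ (hu.toLp u) (hv.toLp v) := by
    intro u v hu hv
    rw [L2.inner_def]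
    refine integral_congr_ae ?_
    filter_upwards [hu.coeFn_toLp, hv.coeFn_toLp] with x h1 h2
    rw [h1, h2]
    simp [mul_comm]
  simp_rw [key (h.1 _) (h'.1 _), key h.2.1 h'.2.1]
  have t1 := (Lp.tendsto_Lp_iff_tendsto_eLpNorm'' f h.1 g h.2.1).2 h.2.2
  have t2 := (Lp.tendsto_Lp_iff_tendsto_eLpNorm'' f' h'.1 g' h'.2.1).2 h'.2.2
  exact t1.inner t2

theorem integral_mul_sq (h : TendstoL2 R f g) {c : Coord → ℝ} (hc : Continuous c) :
    Tendsto (fun n => ∫ x in box R, c x * f n x ^ 2) atTop (𝓝 (∫ x in box R, c x * g x ^ 2)) := by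
  have := (h.mul_continuous hc).integral_mul h
  simpa only [Pi.mul_apply, mul_assoc, ← sq] using this

theorem congr (h : TendstoL2 R f g) (he : ∀ n, ∀ x ∈ box R, f' n x = f n x) :
    TendstoL2 R f' g := by
  have hae : ∀ n, f' n =ᵐ[volume.restrict (box R)] f n := fun n => by
    filter_upwards [ae_restrict_mem (measurableSet_box R)] with x hx using he n x hx
  refine ⟨fun n => (h.1 n).ae_eq (hae n).symm, h.2.1, ?_⟩
  exact h.2.2.congr fun n => (eLpNorm_congr_ae ((hae n).sub (ae_eq_refl g))).symm

end TendstoL2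

theorem integrable_mul_sq {R : ℝ} {c g : Coord → ℝ} (hc : Continuous c)
    (hg : MemLp g 2 (volume.restrict (box R))) :
    IntegrableOn (fun x => c x * g x ^ 2) (box R) :=
  integrableOn_box_mul hc hg.integrable_sq

/-- A function in `H²` of the cube with its weak derivatives of order at most two, vanishing on
the boundary, whose normal derivative vanishes on the lower face. -/
structure ZeroDataH2 (R : ℝ) (h : Coord → ℝ) (h1 : Fin 3 → Coord → ℝ)
    (h2 : Fin 3 → Fin 3 → Coord → ℝ) : Prop where
  memLp0 : MemLp h 2 (volume.restrict (box R))
  memLp1 : ∀ i, MemLp (h1 i) 2 (volume.restrict (box R))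
  memLp2 : ∀ i j, MemLp (h2 i j) 2 (volume.restrict (box R))
  weak1 : ∀ i, WeakPartial R i h (h1 i)
  weak2 : ∀ i j, WeakPartial R j (h1 i) (h2 i j)
  zero : ZeroBoundary R h
  face : ∃ g : Coord → ℝ, ContinuousOn g (Icc (fun _ => -R) fun _ => R) ∧
    (∀ᵐ x ∂(volume.restrict (box R)), h1 2 x = g x) ∧
    ∀ x ∈ Icc (fun _ => -R : Coord) (fun _ => R), x 2 = -R → g x = 0

/-- The approximants are smoothings with odd reflection in all three directions. They vanish on the
planes through the faces for every n, whereas the normal derivative on the lower face is only small,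
not zero. -/
theorem ZeroDataH2.exists_approx {R : ℝ} (hR : 0 < R) {h : Coord → ℝ} {h1 : Fin 3 → Coord → ℝ}
    {h2 : Fin 3 → Fin 3 → Coord → ℝ} (H : ZeroDataH2 R h h1 h2) :
    ∃ f : ℕ → Coord → ℝ, (∀ n, ContDiff ℝ ∞ (f n)) ∧
      (∀ n x, (∃ i, |x i| = R) → f n x = 0) ∧
      (∀ τ > 0, ∀ᶠ n in atTop, ∀ x ∈ Icc (fun _ => -R : Coord) (fun _ => R), x 2 = -R →
        |dd 2 (f n) x| ≤ τ) ∧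
      TendstoL2 R f h ∧ (∀ i, TendstoL2 R (fun n => dd i (f n)) (h1 i)) ∧
      ∀ i j, TendstoL2 R (fun n => dd j (dd i (f n))) (h2 i j) := by
  obtain ⟨ε, η, hε, hε0, hεR, hη⟩ := exists_isMollifier_seq hR
  set σ : Fin 3 → ℝ := fun _ => -1 with hσdef
  have hσ : ∀ j, |σ j| ≤ 1 := fun j => by simp [hσdef]
  have i0 := integrableOn_of_memLp_two H.memLp0
  have i1 := fun i => integrableOn_of_memLp_two (H.memLp1 i)
  have i2 := fun i j => integrableOn_of_memLp_two (H.memLp2 i j)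
  have hT : ∀ {σ : Fin 3 → ℝ} {g : Coord → ℝ}, (∀ j, |σ j| ≤ 1) →
      MemLp g 2 (volume.restrict (box R)) → TendstoL2 R (fun n => smoothing R (η n) σ g) g :=
    fun hσ hg => ⟨fun n => memLp_smoothing (hη n) (integrableOn_of_memLp_two hg) 2, hg,
      tendsto_smoothing hε hε0 hη hσ hg⟩
  have d1 : ∀ n i, dd i (smoothing R (η n) σ h) = smoothing R (η n) (flip i σ) (h1 i) :=
    fun n i => ((H.weak1 i).strong_of_zeroBoundary hR i0 (i1 i) H.zero).dd_smoothing (hη n) i0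
  refine ⟨fun n => smoothing R (η n) σ h, fun n => contDiff_smoothing (hη n) i0, ?_, ?_,
    hT hσ H.memLp0, ?_, ?_⟩
  · rintro n x ⟨i, hx⟩
    exact smoothing_eq_zero (hη n) (hεR n) (j := i) rfl hx
  · intro τ hτ
    obtain ⟨g, hg, hgae, hg0⟩ := H.face
    have huc := isCompact_Icc.uniformContinuousOn_of_continuous hg
    rw [Metric.uniformContinuousOn_iff] at huc
    obtain ⟨δ, hδ, hgδ⟩ := huc (τ / 27) (by positivity)
    filter_upwards [hε.eventually_lt_const hδ] with n hn x hx hx2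
    -- The derivative of the smoothing is itself a smoothing of ∂_z h. Near the lower face the
    -- latter is small by uniform continuity, and the local maximum principle transfers this with
    -- the factor 27.
    rw [d1, show τ = 27 * (τ / 27) by ring]
    refine abs_smoothing_le (hη n) (abs_flip_le hσ 2) (hε0 n) hx (by positivity) ?_
    filter_upwards [hgae, ae_restrict_mem (measurableSet_box R)] with y hy hyb hyx
    have := hgδ y (box_subset_Icc R hyb) x hx (hyx.trans_lt hn)
    rw [hg0 x hx hx2, Real.dist_eq, sub_zero] at this
    rw [hy]
    exact this.le
  · intro i
    simp_rw [d1]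
    exact hT (abs_flip_le hσ i) (H.memLp1 i)
  · intro i j
    simp_rw [d1]
    refine (hT (abs_flip_le (abs_flip_le hσ i) j) (H.memLp2 i j)).congr fun n x hx => ?_
    -- For a repeated direction the first derivative has already turned the kernel into the Neumann
    -- one, so the weak derivative suffices. For distinct directions the kernel is still odd in
    -- direction j, and the weak vanishing of tangential derivatives is needed.
    by_cases hij : i = j
    · subst hij
      exact (H.weak2 i i).dd_smoothing (hη n) (hεR n) hR (i1 i) (i2 i i) (by simp [flip, hσdef])
        (mem_box.1 hx i).le
    · rw [((H.weak1 i).strong_of_tangential hR hij (H.weak2 i j) (i1 i) (i2 i j)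
        H.zero).dd_smoothing (hη n) (i1 i)]

section carleman

variable {R r lam : ℝ} {h : Coord → ℝ} {h1 : Fin 3 → Coord → ℝ} {h2 : Fin 3 → Fin 3 → Coord → ℝ}

theorem integral_mul_sum {ι : Type*} (s : Finset ι) {c : Coord → ℝ} (hc : Continuous c)
    {g : ι → Coord → ℝ} (hg : ∀ i, MemLp (g i) 2 (volume.restrict (box R))) :
    ∫ x in box R, c x * ∑ i ∈ s, g i x ^ 2 = ∑ i ∈ s, ∫ x in box R, c x * g i x ^ 2 := by
  simp_rw [Finset.mul_sum]
  exact integral_finsetSum _ fun i _ => integrable_mul_sq hc (hg i)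

theorem TendstoL2.integral_mul_sum_sq {ι : Type*} (s : Finset ι) {c : Coord → ℝ}
    (hc : Continuous c) {f : ι → ℕ → Coord → ℝ} {g : ι → Coord → ℝ}
    (h : ∀ i, TendstoL2 R (f i) (g i)) :
    Tendsto (fun n => ∫ x in box R, c x * ∑ i ∈ s, f i n x ^ 2) atTop
      (𝓝 (∫ x in box R, c x * ∑ i ∈ s, g i x ^ 2)) := by
  simp_rw [integral_mul_sum s hc fun i => (h i).1 _, integral_mul_sum s hc fun i => (h i).2.1]
  exact tendsto_finsetSum _ fun i _ => (h i).integral_mul_sq hc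

theorem TendstoL2.integral_mul_sum_all_sq {c : Coord → ℝ} (hc : Continuous c)
    {f : Fin 3 → ℕ → Coord → ℝ} {g : Fin 3 → Coord → ℝ} (h : ∀ i, TendstoL2 R (f i) (g i)) :
    Tendsto (fun n => ∫ x in box R, c x * (∑ i, f i n x) ^ 2) atTop
      (𝓝 (∫ x in box R, c x * (∑ i, g i x) ^ 2)) := by
  have := (TendstoL2.finset_sum Finset.univ fun i _ => h i).integral_mul_sq hc
  simpa only [Finset.sum_apply] using this

/-- The Carleman estimate for the first derivatives. -/
theorem ZeroDataH2.carleman_first (H : ZeroDataH2 R h h1 h2) (hR : 0 < R) (hr : R < r)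
    (hlam : 0 < lam) (hlam' : 1 ≤ lam * (r - R) ^ 2) :
    (lam * ∫ x in box R, wt lam r x * ∑ i, h1 i x ^ 2)
      + 8 * (r - R) ^ 2 * lam ^ 3 * (∫ x in box R, wt lam r x * h x ^ 2)
      ≤ ∫ x in box R, wt lam r x * (∑ i, h2 i i x) ^ 2 := by
  obtain ⟨f, hf, hf0, hface, t0, t1, t2⟩ := H.exists_approx hR
  have hc := (contDiff_wt lam r).continuous
  -- Two limits in succession: first n tends to infinity with τ fixed, then τ tends to zero. Because
  -- λ is fixed, the exponential factor in `faceErr` does no harm.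
  have hτ : ∀ τ > 0, (lam * ∫ x in box R, wt lam r x * ∑ i, h1 i x ^ 2)
      + 8 * (r - R) ^ 2 * lam ^ 3 * (∫ x in box R, wt lam r x * h x ^ 2)
      ≤ (∫ x in box R, wt lam r x * (∑ i, h2 i i x) ^ 2) + faceErr R r lam τ := by
    intro τ hτ
    refine le_of_tendsto_of_tendsto
      (((TendstoL2.integral_mul_sum_sq Finset.univ hc t1).const_mul lam).add
        ((t0.integral_mul_sq hc).const_mul _))
      ((TendstoL2.integral_mul_sum_all_sq hc fun i => t2 i i).add_const _) ?_
    filter_upwards [hface τ hτ] with n hn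
    exact carleman_smooth_first hR hr hlam hlam' (hf n) (hf0 n) hn
  have hlim : Tendsto (fun τ => (∫ x in box R, wt lam r x * (∑ i, h2 i i x) ^ 2)
      + faceErr R r lam τ) (𝓝[>] 0)
      (𝓝 ((∫ x in box R, wt lam r x * (∑ i, h2 i i x) ^ 2) + faceErr R r lam 0)) := by
    refine Tendsto.mono_left (Continuous.tendsto ?_ 0) nhdsWithin_le_nhds
    unfold faceErr
    fun_prop
  have h0 : faceErr R r lam 0 = 0 := by simp [faceErr]
  rw [h0, add_zero] at hlim
  exact ge_of_tendsto hlim (eventually_mem_nhdsWithin.mono hτ)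

/-- The Carleman estimate for the second derivatives. -/
theorem ZeroDataH2.carleman_second (H : ZeroDataH2 R h h1 h2) (hR : 0 < R) (hr : R < r)
    (hlam : 0 < lam) :
    ∫ x in box R, wt lam r x * ∑ i, ∑ j, h2 i j x ^ 2
      ≤ 2 * (∫ x in box R, wt lam r x * (∑ i, h2 i i x) ^ 2)
        + 32 * lam ^ 2 * (R + r) ^ 2 * ∫ x in box R, wt lam r x * ∑ i, h1 i x ^ 2 := by
  obtain ⟨f, hf, hf0, -, t0, t1, t2⟩ := H.exists_approx hR
  have hc := (contDiff_wt lam r).continuous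
  have t3 := TendstoL2.integral_mul_sum_sq (Finset.univ ×ˢ Finset.univ) hc
    (f := fun (p : Fin 3 × Fin 3) n => dd p.2 (dd p.1 (f n))) (g := fun p => h2 p.1 p.2)
    fun p => t2 p.1 p.2
  simp only [Finset.sum_product] at t3
  exact le_of_tendsto_of_tendsto' t3
    (((TendstoL2.integral_mul_sum_all_sq hc fun i => t2 i i).const_mul 2).add
      ((TendstoL2.integral_mul_sum_sq Finset.univ hc t1).const_mul _))
    fun n => carleman_smooth_second hR hr hlam (hf n) (hf0 n)

end carleman

end

section

/-! ### The weighted estimate of the quadratic terms -/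

/-- Hölder's inequality with exponents 6, 4/3 and 12. The splitting v² = v^(3/2) v^(1/2) leaves
three quarters of the weight on the L² norm of v, where the Carleman estimate gains, and one quarter
on its L⁶ norm, where it loses. -/
theorem lintegral_mul_sq_le {α : Type*} [MeasurableSpace α] {μ : Measure α} {g v : α → ENNReal}
    (hg : AEMeasurable g μ) (hv : AEMeasurable v μ) :
    ∫⁻ x, g x * v x ^ 2 ∂μ ≤ (∫⁻ x, g x ^ 6 ∂μ) ^ (1 / 6 : ℝ) * (∫⁻ x, v x ^ 2 ∂μ) ^ (3 / 4 : ℝ)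
      * (∫⁻ x, v x ^ 6 ∂μ) ^ (1 / 12 : ℝ) := by
  have h := ENNReal.lintegral_prod_norm_pow_le (μ := μ) (Finset.univ : Finset (Fin 3))
    (f := ![fun x => g x ^ 6, fun x => v x ^ 2, fun x => v x ^ 6]) (p := ![1 / 6, 3 / 4, 1 / 12])
    (by
      intro i _
      fin_cases i
      · exact hg.pow_const _
      · exact hv.pow_const _
      · exact hv.pow_const _)
    (by simp [Fin.sum_univ_three]; norm_num)
    (by intro i _; fin_cases i <;> norm_num)
  simp only [Fin.prod_univ_three, Matrix.cons_val_zero, Matrix.cons_val_one, Matrix.cons_val] at h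
  refine le_trans (le_of_eq (lintegral_congr fun x => ?_)) h
  simp_rw [← ENNReal.rpow_natCast, ← ENNReal.rpow_mul]
  rw [mul_assoc, ← ENNReal.rpow_add_of_nonneg _ _ (by norm_num) (by norm_num)]
  norm_num

theorem WeakPartial.mul_smooth {R : ℝ} {j : Fin 3} {u w s : Coord → ℝ} (h : WeakPartial R j u w)
    (hu : IntegrableOn u (box R)) (hw : IntegrableOn w (box R)) (hs : ContDiff ℝ ∞ s) :
    WeakPartial R j (s * u) (s * w + dd j s * u) := by
  intro φ hφ hφc hφs
  have hcs : HasCompactSupport (φ * s) := hφc.mul_right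
  have hts : tsupport (φ * s) ⊆ box R := (tsupport_mul_subset_left).trans hφs
  have key := h (φ * s) (hφ.mul hs) hcs hts
  have hd : ∀ x, dd j (φ * s) x = φ x * dd j s x + dd j φ x * s x := fun x => by
    rw [show φ * s = fun y => φ y * s y from rfl, dd_mul j hφ hs]
    ring
  have c1 := (contDiff_dd j hs).continuous
  have c2 := (contDiff_dd j hφ).continuous
  have e1 : ∫ x in box R, dd j (φ * s) x * u x
      = (∫ x in box R, (φ x * dd j s x) * u x) + ∫ x in box R, (dd j φ x * s x) * u x := by
    have i1 := integrableOn_box_mul (hφ.continuous.mul c1) hu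
    have i2 := integrableOn_box_mul (c2.mul hs.continuous) hu
    refine Eq.trans ?_ (integral_add i1 i2)
    exact integral_congr_ae (ae_of_all _ fun x => by simp only [hd]; ring)
  have e2 : ∫ x in box R, φ x * (s * w + dd j s * u) x
      = (∫ x in box R, (φ * s) x * w x) + ∫ x in box R, (φ x * dd j s x) * u x := by
    have i1 := integrableOn_box_mul (hφ.continuous.mul hs.continuous) hw
    have i2 := integrableOn_box_mul (hφ.continuous.mul c1) hu
    refine Eq.trans ?_ (integral_add i1 i2)
    exact integral_congr_ae (ae_of_all _ fun x => by simp only [Pi.add_apply, Pi.mul_apply]; ring)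
  have e3 : ∫ x in box R, dd j φ x * (s * u) x = ∫ x in box R, (dd j φ x * s x) * u x :=
    integral_congr_ae (ae_of_all _ fun x => by simp only [Pi.mul_apply]; ring)
  rw [e1] at key
  rw [e2, e3]
  linarith

theorem lintegral_enorm_sq {R : ℝ} {u : Coord → ℝ} (hu : MemLp u 2 (volume.restrict (box R))) :
    ∫⁻ x in box R, ‖u x‖ₑ ^ 2 = ENNReal.ofReal (∫ x in box R, u x ^ 2) := by
  rw [ofReal_integral_eq_lintegral_ofReal hu.integrable_sq (ae_of_all _ fun x => sq_nonneg _)]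
  refine lintegral_congr fun x => ?_
  rw [← ofReal_norm, ← ENNReal.ofReal_pow (norm_nonneg _), Real.norm_eq_abs, sq_abs]

/-- The squared `H¹` norm. -/
noncomputable def sqNorm (R : ℝ) (u : Coord → ℝ) (w : Fin 3 → Coord → ℝ) : ℝ :=
  (∫ x in box R, u x ^ 2) + ∑ i, ∫ x in box R, w i x ^ 2

theorem sqNorm_nonneg (R : ℝ) (u : Coord → ℝ) (w : Fin 3 → Coord → ℝ) : 0 ≤ sqNorm R u w :=
  add_nonneg (integral_nonneg fun _ => sq_nonneg _)
    (Finset.sum_nonneg fun _ _ => integral_nonneg fun _ => sq_nonneg _)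

theorem sumSq_eq {R : ℝ} {u : Coord → ℝ} {w : Fin 3 → Coord → ℝ}
    (hu : MemLp u 2 (volume.restrict (box R))) (hw : ∀ i, MemLp (w i) 2 (volume.restrict (box R))) :
    sumSq R u w = ENNReal.ofReal (sqNorm R u w) := by
  unfold sumSq sqNorm
  rw [ENNReal.ofReal_add (integral_nonneg fun _ => sq_nonneg _)
    (Finset.sum_nonneg fun _ _ => integral_nonneg fun _ => sq_nonneg _),
    ENNReal.ofReal_sum_of_nonneg fun _ _ => integral_nonneg fun _ => sq_nonneg _,
    lintegral_enorm_sq hu]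
  congr 1
  exact Finset.sum_congr rfl fun i _ => lintegral_enorm_sq (hw i)

/-- The square root of the weight is the weight with parameter λ/2, so the derivative formulas for
`wt` apply to it as they stand. -/
theorem wt_half_sq (lam r : ℝ) (x : Coord) : wt (lam / 2) r x ^ 2 = wt lam r x := by
  unfold wt
  rw [← Real.exp_nat_mul]
  congr 1
  push_cast
  ring

theorem abs_dd_wt_half_le {R r lam : ℝ} (hr : R < r) (hlam : 0 < lam) (j : Fin 3) {x : Coord}
    (hx : x ∈ box R) :
    dd j (wt (lam / 2) r) x ^ 2 ≤ 4 * lam ^ 2 * (R + r) ^ 2 * wt lam r x := by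
  have hb := wp_bounds hr hlam (box_subset_Icc R hx)
  by_cases hj : j = 2
  · subst hj
    rw [dd_eq_of_hasDerivAt (contDiff_wt _ _) (hasDerivAt_wt_two (lam / 2) r x)]
    have : 2 * wp (lam / 2) r x * wt (lam / 2) r x = wp lam r x * wt (lam / 2) r x := by
      unfold wp; ring
    rw [this, mul_pow, wt_half_sq]
    exact mul_le_mul_of_nonneg_right hb.2.2.2 (wt_pos _ _ _).le
  · rw [dd_eq_of_hasDerivAt (contDiff_wt _ _) (hasDerivAt_wt_of_ne (lam / 2) r x hj)]
    have := wt_pos lam r x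
    rw [zero_pow two_ne_zero]
    positivity

/-! ### Dependence of the weighted norms on the Carleman parameter -/

section

variable {R r lam : ℝ} {h : Coord → ℝ} {h1 : Fin 3 → Coord → ℝ} {h2 : Fin 3 → Fin 3 → Coord → ℝ}

theorem ZeroDataH2.first_le (H : ZeroDataH2 R h h1 h2) (hR : 0 < R) (hr : R < r)
    (hlam : 1 ≤ lam) (hlam' : 1 ≤ lam * (r - R) ^ 2) :
    ∫ x in box R, wt lam r x * ∑ i, h1 i x ^ 2
      ≤ lam⁻¹ * ∫ x in box R, wt lam r x * (∑ i, h2 i i x) ^ 2 := by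
  have h0 : 0 < lam := by linarith
  have := H.carleman_first hR hr h0 hlam'
  have h3 : 0 ≤ 8 * (r - R) ^ 2 * lam ^ 3 * (∫ x in box R, wt lam r x * h x ^ 2) :=
    mul_nonneg (by positivity) (integral_nonneg fun x => by have := wt_pos lam r x; positivity)
  rw [inv_mul_eq_div, le_div_iff₀ h0]
  linarith

/-- The second order estimate loses λ² against the gradient, and the first order estimate gains λ⁻¹.
The net loss is one power of λ. -/
theorem ZeroDataH2.second_le (H : ZeroDataH2 R h h1 h2) (hR : 0 < R) (hr : R < r)
    (hlam : 1 ≤ lam) (hlam' : 1 ≤ lam * (r - R) ^ 2) :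
    ∫ x in box R, wt lam r x * ∑ i, ∑ j, h2 i j x ^ 2
      ≤ (2 + 32 * (R + r) ^ 2) * lam * ∫ x in box R, wt lam r x * (∑ i, h2 i i x) ^ 2 := by
  have h0 : 0 < lam := by linarith
  have e1 := H.carleman_second hR hr h0
  have e2 := H.first_le hR hr hlam hlam'
  set A := ∫ x in box R, wt lam r x * (∑ i, h2 i i x) ^ 2
  have hA : 0 ≤ A := integral_nonneg fun x => by have := wt_pos lam r x; positivity
  calc _ ≤ 2 * A + 32 * lam ^ 2 * (R + r) ^ 2 * (lam⁻¹ * A) := by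
        refine e1.trans ?_
        gcongr
    _ = 2 * A + 32 * lam * (R + r) ^ 2 * A := by field_simp
    _ ≤ 2 * (lam * A) + 32 * lam * (R + r) ^ 2 * A := by
        gcongr
        nlinarith
    _ = _ := by ring

/-- The bound for the weighted first derivatives in `H¹`. -/
theorem ZeroDataH2.weighted_sqNorm_le (H : ZeroDataH2 R h h1 h2) (hR : 0 < R) (hr : R < r)
    (hlam : 1 ≤ lam) (hlam' : 1 ≤ lam * (r - R) ^ 2) (i : Fin 3) :
    sqNorm R (wt (lam / 2) r * h1 i)
        (fun j => wt (lam / 2) r * h2 i j + dd j (wt (lam / 2) r) * h1 i)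
      ≤ (5 + 88 * (R + r) ^ 2) * lam * ∫ x in box R, wt lam r x * (∑ i, h2 i i x) ^ 2 := by
  have h0 : 0 < lam := by linarith
  have e1 := H.first_le hR hr hlam hlam'
  have e2 := H.second_le hR hr hlam hlam'
  have hcw := (contDiff_wt lam r).continuous
  set A := ∫ x in box R, wt lam r x * (∑ i, h2 i i x) ^ 2 with hA_def
  have hA : 0 ≤ A := integral_nonneg fun x => by have := wt_pos lam r x; positivity
  have hn : ∀ g : Coord → ℝ, 0 ≤ ∫ x in box R, wt lam r x * g x ^ 2 := fun g =>
    integral_nonneg fun x => by have := wt_pos lam r x; positivity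
  rw [integral_mul_sum _ hcw H.memLp1] at e1
  have e2' : ∑ j, ∫ x in box R, wt lam r x * h2 i j x ^ 2 ≤ (2 + 32 * (R + r) ^ 2) * lam * A := by
    refine le_trans ?_ e2
    have := integral_mul_sum (R := R) (Finset.univ ×ˢ Finset.univ) hcw
      (g := fun p : Fin 3 × Fin 3 => h2 p.1 p.2) fun p => H.memLp2 p.1 p.2
    simp only [Finset.sum_product] at this
    rw [this]
    exact Finset.single_le_sum (f := fun i => ∑ j, ∫ x in box R, wt lam r x * h2 i j x ^ 2)
      (fun i _ => Finset.sum_nonneg fun j _ => hn _) (Finset.mem_univ i)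
  have e1' : ∫ x in box R, wt lam r x * h1 i x ^ 2 ≤ lam⁻¹ * A :=
    (Finset.single_le_sum (f := fun i => ∫ x in box R, wt lam r x * h1 i x ^ 2)
      (fun i _ => hn _) (Finset.mem_univ i)).trans e1
  have e0 : ∫ x in box R, (wt (lam / 2) r * h1 i) x ^ 2 = ∫ x in box R, wt lam r x * h1 i x ^ 2 :=
    integral_congr_ae (ae_of_all _ fun x => by
      simp only [Pi.mul_apply, mul_pow, wt_half_sq])
  have e3 : ∀ j, ∫ x in box R, (wt (lam / 2) r * h2 i j + dd j (wt (lam / 2) r) * h1 i) x ^ 2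
      ≤ 2 * (∫ x in box R, wt lam r x * h2 i j x ^ 2)
        + 8 * lam ^ 2 * (R + r) ^ 2 * ∫ x in box R, wt lam r x * h1 i x ^ 2 := by
    intro j
    rw [← integral_const_mul, ← integral_const_mul, ← integral_add
      ((integrable_mul_sq hcw (H.memLp2 i j)).const_mul _)
      ((integrable_mul_sq hcw (H.memLp1 i)).const_mul _)]
    refine integral_mono_of_nonneg (ae_of_all _ fun x => sq_nonneg _)
      (((integrable_mul_sq hcw (H.memLp2 i j)).const_mul _).add
      ((integrable_mul_sq hcw (H.memLp1 i)).const_mul _)) ?_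
    filter_upwards [ae_restrict_mem (measurableSet_box R)] with x hx
    have hd := abs_dd_wt_half_le hr h0 j hx
    simp only [Pi.add_apply, Pi.mul_apply]
    calc (wt (lam / 2) r x * h2 i j x + dd j (wt (lam / 2) r) x * h1 i x) ^ 2
        ≤ 2 * ((wt (lam / 2) r x * h2 i j x) ^ 2 + (dd j (wt (lam / 2) r) x * h1 i x) ^ 2) :=
          add_sq_le
      _ = 2 * (wt lam r x * h2 i j x ^ 2) + 2 * (dd j (wt (lam / 2) r) x ^ 2 * h1 i x ^ 2) := by
          rw [mul_pow, mul_pow, wt_half_sq]; ring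
      _ ≤ 2 * (wt lam r x * h2 i j x ^ 2)
          + 2 * ((4 * lam ^ 2 * (R + r) ^ 2 * wt lam r x) * h1 i x ^ 2) := by gcongr
      _ = _ := by ring
  unfold sqNorm
  rw [e0]
  -- The three directions contribute 3·8 = 24 times (R + r)². Adding 2(2 + 32(R + r)²) from the
  -- second derivatives and 1 from λ⁻¹ ≤ λ gives 5 + 88(R + r)².
  calc _ ≤ lam⁻¹ * A + ∑ j : Fin 3, (2 * (∫ x in box R, wt lam r x * h2 i j x ^ 2)
        + 8 * lam ^ 2 * (R + r) ^ 2 * (lam⁻¹ * A)) := by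
        gcongr with j
        refine (e3 j).trans ?_
        gcongr
    _ = lam⁻¹ * A + 2 * (∑ j : Fin 3, ∫ x in box R, wt lam r x * h2 i j x ^ 2)
        + 24 * (R + r) ^ 2 * lam * A := by
        rw [Finset.sum_add_distrib, ← Finset.mul_sum]
        simp only [Finset.sum_const, Finset.card_univ, Fintype.card_fin, nsmul_eq_mul]
        field_simp
        push_cast
        ring
    _ ≤ lam * A + 2 * ((2 + 32 * (R + r) ^ 2) * lam * A) + 24 * (R + r) ^ 2 * lam * A := by
        gcongr
        exact (inv_le_one_of_one_le₀ hlam).trans hlam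
    _ = _ := by ring

end

/-- The trilinear estimate: `∫ |g| |∂ᵢh|² μ ≤ K ‖g‖_{H¹} λ^{-1/2} ∫ |Δh|² μ`. -/
theorem exists_trilinear {R r : ℝ} (hR : 0 < R) (hr : R < r) : ∃ K : ℝ, 0 ≤ K ∧
    ∀ (lam : ℝ), 1 ≤ lam → 1 ≤ lam * (r - R) ^ 2 →
    ∀ (g : Coord → ℝ) (g1 : Fin 3 → Coord → ℝ), MemLp g 2 (volume.restrict (box R)) →
      (∀ i, MemLp (g1 i) 2 (volume.restrict (box R))) → (∀ i, WeakPartial R i g (g1 i)) →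
    ∀ (h : Coord → ℝ) (h1 : Fin 3 → Coord → ℝ) (h2 : Fin 3 → Fin 3 → Coord → ℝ),
      ZeroDataH2 R h h1 h2 → ∀ i,
      IntegrableOn (fun x => |g x| * (wt lam r x * h1 i x ^ 2)) (box R) ∧
      ∫ x in box R, |g x| * (wt lam r x * h1 i x ^ 2)
        ≤ K * √(sqNorm R g g1) * (√lam)⁻¹ * ∫ x in box R, wt lam r x * (∑ i, h2 i i x) ^ 2 := by
  obtain ⟨S, hS, hsob⟩ := exists_sobolev_six hR
  set c : ℝ := 5 + 88 * (R + r) ^ 2 with hc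
  have hc0 : 0 < c := by positivity
  refine ⟨(S ^ (1 / 6 : ℝ) * S ^ (1 / 12 : ℝ) * ENNReal.ofReal (c ^ (1 / 4 : ℝ))).toReal,
    ENNReal.toReal_nonneg, ?_⟩
  intro lam hlam hlam' g g1 hg hg1 hgw h h1 h2 H i
  have h0 : 0 < lam := by linarith
  set A := ∫ x in box R, wt lam r x * (∑ i, h2 i i x) ^ 2 with hA_def
  have hA : 0 ≤ A := integral_nonneg fun x => by have := wt_pos lam r x; positivity
  have hcs := (contDiff_wt (lam / 2) r)
  set v := wt (lam / 2) r * h1 i with hv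
  set v1 := fun j => wt (lam / 2) r * h2 i j + dd j (wt (lam / 2) r) * h1 i with hv1
  have hmul : ∀ {s u : Coord → ℝ}, ContDiff ℝ ∞ s → MemLp u 2 (volume.restrict (box R)) →
      MemLp (s * u) 2 (volume.restrict (box R)) := by
    intro s u hs hu
    exact ((show TendstoL2 R (fun _ => u) u from ⟨fun _ => hu, hu, by simp⟩).mul_continuous
      hs.continuous).2.1
  have hvm : MemLp v 2 (volume.restrict (box R)) := hmul hcs (H.memLp1 i)
  have hv1m : ∀ j, MemLp (v1 j) 2 (volume.restrict (box R)) := fun j =>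
    (hmul hcs (H.memLp2 i j)).add (hmul (contDiff_dd j hcs) (H.memLp1 i))
  have hvw : ∀ j, WeakPartial R j v (v1 j) := fun j =>
    (H.weak2 i j).mul_smooth (integrableOn_of_memLp_two (H.memLp1 i))
      (integrableOn_of_memLp_two (H.memLp2 i j)) hcs
  have hb := H.weighted_sqNorm_le hR hr hlam hlam' i
  have hv2 : ∫ x in box R, v x ^ 2 ≤ lam⁻¹ * A := by
    have e1 := H.first_le hR hr hlam hlam'
    have hcw := (contDiff_wt lam r).continuous
    rw [integral_mul_sum _ hcw H.memLp1] at e1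
    have e0 : ∫ x in box R, v x ^ 2 = ∫ x in box R, wt lam r x * h1 i x ^ 2 :=
      integral_congr_ae (ae_of_all _ fun x => by
        simp only [hv, Pi.mul_apply, mul_pow, wt_half_sq])
    rw [e0]
    exact (Finset.single_le_sum (f := fun i => ∫ x in box R, wt lam r x * h1 i x ^ 2)
      (fun i _ => integral_nonneg fun x => by have := wt_pos lam r x; positivity)
      (Finset.mem_univ i)).trans e1
  have hle : ∫⁻ x in box R, ‖g x‖ₑ * ‖v x‖ₑ ^ 2
      ≤ (S * ENNReal.ofReal (sqNorm R g g1) ^ 3) ^ (1 / 6 : ℝ)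
        * ENNReal.ofReal (lam⁻¹ * A) ^ (3 / 4 : ℝ)
        * (S * ENNReal.ofReal (c * lam * A) ^ 3) ^ (1 / 12 : ℝ) := by
    refine (lintegral_mul_sq_le hg.1.enorm hvm.1.enorm).trans ?_
    have b1 := hsob g g1 hg hg1 hgw
    have b2 := hsob v v1 hvm hv1m hvw
    rw [sumSq_eq hg hg1] at b1
    rw [sumSq_eq hvm hv1m] at b2
    rw [lintegral_enorm_sq hvm]
    gcongr
    refine b2.trans ?_
    gcongr
  -- Counting powers: λ^(-3/4) from the L² norm and λ^(1/4) from the L⁶ norm leave λ^(-1/2), while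
  -- A^(3/4) A^(1/4) = A.
  have heq : (S * ENNReal.ofReal (sqNorm R g g1) ^ 3) ^ (1 / 6 : ℝ)
        * ENNReal.ofReal (lam⁻¹ * A) ^ (3 / 4 : ℝ)
        * (S * ENNReal.ofReal (c * lam * A) ^ 3) ^ (1 / 12 : ℝ)
      = (S ^ (1 / 6 : ℝ) * S ^ (1 / 12 : ℝ) * ENNReal.ofReal (c ^ (1 / 4 : ℝ)))
        * ENNReal.ofReal (√(sqNorm R g g1) * (√lam)⁻¹ * A) := by
    have hq : ∀ {t p : ℝ}, 0 ≤ t → 0 ≤ p → ENNReal.ofReal t ^ p = ENNReal.ofReal (t ^ p) :=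
      fun ht hp => ENNReal.ofReal_rpow_of_nonneg ht hp
    have hG := sqNorm_nonneg R g g1
    rw [ENNReal.mul_rpow_of_nonneg _ _ (by norm_num), ENNReal.mul_rpow_of_nonneg _ _ (by norm_num),
      ← ENNReal.rpow_natCast, ← ENNReal.rpow_natCast, ← ENNReal.rpow_mul, ← ENNReal.rpow_mul,
      hq hG (by norm_num), hq (by positivity) (by norm_num), hq (by positivity) (by norm_num)]
    have e : (sqNorm R g g1) ^ (((3 : ℕ) : ℝ) * (1 / 6)) * (lam⁻¹ * A) ^ (3 / 4 : ℝ)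
        * (c * lam * A) ^ (((3 : ℕ) : ℝ) * (1 / 12))
        = c ^ (1 / 4 : ℝ) * (√(sqNorm R g g1) * (√lam)⁻¹ * A) := by
      rw [show ((3 : ℕ) : ℝ) * (1 / 6) = 1 / 2 by norm_num,
        show ((3 : ℕ) : ℝ) * (1 / 12) = 1 / 4 by norm_num, ← Real.sqrt_eq_rpow,
        Real.mul_rpow (by positivity) hA, Real.mul_rpow (by positivity) hA,
        Real.mul_rpow hc0.le h0.le]
      have a1 : A ^ (3 / 4 : ℝ) * A ^ (1 / 4 : ℝ) = A := by
        rw [← Real.rpow_add_of_nonneg hA (by norm_num) (by norm_num)]; norm_num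
      have a2 : lam⁻¹ ^ (3 / 4 : ℝ) * lam ^ (1 / 4 : ℝ) = (√lam)⁻¹ := by
        rw [Real.inv_rpow h0.le, ← Real.rpow_neg h0.le, ← Real.rpow_add h0, Real.sqrt_eq_rpow,
          ← Real.rpow_neg h0.le]
        norm_num
      rw [← a2]
      conv_rhs => rw [← a1]
      ring
    calc _ = (S ^ (1 / 6 : ℝ) * S ^ (1 / 12 : ℝ))
          * (ENNReal.ofReal (sqNorm R g g1 ^ (((3 : ℕ) : ℝ) * (1 / 6)))
            * ENNReal.ofReal ((lam⁻¹ * A) ^ (3 / 4 : ℝ))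
            * ENNReal.ofReal ((c * lam * A) ^ (((3 : ℕ) : ℝ) * (1 / 12)))) := by ring
      _ = _ := by
          rw [← ENNReal.ofReal_mul (by positivity), ← ENNReal.ofReal_mul (by positivity), e,
            ENNReal.ofReal_mul (by positivity), ← mul_assoc]
  rw [heq] at hle
  have hpt : ∀ x, ENNReal.ofReal (|g x| * (wt lam r x * h1 i x ^ 2)) = ‖g x‖ₑ * ‖v x‖ₑ ^ 2 := by
    intro x
    rw [← ofReal_norm, ← ofReal_norm, ← ENNReal.ofReal_pow (norm_nonneg _),
      ← ENNReal.ofReal_mul (norm_nonneg _), Real.norm_eq_abs, Real.norm_eq_abs, sq_abs, hv,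
      Pi.mul_apply, mul_pow, wt_half_sq]
  have hnn : ∀ x, 0 ≤ |g x| * (wt lam r x * h1 i x ^ 2) := fun x => by
    have := wt_pos lam r x; positivity
  have hfin : (S ^ (1 / 6 : ℝ) * S ^ (1 / 12 : ℝ) * ENNReal.ofReal (c ^ (1 / 4 : ℝ))) ≠ ⊤ := by
    finiteness
  have hmeas : AEStronglyMeasurable (fun x => |g x| * (wt lam r x * h1 i x ^ 2))
      (volume.restrict (box R)) :=
    hg.1.norm.mul ((contDiff_wt lam r).continuous.aestronglyMeasurable.mul ((H.memLp1 i).1.pow 2))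
  simp_rw [← hpt] at hle
  refine ⟨(lintegral_ofReal_ne_top_iff_integrable hmeas (ae_of_all _ hnn)).1
    (ne_top_of_le_ne_top (by finiteness) hle), ?_⟩
  rw [integral_eq_lintegral_of_nonneg_ae (ae_of_all _ hnn) hmeas]
  refine (ENNReal.toReal_mono (by finiteness) hle).trans (le_of_eq ?_)
  rw [ENNReal.toReal_mul, ENNReal.toReal_ofReal (by positivity)]
  ring

end

section

/-! ### Multi-indices of order at most three -/

/-- The multi-index of `∂ᵢ∂ⱼ`. -/
def MIdx.two (i j : Fin 3) : MIdx :=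
  ⟨fun l => (if l = i then 1 else 0) + (if l = j then 1 else 0), by revert i j; decide⟩

/-- The multi-index of `∂ᵢ∂ⱼ∂ₖ`. -/
def MIdx.three (i j k : Fin 3) : MIdx :=
  ⟨fun l => (if l = i then 1 else 0) + (if l = j then 1 else 0) + (if l = k then 1 else 0),
    by revert i j k; decide⟩

/-- `β' = β + eᵢ`. -/
def MIdx.IsSucc (β : MIdx) (i : Fin 3) (β' : MIdx) : Prop :=
  ∀ l, (β'.1 l : ℕ) = β.1 l + if l = i then 1 else 0

theorem MIdx.isSucc_none (i : Fin 3) : MIdx.none.IsSucc i (MIdx.first i) := by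
  unfold MIdx.IsSucc; revert i; decide

theorem MIdx.isSucc_first (i j : Fin 3) : (MIdx.first i).IsSucc j (MIdx.two i j) := by
  unfold MIdx.IsSucc; revert i j; decide

theorem MIdx.isSucc_two (i j k : Fin 3) : (MIdx.two i j).IsSucc k (MIdx.three i j k) := by
  unfold MIdx.IsSucc; revert i j k; decide

theorem MIdx.two_self (i : Fin 3) : MIdx.two i i = MIdx.second i := by
  revert i; decide

theorem MIdx.exists_eq_of_order_le_two (β : MIdx) (h : β.order ≤ 2) :
    β = MIdx.none ∨ (∃ i, β = MIdx.first i) ∨ ∃ i j, β = MIdx.two i j := by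
  revert β; decide

theorem MIdx.IsSucc.order_eq {β β' : MIdx} {i : Fin 3} (h : β.IsSucc i β') :
    β'.order = β.order + 1 := by
  unfold MIdx.order
  simp_rw [h _, Finset.sum_add_distrib]
  simp

theorem pd_comm {φ : E3 → ℝ} (h : ContDiff ℝ ∞ φ) (i j : Fin 3) :
    pd i (pd j φ) = pd j (pd i φ) := by
  funext x
  have hs : IsSymmSndFDerivAt ℝ φ x := h.contDiffAt.isSymmSndFDerivAt (by
    simp only [minSmoothness_of_isRCLikeNormedField]; exact WithTop.coe_le_coe.2 le_top)
  have key : ∀ i j : Fin 3, pd i (pd j φ) x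
      = fderiv ℝ (fderiv ℝ φ) x (EuclideanSpace.single i 1) (EuclideanSpace.single j 1) := by
    intro i j
    have h1 : ContDiff ℝ ∞ (fderiv ℝ φ) := h.fderiv_right (by simp)
    have h2 := (h1.differentiable (by simp) x).hasFDerivAt
    have h3 : HasFDerivAt (pd j φ)
        ((ContinuousLinearMap.apply ℝ ℝ (EuclideanSpace.single j (1 : ℝ) : E3)).comp
        (fderiv ℝ (fderiv ℝ φ) x)) x :=
      ((ContinuousLinearMap.apply ℝ ℝ (EuclideanSpace.single j (1 : ℝ) : E3)).hasFDerivAt).comp x h2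
    rw [pd, h3.fderiv]
    rfl
  rw [key, key, hs.eq]

theorem pd_iterate_comm {φ : E3 → ℝ} (h : ContDiff ℝ ∞ φ ∧ HasCompactSupport φ) (i j : Fin 3)
    (n : ℕ) : (pd j)^[n] (pd i φ) = pd i ((pd j)^[n] φ) := by
  induction n with
  | zero => rfl
  | succ n ih =>
    rw [Function.iterate_succ_apply', ih, Function.iterate_succ_apply',
      pd_comm (pd_iterate_smooth j n h).1]

/-- `multiDeriv` fixes the order of differentiation, so the extra derivative must be commuted into
its innermost place. -/
theorem multiDeriv_succ {φ : E3 → ℝ} (h : ContDiff ℝ ∞ φ ∧ HasCompactSupport φ) {β β' : MIdx}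
    {i : Fin 3} (hβ : β.IsSucc i β') : multiDeriv β' φ = multiDeriv β (pd i φ) := by
  unfold multiDeriv
  rw [hβ 0, hβ 1, hβ 2]
  have h2 := fun n => pd_iterate_smooth (φ := φ) 2 n h
  fin_cases i
  · have h12 := fun n m => pd_iterate_smooth 1 n (h2 m)
    simp only [Fin.isValue, Fin.zero_eta, if_true, one_ne_zero, if_false, add_zero,
      show (2 : Fin 3) ≠ 0 by decide, Function.iterate_succ_apply]
    rw [pd_iterate_comm h, pd_iterate_comm (h2 _)]
  · simp only [Fin.isValue, Fin.mk_one, if_true, zero_ne_one, if_false, add_zero,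
      show (2 : Fin 3) ≠ 1 by decide, Function.iterate_succ_apply]
    rw [pd_iterate_comm h]
  · simp only [Fin.isValue, Fin.reduceFinMk, if_true, if_false, add_zero,
      show (0 : Fin 3) ≠ 2 by decide, show (1 : Fin 3) ≠ 2 by decide, Function.iterate_succ_apply]

theorem IsTestFunction.pd {Ω : Set E3} {φ : E3 → ℝ} (h : IsTestFunction Ω φ) (i : Fin 3) :
    IsTestFunction Ω (pd i φ) := by
  obtain ⟨h1, h2⟩ := pd_smooth i ⟨h.1, h.2.1⟩
  exact ⟨h1, h2, (tsupport_fderiv_apply_subset ℝ _).trans h.2.2⟩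

variable {R : ℝ} {N : ℕ}

/-- Membership in H³ relates each D^β V to V alone. Testing with ∂ᵢφ links two consecutive
derivatives, since the common sign (-1)^|β| cancels. -/
theorem integral_pd_smul_weakD (V : H3 R N) {β β' : MIdx} {i : Fin 3} (hβ : β.IsSucc i β')
    {φ : E3 → ℝ} (hφ : IsTestFunction (cube R) φ) :
    ∫ x in cube R, pd i φ x • weakD β V x = -∫ x in cube R, φ x • weakD β' V x := by
  have h1 := V.2 β (pd i φ) (hφ.pd i)
  have h2 := V.2 β' φ hφ
  rw [multiDeriv_succ ⟨hφ.1, hφ.2.1⟩ hβ, h1, hβ.order_eq, pow_succ, mul_smul] at h2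
  have h3 := smul_right_injective (CN N) (pow_ne_zero β.order (by norm_num : (-1 : ℝ) ≠ 0)) h2
  rw [neg_one_smul] at h3
  exact h3

/-! ### Components in coordinates -/

theorem toLp_mem_cube {y : Coord} : WithLp.toLp 2 y ∈ cube R ↔ y ∈ box R := by
  rw [mem_box]; rfl

theorem preimage_cube : (WithLp.toLp 2 : Coord → E3) ⁻¹' cube R = box R := by
  ext y; exact toLp_mem_cube

theorem isOpen_cube (R : ℝ) : IsOpen (cube R) := by
  have : cube R = (WithLp.ofLp : E3 → Coord) ⁻¹' box R := by
    ext x; exact mem_box.symm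
  rw [this]
  exact (isOpen_box R).preimage (PiLp.continuous_ofLp 2 _)

theorem measurableSet_cube (R : ℝ) : MeasurableSet (cube R) := (isOpen_cube R).measurableSet

theorem measurePreserving_toLp (R : ℝ) : MeasurePreserving (WithLp.toLp 2 : Coord → E3)
    (volume.restrict (box R)) (volume.restrict (cube R)) := by
  have := (PiLp.volume_preserving_toLp (Fin 3)).restrict_preimage (measurableSet_cube R)
  rwa [preimage_cube] at this

theorem measurableEmbedding_toLp : MeasurableEmbedding (WithLp.toLp 2 : Coord → E3) :=
  (MeasurableEquiv.toLp 2 Coord).measurableEmbedding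

theorem integral_box_eq {F : Type*} [NormedAddCommGroup F] [NormedSpace ℝ F] (f : E3 → F) :
    ∫ y in box R, f (WithLp.toLp 2 y) = ∫ x in cube R, f x :=
  (measurePreserving_toLp R).integral_comp measurableEmbedding_toLp f

instance isFiniteMeasure_cube (R : ℝ) : IsFiniteMeasure (volume.restrict (cube R)) := by
  refine ⟨?_⟩
  rw [← (measurePreserving_toLp R).map_eq, Measure.map_apply (measurePreserving_toLp R).measurable
    MeasurableSet.univ]
  exact measure_lt_top _ _

theorem ae_box_iff {p : E3 → Prop} :
    (∀ᵐ y ∂(volume.restrict (box R)), p (WithLp.toLp 2 y))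
      ↔ ∀ᵐ x ∂(volume.restrict (cube R)), p x := by
  rw [← (measurePreserving_toLp R).map_eq, measurableEmbedding_toLp.ae_map_iff]

/-- The real component of `u` given by a linear functional, in coordinates. -/
noncomputable def comp (c : CN N →L[ℝ] ℝ) (u : L2 R N) : Coord → ℝ :=
  fun y => c (u (WithLp.toLp 2 y))

theorem memLp_comp (c : CN N →L[ℝ] ℝ) (u : L2 R N) :
    MemLp (comp c u) 2 (volume.restrict (box R)) :=
  c.comp_memLp' ((Lp.memLp u).comp_measurePreserving (measurePreserving_toLp R))

/-- The bridge from vector functions on Euclidean space to the scalar calculus in coordinates. A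
real linear functional commutes with the integral, and the change of space preserves measure. -/
theorem weakPartial_comp (c : CN N →L[ℝ] ℝ) (V : H3 R N) {β β' : MIdx} {i : Fin 3}
    (hβ : β.IsSucc i β') : WeakPartial R i (comp c (weakD β V)) (comp c (weakD β' V)) := by
  intro φ hφ hφc hφs
  set L : E3 ≃L[ℝ] Coord := PiLp.continuousLinearEquiv 2 ℝ fun _ : Fin 3 => ℝ
  have hΦ : IsTestFunction (cube R) (φ ∘ L) := by
    refine ⟨hφ.comp L.contDiff, hφc.comp_homeomorph L.toHomeomorph, ?_⟩
    have : tsupport (φ ∘ L) = L ⁻¹' tsupport φ :=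
      tsupport_comp_eq_preimage φ L.toHomeomorph
    rw [this]
    intro x hx
    exact mem_box.1 (hφs hx)
  have hd : ∀ y, pd i (φ ∘ L) (WithLp.toLp 2 y) = dd i φ y := by
    intro y
    unfold pd dd
    rw [L.comp_right_fderiv]
    rfl
  have key := integral_pd_smul_weakD V hβ hΦ
  have k2 := congrArg c key
  rw [map_neg, ← c.integral_comp_comm (integrable_test_smul (pd_smooth i ⟨hΦ.1, hΦ.2.1⟩) _),
    ← c.integral_comp_comm (integrable_test_smul ⟨hΦ.1, hΦ.2.1⟩ _), ← integral_box_eq,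
    ← integral_box_eq] at k2
  simpa only [map_smul, hd, smul_eq_mul] using! k2

/-- The real and imaginary parts of the coordinates of `ℂᴺ`. -/
noncomputable def cf : Fin N ⊕ Fin N → CN N →L[ℝ] ℝ :=
  Sum.elim (fun n => Complex.reCLM.comp ((EuclideanSpace.proj n : CN N →L[ℂ] ℂ).restrictScalars ℝ))
    fun n => Complex.imCLM.comp ((EuclideanSpace.proj n : CN N →L[ℂ] ℂ).restrictScalars ℝ)

/-- The Carleman and trilinear estimates are quadratic in h, so they hold for ℂᴺ-valued functions by
summation over the 2N real components. -/
theorem norm_sq_eq_sum_cf (z : CN N) : ‖z‖ ^ 2 = ∑ l, cf l z ^ 2 := by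
  rw [EuclideanSpace.norm_sq_eq, Fintype.sum_sum_type, ← Finset.sum_add_distrib]
  refine Finset.sum_congr rfl fun n _ => ?_
  rw [Complex.sq_norm, Complex.normSq_apply, sq, sq]
  rfl

theorem abs_cf_le (l : Fin N ⊕ Fin N) (z : CN N) : |cf l z| ≤ ‖z‖ := by
  rw [← sq_le_sq₀ (abs_nonneg _) (norm_nonneg _), sq_abs, norm_sq_eq_sum_cf]
  exact Finset.single_le_sum (f := fun l => cf l z ^ 2) (fun _ _ => sq_nonneg _) (Finset.mem_univ l)

theorem norm_le_sum_cf (z : CN N) : ‖z‖ ≤ ∑ l, |cf l z| := by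
  rw [← sq_le_sq₀ (norm_nonneg _) (Finset.sum_nonneg fun _ _ => abs_nonneg _), norm_sq_eq_sum_cf]
  simp_rw [← sq_abs (cf _ z)]
  exact Finset.sum_sq_le_sq_sum_of_nonneg fun _ _ => abs_nonneg _

theorem integral_norm_sq (u : L2 R N) : ∫ x in cube R, ‖u x‖ ^ 2 = ‖u‖ ^ 2 := by
  have := L2.inner_def (𝕜 := ℝ) u u
  rw [real_inner_self_eq_norm_sq] at this
  rw [this]
  exact integral_congr_ae (ae_of_all _ fun x => (real_inner_self_eq_norm_sq _).symm)

theorem integrable_norm_sq (u : L2 R N) :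
    Integrable (fun x => ‖u x‖ ^ 2) (volume.restrict (cube R)) :=
  (Lp.memLp u).norm.integrable_sq

theorem integral_comp_sq_le (l : Fin N ⊕ Fin N) (u : L2 R N) :
    ∫ y in box R, comp (cf l) u y ^ 2 ≤ ‖u‖ ^ 2 := by
  rw [← integral_norm_sq, ← integral_box_eq]
  refine integral_mono (memLp_comp _ _).integrable_sq
    (((measurePreserving_toLp R).integrable_comp_emb measurableEmbedding_toLp).2
      (integrable_norm_sq u)) fun y => ?_
  simp only
  rw [← sq_abs]
  exact pow_le_pow_left₀ (abs_nonneg _) (abs_cf_le _ _) 2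

theorem norm_sq_eq_sum_weakD (V : H3 R N) : ‖V‖ ^ 2 = ∑ β, ‖weakD β V‖ ^ 2 := by
  exact PiLp.norm_sq_eq_of_L2 _ (V : PiLp 2 fun _ : MIdx => L2 R N)

theorem norm_weakD_le (β : MIdx) (V : H3 R N) : ‖weakD β V‖ ≤ ‖V‖ := by
  rw [← sq_le_sq₀ (norm_nonneg _) (norm_nonneg _), norm_sq_eq_sum_weakD V]
  exact Finset.single_le_sum (f := fun β => ‖weakD β V‖ ^ 2) (fun _ _ => sq_nonneg _)
    (Finset.mem_univ β)

theorem sqNorm_comp_le (l : Fin N ⊕ Fin N) (V : H3 R N) (β : MIdx) (β' : Fin 3 → MIdx) :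
    sqNorm R (comp (cf l) (weakD β V)) (fun i => comp (cf l) (weakD (β' i) V)) ≤ 4 * ‖V‖ ^ 2 := by
  have h : ∀ β, ∫ y in box R, comp (cf l) (weakD β V) y ^ 2 ≤ ‖V‖ ^ 2 := fun β =>
    (integral_comp_sq_le l _).trans (pow_le_pow_left₀ (norm_nonneg _) (norm_weakD_le β V) 2)
  unfold sqNorm
  rw [Fin.sum_univ_three]
  linarith [h β, h (β' 0), h (β' 1), h (β' 2)]

/-- The embedding of `H²` in `L^∞`. -/
theorem exists_bound_weakD (hR : 0 < R) (N : ℕ) : ∃ K : ℝ, 0 ≤ K ∧ ∀ (V : H3 R N),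
    (∀ᵐ x ∂(volume.restrict (cube R)), ‖weakD MIdx.none V x‖ ≤ K * ‖V‖) ∧
    ∀ i, ∀ᵐ x ∂(volume.restrict (cube R)), ‖weakD (MIdx.first i) V x‖ ≤ K * ‖V‖ := by
  obtain ⟨K, hK, hb⟩ := exists_sobolev_bounded hR
  have key : ∀ (V : H3 R N) (β : MIdx) (β1 : Fin 3 → MIdx) (β2 : Fin 3 → Fin 3 → MIdx),
      (∀ i, β.IsSucc i (β1 i)) → (∀ i j, (β1 i).IsSucc j (β2 i j)) →
      ∀ᵐ x ∂(volume.restrict (cube R)), ‖weakD β V x‖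
        ≤ (∑ _l : Fin N ⊕ Fin N, 8 * K.toReal) * ‖V‖ := by
    intro V β β1 β2 h1 h2
    have hl : ∀ l : Fin N ⊕ Fin N, ∀ᵐ x ∂(volume.restrict (cube R)),
        |cf l (weakD β V x)| ≤ 8 * K.toReal * ‖V‖ := by
      intro l
      rw [← ae_box_iff]
      have h := hb (comp (cf l) (weakD β V)) (fun i => comp (cf l) (weakD (β1 i) V))
        (fun i j => comp (cf l) (weakD (β2 i j) V)) (memLp_comp _ _) (fun i => memLp_comp _ _)
        (fun i j => memLp_comp _ _) (fun i => weakPartial_comp _ V (h1 i))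
        fun i j => weakPartial_comp _ V (h2 i j)
      have hs : ∀ (β : MIdx) (β' : Fin 3 → MIdx),
          sumSq R (comp (cf l) (weakD β V)) (fun i => comp (cf l) (weakD (β' i) V)) ^ (1 / 2 : ℝ)
            ≤ ENNReal.ofReal (2 * ‖V‖) := by
        intro β β'
        rw [sumSq_eq (memLp_comp _ _) fun i => memLp_comp _ _,
          ENNReal.ofReal_rpow_of_nonneg (sqNorm_nonneg _ _ _) (by norm_num), ← Real.sqrt_eq_rpow]
        refine ENNReal.ofReal_le_ofReal ?_
        rw [Real.sqrt_le_left (by positivity)]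
        exact (sqNorm_comp_le l V β β').trans (le_of_eq (by ring))
      filter_upwards [h] with y hy
      have h4 : ‖comp (cf l) (weakD β V) y‖ₑ ≤ ENNReal.ofReal (8 * K.toReal * ‖V‖) := by
        refine hy.trans ?_
        -- One H¹ norm of the function and three of its first derivatives, each at most 2‖V‖,
        -- explain the factor 8.
        calc _ ≤ K * (ENNReal.ofReal (2 * ‖V‖) + ∑ _i : Fin 3, ENNReal.ofReal (2 * ‖V‖)) := by
              gcongr with i
              · exact hs _ _
              · exact hs _ _
          _ = ENNReal.ofReal K.toReal * ENNReal.ofReal (8 * ‖V‖) := by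
              rw [ENNReal.ofReal_toReal hK, ← ENNReal.ofReal_sum_of_nonneg
                fun _ _ => by positivity, ← ENNReal.ofReal_add (by positivity)
                (Finset.sum_nonneg fun _ _ => by positivity)]
              congr 2
              simp
              ring
          _ = _ := by
              rw [← ENNReal.ofReal_mul ENNReal.toReal_nonneg]
              congr 1
              ring
      rw [← ofReal_norm, ENNReal.ofReal_le_ofReal_iff (by positivity)] at h4
      exact h4
    filter_upwards [ae_all_iff.2 hl] with x hx
    refine (norm_le_sum_cf _).trans ?_
    rw [Finset.sum_mul]
    exact Finset.sum_le_sum fun l _ => hx l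
  refine ⟨∑ _l : Fin N ⊕ Fin N, 8 * K.toReal, by positivity, fun V => ⟨?_, fun i => ?_⟩⟩
  · exact key V _ MIdx.first MIdx.two MIdx.isSucc_none MIdx.isSucc_first
  · exact key V _ (MIdx.two i) (MIdx.three i) (MIdx.isSucc_first i) (MIdx.isSucc_two i)

/-! ### The closed cube -/

theorem ofLp_mem_Icc {x : E3} : x.ofLp ∈ Icc (fun _ => -R : Coord) (fun _ => R) ↔ ∀ i, |x i| ≤ R := by
  simp only [mem_Icc, Pi.le_def, abs_le]
  exact ⟨fun h i => ⟨h.1 i, h.2 i⟩, fun h => ⟨fun i => (h i).1, fun i => (h i).2⟩⟩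

theorem closure_cube (hR : 0 < R) : closure (cube R) = {x | ∀ i, |x i| ≤ R} := by
  set L : E3 ≃ₜ Coord := (PiLp.continuousLinearEquiv 2 ℝ fun _ : Fin 3 => ℝ).toHomeomorph
  have h1 : cube R = L ⁻¹' box R := by
    ext x; exact mem_box.symm
  rw [h1, ← L.preimage_closure, box, closure_pi_set]
  ext x
  simp only [closure_Ioo (show -R ≠ R by linarith), mem_preimage, Set.mem_pi, mem_univ, true_imp_iff,
    Set.mem_ofPred_eq, abs_le, mem_Icc]
  rfl

theorem mem_frontier_cube (hR : 0 < R) {x : E3} (hx : ∀ i, |x i| ≤ R) {i : Fin 3}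
    (hi : |x i| = R) : x ∈ frontier (cube R) := by
  rw [(isOpen_cube R).frontier_eq, closure_cube hR]
  exact ⟨hx, fun h => (h i).ne hi⟩

theorem closure_cube_coord (hR : 0 < R) {y : Coord}
    (hy : y ∈ Icc (fun _ => -R : Coord) (fun _ => R)) : WithLp.toLp 2 y ∈ closure (cube R) := by
  rw [closure_cube hR]
  exact ofLp_mem_Icc.1 hy

theorem continuousOn_comp_toLp (hR : 0 < R) (c : CN N →L[ℝ] ℝ) {g : E3 → CN N}
    (hg : ContinuousOn g (closure (cube R))) :
    ContinuousOn (fun y : Coord => c (g (WithLp.toLp 2 y))) (Icc (fun _ => -R) fun _ => R) :=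
  c.continuous.comp_continuousOn (hg.comp (PiLp.continuous_toLp 2 _).continuousOn
    fun _ hy => closure_cube_coord hR hy)

/-- Γ omits its edges, whereas the Carleman estimate uses the closed face. Shrinking the horizontal
coordinates approaches any point of the closed face from Γ, and continuity extends the boundary
condition. -/
theorem closure_lowerFace (hR : 0 < R) {x : E3} (hx : ∀ i, |x i| ≤ R) (h2 : x 2 = -R) :
    x ∈ closure (lowerFace R) := by
  have hlim : Tendsto (fun t : ℝ => (!₂[t * x 0, t * x 1, -R] : E3)) (𝓝[<] 1) (𝓝 x) := by
    have hc : Continuous fun t : ℝ => (!₂[t * x 0, t * x 1, -R] : E3) := by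
      refine (PiLp.continuous_toLp 2 _).comp (continuous_pi fun i => ?_)
      fin_cases i <;> simp <;> fun_prop
    have h1 : (!₂[1 * x 0, 1 * x 1, -R] : E3) = x := by
      ext i
      fin_cases i <;> simp [h2]
    have := hc.tendsto 1
    rw [h1] at this
    exact this.mono_left nhdsWithin_le_nhds
  refine mem_closure_of_tendsto hlim ?_
  filter_upwards [Ioo_mem_nhdsLT (show (0 : ℝ) < 1 by norm_num)] with t ht
  have : ∀ i, |t * x i| < R := fun i => by
    rw [abs_mul, abs_of_pos ht.1]
    nlinarith [hx i, ht.1, ht.2, abs_nonneg (x i)]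
  exact ⟨by simpa using this 0, by simpa using this 1, by simp⟩

/-- The components of elements of `H³₀` satisfy the assumptions of the Carleman estimates. -/
theorem zeroDataH2_comp (hR : 0 < R) {h : H3 R N} (hh : h ∈ H03 R N) (c : CN N →L[ℝ] ℝ) :
    ZeroDataH2 R (comp c (weakD MIdx.none h)) (fun i => comp c (weakD (MIdx.first i) h))
      fun i j => comp c (weakD (MIdx.two i j) h) where
  memLp0 := memLp_comp _ _
  memLp1 _ := memLp_comp _ _
  memLp2 _ _ := memLp_comp _ _
  weak1 i := weakPartial_comp c h (MIdx.isSucc_none i)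
  weak2 i j := weakPartial_comp c h (MIdx.isSucc_first i j)
  zero := by
    obtain ⟨g, hg, hgae, hg0⟩ := hh.1
    refine ⟨fun y => c (g (WithLp.toLp 2 y)), continuousOn_comp_toLp hR c hg, ?_, ?_⟩
    · filter_upwards [ae_box_iff.2 hgae] with y hy
      simp only [comp, hy]
    · rintro y hy ⟨i, hi⟩
      simp only [hg0 _ (mem_frontier_cube hR (ofLp_mem_Icc.1 hy) hi), Pi.zero_apply, map_zero]
  face := by
    obtain ⟨g, hg, hgae, hg0⟩ := hh.2
    refine ⟨fun y => c (g (WithLp.toLp 2 y)), continuousOn_comp_toLp hR c hg, ?_, ?_⟩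
    · filter_upwards [ae_box_iff.2 hgae] with y hy
      simp only [comp, hy]
    · intro y hy hy2
      have hsub : closure (lowerFace R) ⊆ closure (cube R) := by
        refine closure_minimal (fun x hx => ?_) isClosed_closure
        rw [closure_cube hR]
        intro i
        fin_cases i
        · exact hx.1.le
        · exact hx.2.1.le
        · change |x 2| ≤ R
          rw [hx.2.2, abs_neg, abs_of_pos hR]
      have hz : EqOn g 0 (closure (lowerFace R)) := by
        intro x hx
        have h1 : Tendsto g (𝓝[lowerFace R] x) (𝓝 (g x)) :=
          ((hg x (hsub hx)).mono (subset_closure.trans hsub))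
        have : NeBot (𝓝[lowerFace R] x) := mem_closure_iff_nhdsWithin_neBot.1 hx
        refine tendsto_nhds_unique (h1.congr' ?_) tendsto_const_nhds
        filter_upwards [self_mem_nhdsWithin] with y hy using hg0 y hy
      have := hz (closure_lowerFace hR (x := WithLp.toLp 2 y) (ofLp_mem_Icc.1 hy) hy2)
      simp only [this, Pi.zero_apply, map_zero]

end

section

/-! ### The coefficients of the nonlinear operator -/

theorem contDiff_orthoBasis (a : ℝ) (n : ℕ) : ContDiff ℝ ∞ (orthoBasis a n) := by
  induction n using Nat.strong_induction_on with
  | _ n ih =>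
    have h : orthoBasis a n = fun α => α ^ n * Real.exp α - ∑ j : Fin n,
        (∫ t in (-a)..a, t ^ n * Real.exp t * orthoBasis a j t) /
          (∫ t in (-a)..a, orthoBasis a j t ^ 2) * orthoBasis a j α := by
      exact funext (orthoBasis.eq_1 a n)
    rw [h]
    refine ContDiff.sub ((contDiff_id.pow n).mul Real.contDiff_exp) ?_
    exact ContDiff.sum fun j _ => contDiff_const.mul (ih j j.2)

theorem contDiff_Psi (a : ℝ) (n : ℕ) : ContDiff ℝ ∞ (Psi a n) :=
  (contDiff_orthoBasis a n).div_const _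

theorem continuous_Psi (a : ℝ) (n : ℕ) : Continuous (Psi a n) := (contDiff_Psi a n).continuous

theorem continuous_deriv_Psi (a : ℝ) (n : ℕ) : Continuous (deriv (Psi a n)) :=
  (contDiff_Psi a n).continuous_deriv (by simp)

variable {R : ℝ} {N : ℕ}

theorem norm_sub_source_pos {d : ℝ} (hR : 0 < R) (hd : R < d) {x : E3} (hx : x ∈ closure (cube R))
    (α : ℝ) : 0 < ‖x - source d α‖ := by
  rw [norm_pos_iff, sub_ne_zero]
  rintro rfl
  rw [closure_cube hR] at hx
  have := hx 2
  simp only [source, PiLp.toLp_apply, Matrix.cons_val, abs_neg] at this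
  have := le_abs_self d
  linarith

/-- An integral over a parameter of a function on the cube that is jointly continuous. -/
theorem integral_param {a : ℝ} (ha : 0 < a) (hR : 0 < R) {G : E3 → ℝ → ℂ}
    (hm : Measurable (Function.uncurry G))
    (hc : ContinuousOn (Function.uncurry G) (closure (cube R) ×ˢ Icc (-a) a)) :
    AEStronglyMeasurable (fun x => ∫ α in (-a)..a, G x α) (volume.restrict (cube R)) ∧
    (∃ C, ∀ x ∈ cube R, ‖∫ α in (-a)..a, G x α‖ ≤ C) ∧
    ∀ x ∈ cube R, IntervalIntegrable (G x) volume (-a) a := by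
  have hle : -a ≤ a := by linarith
  have hK : IsCompact (closure (cube R)) := by
    have h : closure (cube R) = (WithLp.toLp 2 : Coord → E3) '' Icc (fun _ => -R) (fun _ => R) := by
      ext x
      rw [closure_cube hR]
      constructor
      · intro hx
        exact ⟨x.ofLp, ofLp_mem_Icc.2 hx, rfl⟩
      · rintro ⟨y, hy, rfl⟩
        exact ofLp_mem_Icc.1 hy
    rw [h]
    exact isCompact_Icc.image (PiLp.continuous_toLp 2 _)
  refine ⟨?_, ?_, ?_⟩
  · simp_rw [intervalIntegral.integral_of_le hle]
    exact (hm.stronglyMeasurable.integral_prod_right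
      (ν := volume.restrict (Ioc (-a) a))).aestronglyMeasurable
  · obtain ⟨C, hC⟩ := (hK.prod isCompact_Icc).exists_bound_of_continuousOn hc
    refine ⟨C * |a - -a|, fun x hx => ?_⟩
    refine intervalIntegral.norm_integral_le_of_norm_le_const fun α hα => ?_
    rw [uIoc_of_le hle] at hα
    exact hC (x, α) ⟨subset_closure hx, hα.1.le, hα.2⟩
  · intro x hx
    refine ContinuousOn.intervalIntegrable ?_
    rw [uIcc_of_le hle]
    exact hc.comp (f := fun α => (x, α)) (by fun_prop) fun α hα => ⟨subset_closure hx, hα⟩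

theorem continuous_source (d : ℝ) : Continuous (source d) := by
  refine (PiLp.continuous_toLp 2 _).comp (continuous_pi fun i => ?_)
  fin_cases i <;> simp <;> fun_prop

theorem continuous_sub_source (d : ℝ) : Continuous fun q : E3 × ℝ => q.1 - source d q.2 :=
  continuous_fst.sub ((continuous_source d).comp continuous_snd)

theorem continuous_sub_source_apply (d : ℝ) (i : Fin 3) :
    Continuous fun q : E3 × ℝ => (q.1 - source d q.2) i :=
  (EuclideanSpace.proj (𝕜 := ℝ) i).continuous.comp (continuous_sub_source d)

theorem xTilde_regular {k d : ℝ} (hR : 0 < R) (hd : R < d) (i : Fin 3) :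
    Measurable (fun q : E3 × ℝ => xTilde k d q.2 q.1 i) ∧
    ∀ a, ContinuousOn (fun q : E3 × ℝ => xTilde k d q.2 q.1 i) (closure (cube R) ×ˢ Icc (-a) a) := by
  have h1 : Continuous fun q : E3 × ℝ => (((q.1 - source d q.2) i : ℝ) : ℂ) :=
    Complex.continuous_ofReal.comp (continuous_sub_source_apply d i)
  have h2 : Continuous fun q : E3 × ℝ => ((‖q.1 - source d q.2‖ : ℝ) : ℂ) :=
    Complex.continuous_ofReal.comp (continuous_sub_source d).norm
  unfold xTilde
  refine ⟨?_, fun a => ?_⟩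
  · exact ((h1.measurable.const_mul _).div h2.measurable).sub
      (h1.measurable.div (h2.measurable.pow_const 2))
  · have hne : ∀ q ∈ closure (cube R) ×ˢ Icc (-a) a, ((‖q.1 - source d q.2‖ : ℝ) : ℂ) ≠ 0 :=
      fun q hq => Complex.ofReal_ne_zero.2 (norm_sub_source_pos hR hd hq.1 q.2).ne'
    exact (((continuous_const.mul h1).continuousOn).div h2.continuousOn hne).sub
      (h1.continuousOn.div (h2.pow 2).continuousOn fun q hq => pow_ne_zero 2 (hne q hq))

theorem xHat_regular {k d : ℝ} (hR : 0 < R) (hd : R < d) (i : Fin 3) :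
    Measurable (fun q : E3 × ℝ => xHat k d q.2 q.1 i) ∧
    ∀ a, ContinuousOn (fun q : E3 × ℝ => xHat k d q.2 q.1 i) (closure (cube R) ×ˢ Icc (-a) a) := by
  have h2 : Continuous fun q : E3 × ℝ => ((‖q.1 - source d q.2‖ : ℝ) : ℂ) :=
    Complex.continuous_ofReal.comp (continuous_sub_source d).norm
  have hx : ∀ j : Fin 3, Continuous fun q : E3 × ℝ => q.1 j := fun j =>
    (EuclideanSpace.proj (𝕜 := ℝ) j).continuous.comp continuous_fst
  have hA : Continuous fun q : E3 × ℝ => (((![-(q.1 1) ^ 2 - (q.1 2 + d) ^ 2,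
      (q.1 0 - q.2) * q.1 1, (q.1 0 - q.2) * (q.1 2 + d)] : Fin 3 → ℝ) i : ℝ) : ℂ) := by
    have := hx 0; have := hx 1; have := hx 2
    refine Complex.continuous_ofReal.comp ?_
    fin_cases i <;> simp <;> fun_prop
  have hB : Continuous fun q : E3 × ℝ => (((![(q.1 0 - q.2) ^ 2 - (q.1 1) ^ 2 - (q.1 2 + d) ^ 2,
      2 * (q.1 0 - q.2) * q.1 1, 2 * (q.1 0 - q.2) * (q.1 2 + d)] : Fin 3 → ℝ) i : ℝ) : ℂ) := by
    have := hx 0; have := hx 1; have := hx 2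
    refine Complex.continuous_ofReal.comp ?_
    fin_cases i <;> simp <;> fun_prop
  unfold xHat
  refine ⟨?_, fun a => ?_⟩
  · exact ((measurable_const.div (h2.measurable.pow_const 3)).mul hA.measurable).sub
      ((measurable_const.div (h2.measurable.pow_const 4)).mul hB.measurable)
  · have hne : ∀ q ∈ closure (cube R) ×ˢ Icc (-a) a, ((‖q.1 - source d q.2‖ : ℝ) : ℂ) ≠ 0 :=
      fun q hq => Complex.ofReal_ne_zero.2 (norm_sub_source_pos hR hd hq.1 q.2).ne'
    exact ((continuousOn_const.div (h2.pow 3).continuousOn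
        fun q hq => pow_ne_zero 3 (hne q hq)).mul hA.continuousOn).sub
      ((continuousOn_const.div (h2.pow 4).continuousOn
        fun q hq => pow_ne_zero 4 (hne q hq)).mul hB.continuousOn)

theorem integral_param_mul {a : ℝ} (ha : 0 < a) (hR : 0 < R) {X : ℝ → E3 → ℂ} {w : ℝ → ℂ}
    (hw : Continuous w) (hX : Measurable (fun q : E3 × ℝ => X q.2 q.1) ∧
      ∀ a, ContinuousOn (fun q : E3 × ℝ => X q.2 q.1) (closure (cube R) ×ˢ Icc (-a) a)) :
    AEStronglyMeasurable (fun x => ∫ α in (-a)..a, w α * X α x) (volume.restrict (cube R)) ∧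
    (∃ C, ∀ x ∈ cube R, ‖∫ α in (-a)..a, w α * X α x‖ ≤ C) ∧
    ∀ x ∈ cube R, IntervalIntegrable (fun α => w α * X α x) volume (-a) a := by
  have h2 : Continuous fun q : E3 × ℝ => w q.2 := hw.comp continuous_snd
  exact integral_param ha hR (G := fun x α => w α * X α x) (h2.measurable.mul hX.1)
    (h2.continuousOn.mul (hX.2 a))

/-- The coordinates of `ℂᴺ`, as real linear maps. -/
noncomputable def coordCLM (n : Fin N) : CN N →L[ℝ] ℂ :=
  (EuclideanSpace.proj n : CN N →L[ℂ] ℂ).restrictScalars ℝ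

@[simp] theorem coordCLM_apply (n : Fin N) (p : CN N) : coordCLM n p = p n := rfl

/-- The columns of `S_N⁻¹`. -/
noncomputable def colS (a : ℝ) (N : ℕ) (m : Fin N) : CN N :=
  WithLp.toLp 2 fun j => (((matS a N)⁻¹ j m : ℝ) : ℂ)

/-- The quadratic part of `S_N⁻¹ f`, for a single partial derivative. -/
noncomputable def quadB (a : ℝ) (N : ℕ) : CN N →L[ℝ] CN N →L[ℝ] CN N :=
  ∑ m : Fin N, ∑ n : Fin N, ∑ l : Fin N,
    (2 * ∫ α in (-a)..a, (Psi a m α * Psi a n α * deriv (Psi a l) α : ℂ)) •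
      (coordCLM n).smulRight ((coordCLM l).smulRight (colS a N m))

/-- The coefficient functions of the linear part of `f`. -/
noncomputable def linCoeff (a d k : ℝ) (i : Fin 3) (m n : ℕ) (x : E3) : ℂ :=
  2 * (∫ α in (-a)..a, (Psi a m α * deriv (Psi a n) α : ℂ) * xTilde k d α x i)
    + 2 * ∫ α in (-a)..a, (Psi a m α * Psi a n α : ℂ) * xHat k d α x i

/-- The linear part of `S_N⁻¹ f`, for a single partial derivative. -/
noncomputable def linL (a d k : ℝ) (N : ℕ) (i : Fin 3) (x : E3) : CN N →L[ℝ] CN N :=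
  ∑ m : Fin N, ∑ n : Fin N, linCoeff a d k i m n x • (coordCLM n).smulRight (colS a N m)

theorem continuous_weight_deriv (a : ℝ) (m n : ℕ) :
    Continuous fun α : ℝ => (Psi a m α * deriv (Psi a n) α : ℂ) :=
  (Complex.continuous_ofReal.comp (continuous_Psi a m)).mul
    (Complex.continuous_ofReal.comp (continuous_deriv_Psi a n))

theorem continuous_weight (a : ℝ) (m n : ℕ) :
    Continuous fun α : ℝ => (Psi a m α * Psi a n α : ℂ) :=
  (Complex.continuous_ofReal.comp (continuous_Psi a m)).mul
    (Complex.continuous_ofReal.comp (continuous_Psi a n))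

section

variable {a d k : ℝ} (ha : 0 < a) (hR : 0 < R) (hd : R < d)

include ha hR hd

theorem aestronglyMeasurable_linCoeff (i : Fin 3) (m n : ℕ) :
    AEStronglyMeasurable (linCoeff a d k i m n) (volume.restrict (cube R)) :=
  ((integral_param_mul (X := fun α x => xTilde k d α x i) ha hR (continuous_weight_deriv a m n) (xTilde_regular hR hd i)).1.const_mul
    _).add ((integral_param_mul (X := fun α x => xHat k d α x i) ha hR (continuous_weight a m n) (xHat_regular hR hd i)).1.const_mul _)

theorem exists_bound_linCoeff (i : Fin 3) (m n : ℕ) :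
    ∃ C, ∀ x ∈ cube R, ‖linCoeff a d k i m n x‖ ≤ C := by
  obtain ⟨C1, h1⟩ := (integral_param_mul (X := fun α x => xTilde k d α x i) ha hR (continuous_weight_deriv a m n)
    (xTilde_regular (k := k) hR hd i)).2.1
  obtain ⟨C2, h2⟩ := (integral_param_mul (X := fun α x => xHat k d α x i) ha hR (continuous_weight a m n)
    (xHat_regular (k := k) hR hd i)).2.1
  refine ⟨2 * C1 + 2 * C2, fun x hx => (norm_add_le _ _).trans ?_⟩
  rw [norm_mul, norm_mul, Complex.norm_ofNat]
  linarith [h1 x hx, h2 x hx]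

theorem aestronglyMeasurable_linL (i : Fin 3) :
    AEStronglyMeasurable (linL a d k N i) (volume.restrict (cube R)) := by
  unfold linL
  refine Finset.aestronglyMeasurable_fun_sum _ fun m _ =>
    Finset.aestronglyMeasurable_fun_sum _ fun n _ => ?_
  exact (aestronglyMeasurable_linCoeff ha hR hd i m n).smul_const _

theorem exists_bound_linL (N : ℕ) : ∃ C, 0 ≤ C ∧ ∀ i, ∀ x ∈ cube R, ‖linL a d k N i x‖ ≤ C := by
  choose c hc using fun i m n => exists_bound_linCoeff (k := k) ha hR hd i m n
  have key : ∀ i, ∀ x ∈ cube R, ‖linL a d k N i x‖ ≤ ∑ m : Fin N, ∑ n : Fin N,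
      |c i m n| * ‖(coordCLM n).smulRight (colS a N m)‖ := by
    intro i x hx
    refine (norm_sum_le _ _).trans (Finset.sum_le_sum fun m _ => (norm_sum_le _ _).trans
      (Finset.sum_le_sum fun n _ => ?_))
    rw [norm_smul]
    exact mul_le_mul_of_nonneg_right ((hc i m n x hx).trans (le_abs_self _)) (norm_nonneg _)
  refine ⟨∑ i, ∑ m : Fin N, ∑ n : Fin N, |c i m n| * ‖(coordCLM n).smulRight (colS a N m)‖,
    by positivity, fun i x hx => (key i x hx).trans ?_⟩
  exact Finset.single_le_sum (f := fun i => ∑ m : Fin N, ∑ n : Fin N,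
    |c i m n| * ‖(coordCLM n).smulRight (colS a N m)‖) (fun i _ => by positivity)
    (Finset.mem_univ i)

/-- Gathering f by partial derivatives shows that different directions do not interact. The point
must lie in the cube, where the source is at positive distance, so that the integrals over α may be
split. -/
theorem quadF_eq {x : E3} (hx : x ∈ cube R) (P : Fin 3 → CN N) (m : Fin N) :
    quadF a d k N x (fun n i => P i n) m
      = (∑ i, ∑ n : Fin N, ∑ l : Fin N,
          (2 * ∫ α in (-a)..a, (Psi a m α * Psi a n α * deriv (Psi a l) α : ℂ)) * (P i n * P i l))
        + ∑ i, ∑ n : Fin N, linCoeff a d k i m n x * P i n := by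
  have e1 : ∀ n : Fin N, (∫ α in (-a)..a, (Psi a m α * deriv (Psi a n) α : ℂ)
      * ((fun i => P i n) ⬝ᵥ xTilde k d α x))
      = ∑ i, (∫ α in (-a)..a, (Psi a m α * deriv (Psi a n) α : ℂ) * xTilde k d α x i) * P i n := by
    intro n
    simp_rw [dotProduct, Finset.mul_sum]
    rw [intervalIntegral.integral_finsetSum]
    · refine Finset.sum_congr rfl fun i _ => ?_
      rw [← intervalIntegral.integral_mul_const]
      congr 1; funext α; ring
    · intro i _
      have := ((integral_param_mul (X := fun α x => xTilde k d α x i) ha hR (continuous_weight_deriv a m n)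
        (xTilde_regular (k := k) hR hd i)).2.2 x hx).mul_const (P i n)
      refine this.congr_ae (ae_of_all _ fun α => ?_)
      ring
  have e2 : ∀ n : Fin N, (∫ α in (-a)..a, (Psi a m α * Psi a n α : ℂ)
      * (xHat k d α x ⬝ᵥ fun i => P i n))
      = ∑ i, (∫ α in (-a)..a, (Psi a m α * Psi a n α : ℂ) * xHat k d α x i) * P i n := by
    intro n
    simp_rw [dotProduct, Finset.mul_sum]
    rw [intervalIntegral.integral_finsetSum]
    · refine Finset.sum_congr rfl fun i _ => ?_
      rw [← intervalIntegral.integral_mul_const]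
      congr 1; funext α; ring
    · intro i _
      have := ((integral_param_mul (X := fun α x => xHat k d α x i) ha hR (continuous_weight a m n)
        (xHat_regular (k := k) hR hd i)).2.2 x hx).mul_const (P i n)
      refine this.congr_ae (ae_of_all _ fun α => ?_)
      ring
  unfold quadF
  simp_rw [e1, e2]
  rw [add_assoc]
  congr 1
  · simp_rw [dotProduct, Finset.sum_mul, Finset.mul_sum]
    refine Eq.trans ?_ Finset.sum_comm
    refine Finset.sum_congr rfl fun n _ => Eq.trans ?_ Finset.sum_comm
    exact Finset.sum_congr rfl fun l _ => Finset.sum_congr rfl fun i _ => by ring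
  · unfold linCoeff
    simp_rw [add_mul, Finset.sum_add_distrib, Finset.mul_sum]
    congr 1
    · rw [Finset.sum_comm]
      exact Finset.sum_congr rfl fun i _ => Finset.sum_congr rfl fun n _ => by ring
    · rw [Finset.sum_comm]
      exact Finset.sum_congr rfl fun i _ => Finset.sum_congr rfl fun n _ => by ring

/-- Reduces K to one fixed bilinear map and bounded linear coefficients. Invertibility of S_N plays
no role in the estimates; only the entries of its (possibly default) inverse appear. -/
theorem termK_eq {x : E3} (hx : x ∈ cube R) (P : Fin 3 → CN N) :
    termK a d k N x (fun n i => P i n)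
      = (∑ i, quadB a N (P i) (P i)) + ∑ i, linL a d k N i x (P i) := by
  have h1 : termK a d k N x (fun n i => P i n)
      = ∑ m, quadF a d k N x (fun n i => P i n) m • colS a N m := by
    ext j
    simp [termK, colS, Matrix.mulVec, dotProduct, mul_comm]
  rw [h1]
  simp_rw [quadF_eq ha hR hd hx P, add_smul, Finset.sum_add_distrib, Finset.sum_smul]
  congr 1
  · unfold quadB
    simp only [_root_.sum_apply, _root_.smul_apply,
      ContinuousLinearMap.smulRight_apply, coordCLM_apply]
    rw [Finset.sum_comm]
    simp only [smul_smul, mul_assoc]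
  · unfold linL
    simp only [_root_.sum_apply, _root_.smul_apply,
      ContinuousLinearMap.smulRight_apply, coordCLM_apply]
    rw [Finset.sum_comm]
    simp only [smul_smul]

end

end

section

/-! ### The functional as a polynomial map between Hilbert spaces -/

variable {R : ℝ} {N : ℕ}

/-- The weak derivative as a continuous linear map. -/
noncomputable def weakDL (β : MIdx) : H3 R N →L[ℝ] L2 R N :=
  (PiLp.proj 2 (fun _ : MIdx => L2 R N) β).comp (sobolevH3 R N).subtypeL

@[simp] theorem weakDL_apply (β : MIdx) (V : H3 R N) : weakDL β V = weakD β V := rfl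

/-- Upgrades a pointwise bound to a bounded map into L^∞. Applied to first derivatives, it lets a
product of two gradients be estimated in L² by pairing L^∞ with L². -/
theorem exists_toLinf {T : H3 R N →L[ℝ] L2 R N} {K : ℝ} (hK : 0 ≤ K)
    (h : ∀ V, ∀ᵐ x ∂(volume.restrict (cube R)), ‖T V x‖ ≤ K * ‖V‖) :
    ∃ S : H3 R N →L[ℝ] Lp (CN N) ⊤ (volume.restrict (cube R)),
      ∀ V, S V =ᵐ[volume.restrict (cube R)] T V := by
  have hm : ∀ V, MemLp (T V) ⊤ (volume.restrict (cube R)) := fun V =>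
    memLp_top_of_bound (Lp.memLp (T V)).1 _ (h V)
  let S0 : H3 R N →ₗ[ℝ] Lp (CN N) ⊤ (volume.restrict (cube R)) :=
    { toFun := fun V => (hm V).toLp _
      map_add' := fun V W => by
        rw [← MemLp.toLp_add]
        refine MemLp.toLp_congr _ _ ?_
        rw [map_add]
        exact Lp.coeFn_add _ _
      map_smul' := fun c V => by
        rw [RingHom.id_apply, ← MemLp.toLp_const_smul]
        refine MemLp.toLp_congr _ _ ?_
        rw [map_smul]
        exact Lp.coeFn_smul _ _ }
  have hS : ∀ V, S0 V =ᵐ[volume.restrict (cube R)] T V := fun V => (hm V).coeFn_toLp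
  -- For the exponent ∞ the convention `⊤.toReal = 0` makes the power of the total measure equal to
  -- 1, so the bound is K itself.
  refine ⟨S0.mkContinuous (measureUnivNNReal (volume.restrict (cube R)) ^ (⊤ : ENNReal).toReal⁻¹ * K)
    fun V => ?_, hS⟩
  rw [mul_assoc]
  refine Lp.norm_le_of_ae_bound (by positivity) ?_
  filter_upwards [hS V, h V] with x h1 h2
  rw [h1]
  exact h2

theorem exists_mulL {E : Type*} [NormedAddCommGroup E] [NormedSpace ℝ E]
    (B : E →L[ℝ] CN N →L[ℝ] CN N) {c : E3 → E}
    (hc : AEStronglyMeasurable c (volume.restrict (cube R))) {C : ℝ} (hC : ∀ x ∈ cube R, ‖c x‖ ≤ C) :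
    ∃ T : L2 R N →L[ℝ] L2 R N, ∀ u, T u =ᵐ[volume.restrict (cube R)] fun x => B (c x) (u x) := by
  have hm : MemLp c ⊤ (volume.restrict (cube R)) := by
    refine memLp_top_of_bound hc C ?_
    filter_upwards [ae_restrict_mem (measurableSet_cube R)] with x hx using hC x hx
  refine ⟨B.holderL (volume.restrict (cube R)) ⊤ 2 2 (hm.toLp c), fun u => ?_⟩
  have h1 := B.coeFn_holder (r := 2) (hm.toLp c) u
  filter_upwards [h1, hm.coeFn_toLp] with x h2 h3
  rw [ContinuousLinearMap.holderL_apply_apply, h2, h3]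

theorem coeFn_finset_sum {ι : Type*} (s : Finset ι) (u : ι → L2 R N) :
    (∑ i ∈ s, u i : L2 R N) =ᵐ[volume.restrict (cube R)] fun x => ∑ i ∈ s, u i x := by
  classical
  induction s using Finset.induction_on with
  | empty =>
    simp only [Finset.sum_empty]
    exact Lp.coeFn_zero (CN N) 2 (volume.restrict (cube R))
  | insert a s ha ih =>
    rw [Finset.sum_insert ha]
    filter_upwards [Lp.coeFn_add (u a) (∑ i ∈ s, u i), ih] with x h1 h2
    rw [h1, Pi.add_apply, h2, Finset.sum_insert ha]

/-- The square root of the normalized Carleman weight. -/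
noncomputable def sqrtWt (R r lam : ℝ) (x : E3) : ℝ :=
  Real.exp (lam * (x 2 - r) ^ 2 - lam * (R + r) ^ 2)

theorem sqrtWt_sq (R r lam : ℝ) (x : E3) : sqrtWt R r lam x ^ 2
    = Real.exp (-2 * lam * (R + r) ^ 2) * carlemanWeight lam r (x 2) := by
  unfold sqrtWt carlemanWeight
  rw [← Real.exp_nat_mul, ← Real.exp_add]
  congr 1
  push_cast
  ring

theorem continuous_sqrtWt (R r lam : ℝ) : Continuous (sqrtWt R r lam) := by
  have : Continuous fun x : E3 => x 2 := (EuclideanSpace.proj (𝕜 := ℝ) (2 : Fin 3)).continuous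
  unfold sqrtWt
  fun_prop

/-- The normalizing factor exp(-2λ(R + r)²) is the reciprocal of the largest weight on the closed
cube, so multiplication by `sqrtWt` is a contraction of L². -/
theorem sqrtWt_le_one {r lam : ℝ} (hr : R < r) (hlam : 0 < lam) {x : E3} (hx : x ∈ cube R) :
    ‖sqrtWt R r lam x‖ ≤ 1 := by
  have h := abs_lt.1 (hx 2)
  have h2 : (x 2 - r) ^ 2 ≤ (R + r) ^ 2 := by
    rw [show (x 2 - r) ^ 2 = (r - x 2) ^ 2 by ring]
    exact pow_le_pow_left₀ (by linarith) (by linarith) 2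
  rw [sqrtWt, Real.norm_eq_abs, abs_of_pos (Real.exp_pos _), Real.exp_le_one_iff]
  nlinarith

/-- The operator `L`, up to the identification of the quadratic and linear parts. -/
theorem exists_operator {a d k : ℝ} (ha : 0 < a) (hR : 0 < R) (hd : R < d) (N : ℕ) {r lam : ℝ}
    (hr : R < r) (hlam : 0 < lam) :
    ∃ (T : H3 R N →L[ℝ] L2 R N) (Q : H3 R N →L[ℝ] H3 R N →L[ℝ] L2 R N),
      (∀ V, T V =ᵐ[volume.restrict (cube R)] fun x => sqrtWt R r lam x •
        ((∑ i, weakD (MIdx.second i) V x) + ∑ i, linL a d k N i x (weakD (MIdx.first i) V x))) ∧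
      ∀ V W, Q V W =ᵐ[volume.restrict (cube R)] fun x => sqrtWt R r lam x •
        ∑ i, quadB a N (weakD (MIdx.first i) V x) (weakD (MIdx.first i) W x) := by
  obtain ⟨C, -, hC⟩ := exists_bound_linL (k := k) ha hR hd N
  choose Λ hΛ using fun i => exists_mulL (ContinuousLinearMap.id ℝ (CN N →L[ℝ] CN N))
    (aestronglyMeasurable_linL (N := N) (k := k) ha hR hd i) (hC i)
  obtain ⟨m, hm⟩ := exists_mulL (N := N) (ContinuousLinearMap.lsmul ℝ ℝ)
    (continuous_sqrtWt R r lam).aestronglyMeasurable fun x (hx : x ∈ cube R) =>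
      sqrtWt_le_one hr hlam hx
  obtain ⟨K, hK, hb⟩ := exists_bound_weakD hR N
  choose S hS using fun i => exists_toLinf (T := weakDL (R := R) (N := N) (MIdx.first i)) hK
    fun V => (hb V).2 i
  refine ⟨m.comp (∑ i, (weakDL (MIdx.second i) + (Λ i).comp (weakDL (MIdx.first i)))),
    (ContinuousLinearMap.compL ℝ (H3 R N) (L2 R N) (L2 R N) m).comp
    (∑ i, ((quadB a N).holderL (volume.restrict (cube R)) ⊤ 2 2).bilinearComp (S i)
      (weakDL (MIdx.first i))), fun V => ?_, fun V W => ?_⟩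
  · simp only [ContinuousLinearMap.comp_apply, _root_.sum_apply, _root_.add_apply, weakDL_apply]
    have h1 := coeFn_finset_sum Finset.univ
      fun i : Fin 3 => weakD (MIdx.second i) V + Λ i (weakD (MIdx.first i) V)
    filter_upwards [hm (∑ i, (weakD (MIdx.second i) V + Λ i (weakD (MIdx.first i) V))), h1,
      ae_all_iff.2 fun i => hΛ i (weakD (MIdx.first i) V),
      ae_all_iff.2 fun i => Lp.coeFn_add (weakD (MIdx.second i) V) (Λ i (weakD (MIdx.first i) V))]
      with x e1 e2 e3 e4
    rw [e1, e2, ← Finset.sum_add_distrib]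
    simp only [e4, Pi.add_apply, e3]
    rfl
  · simp only [ContinuousLinearMap.comp_apply, ContinuousLinearMap.compL_apply, _root_.sum_apply,
      ContinuousLinearMap.bilinearComp_apply, weakDL_apply,
      ContinuousLinearMap.holderL_apply_apply]
    have h1 := coeFn_finset_sum Finset.univ
      fun i : Fin 3 => (quadB a N).holder 2 (S i V) (weakD (MIdx.first i) W)
    filter_upwards [hm (∑ i, (quadB a N).holder 2 (S i V) (weakD (MIdx.first i) W)), h1,
      ae_all_iff.2 fun i => (quadB a N).coeFn_holder (r := 2) (S i V) (weakD (MIdx.first i) W),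
      ae_all_iff.2 fun i => hS i V] with x e1 e2 e3 e4
    rw [e1, e2]
    simp only [e3, e4]
    rfl

theorem functionalJ_eq {a d k : ℝ} (ha : 0 < a) (hR : 0 < R) (hd : R < d) {r lam γ : ℝ}
    {T : H3 R N →L[ℝ] L2 R N} {Q : H3 R N →L[ℝ] H3 R N →L[ℝ] L2 R N}
    (hT : ∀ V, T V =ᵐ[volume.restrict (cube R)] fun x => sqrtWt R r lam x •
        ((∑ i, weakD (MIdx.second i) V x) + ∑ i, linL a d k N i x (weakD (MIdx.first i) V x)))
    (hQ : ∀ V W, Q V W =ᵐ[volume.restrict (cube R)] fun x => sqrtWt R r lam x •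
        ∑ i, quadB a N (weakD (MIdx.first i) V x) (weakD (MIdx.first i) W x)) (V : H3 R N) :
    functionalJ r a d k lam γ V = ‖T V + Q V V‖ ^ 2 + γ * ‖V‖ ^ 2 := by
  unfold functionalJ
  rw [← integral_norm_sq, ← integral_const_mul]
  congr 1
  refine integral_congr_ae ?_
  filter_upwards [hT V, hQ V V, Lp.coeFn_add (T V) (Q V V), ae_restrict_mem (measurableSet_cube R)]
    with x h1 h2 h3 hx
  have h4 : (T V + Q V V : L2 R N) x = sqrtWt R r lam x • opL a d k V x := by
    rw [h3, Pi.add_apply, h1, h2, opL, termK_eq ha hR hd hx fun i => weakD (MIdx.first i) V x,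
      ← smul_add]
    congr 1
    abel
  rw [h4, norm_smul, mul_pow, Real.norm_eq_abs, sq_abs, sqrtWt_sq]
  ring

/-! ### The derivative and the exact Taylor formula of the functional -/

section polynomial

variable {X Y : Type*} [NormedAddCommGroup X] [InnerProductSpace ℝ X] [NormedAddCommGroup Y]
  [InnerProductSpace ℝ Y] (T : X →L[ℝ] Y) (Q : X →L[ℝ] X →L[ℝ] Y) (γ : ℝ)

theorem hasFDerivAt_quadratic (V : X) :
    HasFDerivAt (fun V => ‖T V + Q V V‖ ^ 2 + γ * ‖V‖ ^ 2)
      (2 • (innerSL ℝ (T V + Q V V)).comp (T + (Q V + Q.flip V)) + γ • (2 • innerSL ℝ V)) V := by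
  have hQ : HasFDerivAt (fun V => Q V V) (Q V + Q.flip V) V := by
    have := Q.isBoundedBilinearMap.hasFDerivAt (V, V)
    have h2 := HasFDerivAt.comp (f := fun V => (V, V)) V this
      ((hasFDerivAt_id V).prodMk (hasFDerivAt_id V))
    refine h2.congr_fderiv ?_
    ext h
    simp
  have h1 := (T.hasFDerivAt (x := V)).add hQ
  have h2 := h1.norm_sq
  have h3 := ((hasFDerivAt_id V).norm_sq).const_mul γ
  refine (h2.add h3).congr_fderiv ?_
  ext h
  simp

/-- Write u for the value at V and m for the increment. The derivative sees only the part m - Q(h,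
h), so subtracting it from 2⟨u, m⟩ + ‖m‖² leaves ‖m‖² + 2⟨u, Q(h, h)⟩. -/
theorem quadratic_diff (V h : X) :
    (‖T (V + h) + Q (V + h) (V + h)‖ ^ 2 + γ * ‖V + h‖ ^ 2) - (‖T V + Q V V‖ ^ 2 + γ * ‖V‖ ^ 2)
      - (2 • (innerSL ℝ (T V + Q V V)).comp (T + (Q V + Q.flip V)) + γ • (2 • innerSL ℝ V)) h
      = ‖T h + (Q V h + Q h V + Q h h)‖ ^ 2 + 2 * inner ℝ (T V + Q V V) (Q h h) + γ * ‖h‖ ^ 2 := by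
  have e1 : T (V + h) + Q (V + h) (V + h)
      = (T V + Q V V) + (T h + (Q V h + Q h V + Q h h)) := by
    simp only [map_add, _root_.add_apply]
    abel
  have e2 : T h + (Q V h + Q h V) = (T h + (Q V h + Q h V + Q h h)) - Q h h := by abel
  rw [e1, norm_add_sq_real, norm_add_sq_real V h]
  simp only [_root_.add_apply, _root_.smul_apply, ContinuousLinearMap.comp_apply,
    innerSL_apply_apply, ContinuousLinearMap.flip_apply, smul_eq_mul, nsmul_eq_mul, e2, inner_sub_right]
  push_cast
  ring

end polynomial

end

section

/-! ### Coercivity -/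

variable {R : ℝ} {N : ℕ}

/-- The weighted square integral of `u`. -/
noncomputable def weightedSq (lam r : ℝ) (u : L2 R N) : ℝ :=
  ∫ x in cube R, carlemanWeight lam r (x 2) * ‖u x‖ ^ 2

theorem one_le_carlemanWeight {lam r z : ℝ} (hlam : 0 < lam) : 1 ≤ carlemanWeight lam r z := by
  rw [carlemanWeight, Real.one_le_exp_iff]
  positivity

theorem carlemanWeight_pos {lam r z : ℝ} : 0 < carlemanWeight lam r z := Real.exp_pos _

theorem weightedSq_nonneg (lam r : ℝ) (u : L2 R N) : 0 ≤ weightedSq lam r u :=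
  integral_nonneg fun x => by
    have := @carlemanWeight_pos lam r (x 2)
    positivity

theorem integrable_box_iff {f : E3 → ℝ} :
    Integrable (fun y : Coord => f (WithLp.toLp 2 y)) (volume.restrict (box R))
      ↔ Integrable f (volume.restrict (cube R)) :=
  (measurePreserving_toLp R).integrable_comp_emb measurableEmbedding_toLp

theorem weightedSq_eq (lam r : ℝ) (u : L2 R N) :
    weightedSq lam r u = ∑ l, ∫ y in box R, wt lam r y * comp (cf l) u y ^ 2 := by
  unfold weightedSq
  rw [← integral_box_eq, ← integral_mul_sum _ (contDiff_wt lam r).continuous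
    fun l => memLp_comp (cf l) u]
  refine integral_congr_ae (ae_of_all _ fun y => ?_)
  simp only [norm_sq_eq_sum_cf]
  rfl

theorem integrable_weightedSq (lam r : ℝ) (u : L2 R N) :
    Integrable (fun x => carlemanWeight lam r (x 2) * ‖u x‖ ^ 2) (volume.restrict (cube R)) := by
  rw [← integrable_box_iff]
  have h := integrable_finsetSum (Finset.univ : Finset (Fin N ⊕ Fin N)) fun l _ =>
    integrable_mul_sq (contDiff_wt lam r).continuous (memLp_comp (cf l) u)
  refine h.congr (ae_of_all _ fun y => ?_)
  simp only [norm_sq_eq_sum_cf, Finset.mul_sum]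
  rfl

theorem norm_sq_le_weightedSq {lam r : ℝ} (hlam : 0 < lam) (u : L2 R N) :
    ‖u‖ ^ 2 ≤ weightedSq lam r u := by
  rw [← integral_norm_sq]
  refine integral_mono (integrable_norm_sq u) (integrable_weightedSq lam r u) fun x => ?_
  exact le_mul_of_one_le_left (sq_nonneg _) (one_le_carlemanWeight hlam)

/-- The Laplacian. -/
noncomputable def lapl (V : H3 R N) : L2 R N := ∑ i, weakD (MIdx.second i) V

theorem lapl_ae (V : H3 R N) :
    lapl V =ᵐ[volume.restrict (cube R)] fun x => ∑ i, weakD (MIdx.second i) V x :=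
  coeFn_finset_sum _ _

theorem weightedSq_lapl (lam r : ℝ) (h : H3 R N) : weightedSq lam r (lapl h)
    = ∑ l, ∫ y in box R, wt lam r y * (∑ i, comp (cf l) (weakD (MIdx.two i i) h) y) ^ 2 := by
  rw [weightedSq_eq]
  refine Finset.sum_congr rfl fun l _ => integral_congr_ae ?_
  filter_upwards [ae_box_iff.2 (lapl_ae h)] with y hy
  simp only [comp, hy, map_sum, MIdx.two_self]

/-! ### The Carleman estimates for vector functions in H³₀ -/

section estimates

variable {r lam : ℝ} {h : H3 R N}

theorem weightedSq_first_le (hh : h ∈ H03 R N) (hR : 0 < R) (hr : R < r) (hlam : 1 ≤ lam)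
    (hlam' : 1 ≤ lam * (r - R) ^ 2) :
    ∑ i, weightedSq lam r (weakD (MIdx.first i) h) ≤ lam⁻¹ * weightedSq lam r (lapl h) := by
  rw [weightedSq_lapl, Finset.mul_sum]
  simp_rw [weightedSq_eq]
  rw [Finset.sum_comm]
  refine Finset.sum_le_sum fun l _ => ?_
  have := (zeroDataH2_comp hR hh (cf l)).first_le hR hr hlam hlam'
  rwa [integral_mul_sum _ (contDiff_wt lam r).continuous fun i => memLp_comp _ _] at this

theorem weightedSq_none_le (hh : h ∈ H03 R N) (hR : 0 < R) (hr : R < r) (hlam : 1 ≤ lam)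
    (hlam' : 1 ≤ lam * (r - R) ^ 2) :
    8 * (r - R) ^ 2 * lam ^ 3 * weightedSq lam r (weakD MIdx.none h)
      ≤ weightedSq lam r (lapl h) := by
  rw [weightedSq_lapl, weightedSq_eq, Finset.mul_sum]
  refine Finset.sum_le_sum fun l _ => ?_
  have h1 := (zeroDataH2_comp hR hh (cf l)).carleman_first hR hr (by linarith) hlam'
  have h2 : 0 ≤ lam * ∫ x in box R, wt lam r x
      * ∑ i, comp (cf l) (weakD (MIdx.first i) h) x ^ 2 :=
    mul_nonneg (by linarith) (integral_nonneg fun x => by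
      have := wt_pos lam r x
      positivity)
  linarith

theorem weightedSq_second_le (hh : h ∈ H03 R N) (hR : 0 < R) (hr : R < r) (hlam : 1 ≤ lam)
    (hlam' : 1 ≤ lam * (r - R) ^ 2) :
    ∑ p : Fin 3 × Fin 3, weightedSq lam r (weakD (MIdx.two p.1 p.2) h)
      ≤ (2 + 32 * (R + r) ^ 2) * lam * weightedSq lam r (lapl h) := by
  rw [weightedSq_lapl, Finset.mul_sum]
  simp_rw [weightedSq_eq]
  rw [Finset.sum_comm]
  refine Finset.sum_le_sum fun l _ => ?_
  have := (zeroDataH2_comp hR hh (cf l)).second_le hR hr hlam hlam'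
  have e := integral_mul_sum (R := R) (Finset.univ ×ˢ Finset.univ)
    (contDiff_wt lam r).continuous
    (g := fun p : Fin 3 × Fin 3 => comp (cf l) (weakD (MIdx.two p.1 p.2) h)) fun p => memLp_comp _ _
  simp only [Finset.sum_product] at e
  rw [e] at this
  rw [Fintype.sum_prod_type]
  exact this

/-- Pairs (i, j) describe all second order multi-indices, the mixed ones twice. Hence only an
inequality holds, which is the direction needed. -/
theorem normSqH2_le_sum (h : H3 R N) : normSqH2 h ≤ ‖weakD MIdx.none h‖ ^ 2
    + ((∑ i, ‖weakD (MIdx.first i) h‖ ^ 2)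
      + ∑ p : Fin 3 × Fin 3, ‖weakD (MIdx.two p.1 p.2) h‖ ^ 2) := by
  let g : Unit ⊕ (Fin 3 ⊕ (Fin 3 × Fin 3)) → MIdx :=
    Sum.elim (fun _ => MIdx.none) (Sum.elim MIdx.first fun p => MIdx.two p.1 p.2)
  have hg : ∑ q, ‖weakD (g q) h‖ ^ 2 = ‖weakD MIdx.none h‖ ^ 2
      + ((∑ i, ‖weakD (MIdx.first i) h‖ ^ 2)
      + ∑ p : Fin 3 × Fin 3, ‖weakD (MIdx.two p.1 p.2) h‖ ^ 2) := by
    simp [g, Fintype.sum_sum_type]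
  rw [← hg]
  have h1 : ∑ q, ‖weakD (g q) h‖ ^ 2
      = ∑ β : MIdx, ∑ q, if β = g q then ‖weakD β h‖ ^ 2 else 0 := by
    rw [Finset.sum_comm]
    simp
  rw [h1]
  refine Finset.sum_le_sum fun β _ => ?_
  have hnn : ∀ q ∈ Finset.univ, 0 ≤ if β = g q then ‖weakD β h‖ ^ 2 else 0 := fun q _ => by
    split_ifs <;> positivity
  split_ifs with hβ
  · obtain ⟨q, hq⟩ : ∃ q, β = g q := by
      rcases MIdx.exists_eq_of_order_le_two β hβ with rfl | ⟨i, rfl⟩ | ⟨i, j, rfl⟩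
      · exact ⟨Sum.inl (), rfl⟩
      · exact ⟨Sum.inr (Sum.inl i), rfl⟩
      · exact ⟨Sum.inr (Sum.inr (i, j)), rfl⟩
    have := Finset.single_le_sum hnn (Finset.mem_univ q)
    rwa [if_pos hq] at this
  · exact Finset.sum_nonneg hnn

/-- The weighted `L²` norm of the Laplacian controls the `H²` norm on `H³₀`. -/
theorem exists_normSqH2_le (hR : 0 < R) (hr : R < r) (hlam : 1 ≤ lam)
    (hlam' : 1 ≤ lam * (r - R) ^ 2) (N : ℕ) : ∃ C, 0 < C ∧ ∀ h ∈ H03 R N,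
      normSqH2 h ≤ C * weightedSq lam r (lapl h) := by
  have h0 : 0 < lam := by linarith
  have hrR : 0 < r - R := by linarith
  refine ⟨(8 * (r - R) ^ 2 * lam ^ 3)⁻¹ + (lam⁻¹ + (2 + 32 * (R + r) ^ 2) * lam), by positivity,
    fun h hh => (normSqH2_le_sum h).trans ?_⟩
  rw [add_mul, add_mul]
  refine add_le_add ?_ (add_le_add ?_ ?_)
  · refine (norm_sq_le_weightedSq (r := r) h0 _).trans ?_
    rw [inv_mul_eq_div, le_div_iff₀' (by positivity)]
    exact weightedSq_none_le hh hR hr hlam hlam'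
  · exact (Finset.sum_le_sum fun i _ => norm_sq_le_weightedSq h0 _).trans
      (weightedSq_first_le hh hR hr hlam hlam')
  · exact (Finset.sum_le_sum fun i _ => norm_sq_le_weightedSq h0 _).trans
      (weightedSq_second_le hh hR hr hlam hlam')

end estimates

theorem sqrt_sqNorm_comp_le (l : Fin N ⊕ Fin N) (V : H3 R N) (β : MIdx) (β' : Fin 3 → MIdx) :
    √(sqNorm R (comp (cf l) (weakD β V)) (fun i => comp (cf l) (weakD (β' i) V))) ≤ 2 * ‖V‖ := by
  rw [Real.sqrt_le_left (by positivity)]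
  exact (sqNorm_comp_le l V β β').trans (le_of_eq (by ring))

/-- The trilinear estimate for elements of `H³`. -/
theorem exists_trilinear_H3 {r : ℝ} (hR : 0 < R) (hr : R < r) (N : ℕ) : ∃ K : ℝ, 0 ≤ K ∧
    ∀ lam, 1 ≤ lam → 1 ≤ lam * (r - R) ^ 2 → ∀ V : H3 R N, ∀ h ∈ H03 R N,
      Integrable (fun x => carlemanWeight lam r (x 2) * ((∑ j, ∑ l, |cf l (weakD (MIdx.second j) V x)|)
        * ∑ i, ‖weakD (MIdx.first i) h x‖ ^ 2)) (volume.restrict (cube R)) ∧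
      ∫ x in cube R, carlemanWeight lam r (x 2) * ((∑ j, ∑ l, |cf l (weakD (MIdx.second j) V x)|)
        * ∑ i, ‖weakD (MIdx.first i) h x‖ ^ 2)
        ≤ K * ‖V‖ * (√lam)⁻¹ * weightedSq lam r (lapl h) := by
  obtain ⟨K, hK, hb⟩ := exists_trilinear hR hr
  refine ⟨∑ _j : Fin 3, ∑ _l : Fin N ⊕ Fin N, ∑ _i : Fin 3, K * 2, by positivity, ?_⟩
  intro lam hlam hlam' V h hh
  -- The trilinear estimate is applied with g a component of ∂ⱼ²V, whose first derivatives are third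
  -- derivatives of V. This is where three derivatives of V are consumed.
  have key := fun (j : Fin 3) (l : Fin N ⊕ Fin N) (i : Fin 3) (l' : Fin N ⊕ Fin N) =>
    hb lam hlam hlam' (comp (cf l) (weakD (MIdx.two j j) V))
      (fun k => comp (cf l) (weakD (MIdx.three j j k) V)) (memLp_comp _ _) (fun k => memLp_comp _ _)
      (fun k => weakPartial_comp _ V (MIdx.isSucc_two j j k)) _ _ _
      (zeroDataH2_comp hR hh (cf l')) i
  have hpt : ∀ y : Coord, carlemanWeight lam r (WithLp.toLp 2 y 2)
      * ((∑ j, ∑ l, |cf l (weakD (MIdx.second j) V (WithLp.toLp 2 y))|)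
        * ∑ i, ‖weakD (MIdx.first i) h (WithLp.toLp 2 y)‖ ^ 2)
      = ∑ j, ∑ l, ∑ i, ∑ l', |comp (cf l) (weakD (MIdx.two j j) V) y|
        * (wt lam r y * comp (cf l') (weakD (MIdx.first i) h) y ^ 2) := by
    intro y
    simp only [norm_sq_eq_sum_cf, comp, MIdx.two_self, ← Finset.mul_sum, ← Finset.sum_mul]
    rw [show carlemanWeight lam r (WithLp.toLp 2 y 2) = wt lam r y from rfl]
    ring
  have hint : ∀ j l i, Integrable (fun y => ∑ l', |comp (cf l) (weakD (MIdx.two j j) V) y|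
        * (wt lam r y * comp (cf l') (weakD (MIdx.first i) h) y ^ 2)) (volume.restrict (box R)) :=
    fun j l i => integrable_finsetSum _ fun l' _ => (key j l i l').1
  rw [← integrable_box_iff, ← integral_box_eq]
  simp only [hpt]
  refine ⟨integrable_finsetSum _ fun j _ => integrable_finsetSum _ fun l _ =>
    integrable_finsetSum _ fun i _ => hint j l i, ?_⟩
  rw [integral_finsetSum _ fun j _ => integrable_finsetSum _ fun l _ =>
    integrable_finsetSum _ fun i _ => hint j l i]
  simp only [Finset.sum_mul]
  refine Finset.sum_le_sum fun j _ => ?_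
  rw [integral_finsetSum _ fun l _ => integrable_finsetSum _ fun i _ => hint j l i]
  refine Finset.sum_le_sum fun l _ => ?_
  rw [integral_finsetSum _ fun i _ => hint j l i]
  refine Finset.sum_le_sum fun i _ => ?_
  rw [integral_finsetSum _ fun l' _ => (key j l i l').1, weightedSq_lapl, Finset.mul_sum]
  refine Finset.sum_le_sum fun l' _ => (key j l i l').2.trans ?_
  have hA : 0 ≤ ∫ y in box R, wt lam r y
      * (∑ i, comp (cf l') (weakD (MIdx.two i i) h) y) ^ 2 :=
    integral_nonneg fun y => by have := wt_pos lam r y; positivity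
  have := sqrt_sqNorm_comp_le l V (MIdx.two j j) (MIdx.three j j)
  calc _ ≤ K * (2 * ‖V‖) * (√lam)⁻¹ * ∫ y in box R, wt lam r y
      * (∑ i, comp (cf l') (weakD (MIdx.two i i) h) y) ^ 2 := by gcongr
    _ = _ := by ring

theorem half_sq_sub_le {E : Type*} [NormedAddCommGroup E] (u v : E) :
    ‖u‖ ^ 2 / 2 - ‖v‖ ^ 2 ≤ ‖u + v‖ ^ 2 := by
  have h1 : ‖u‖ ≤ ‖u + v‖ + ‖v‖ := by
    have := norm_sub_le (u + v) v
    rwa [add_sub_cancel_right] at this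
  nlinarith [norm_nonneg u, norm_nonneg v, norm_nonneg (u + v), sq_nonneg (‖u + v‖ - ‖v‖)]

theorem sq_sum_three_le (t : Fin 3 → ℝ) : (∑ i, t i) ^ 2 ≤ 3 * ∑ i, t i ^ 2 := by
  simp only [Fin.sum_univ_three]
  nlinarith [sq_nonneg (t 0 - t 1), sq_nonneg (t 0 - t 2), sq_nonneg (t 1 - t 2)]

section pointwise

variable {E : Type*} [NormedAddCommGroup E] [NormedSpace ℝ E] {B : E →L[ℝ] E →L[ℝ] E}
  {Λ : Fin 3 → E →L[ℝ] E} {CL K : ℝ} {p v : Fin 3 → E}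

/-- The term B(p, p) is treated as linear in p with one factor bounded by 2K, so the total
coefficient is K + K + 2K = 4K. The factor 3 comes from Cauchy–Schwarz over the three directions. -/
theorem norm_sq_perturbation_le (hΛ : ∀ i, ‖Λ i‖ ≤ CL) (hv : ∀ i, ‖v i‖ ≤ K)
    (hp : ∀ i, ‖p i‖ ≤ 2 * K) :
    ‖∑ i, (Λ i (p i) + (B (v i) (p i) + B (p i) (v i) + B (p i) (p i)))‖ ^ 2
      ≤ 3 * (CL + ‖B‖ * (4 * K)) ^ 2 * ∑ i, ‖p i‖ ^ 2 := by
  have hb0 : 0 ≤ ‖B‖ := norm_nonneg B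
  have h1 : ‖∑ i, (Λ i (p i) + (B (v i) (p i) + B (p i) (v i) + B (p i) (p i)))‖
      ≤ (CL + ‖B‖ * (4 * K)) * ∑ i, ‖p i‖ := by
    rw [Finset.mul_sum]
    refine (norm_sum_le _ _).trans (Finset.sum_le_sum fun i _ => ?_)
    have n1 : ‖Λ i (p i)‖ ≤ CL * ‖p i‖ := (Λ i).le_of_opNorm_le (hΛ i) _
    have n2 : ‖B (v i) (p i)‖ ≤ ‖B‖ * K * ‖p i‖ := (B.le_opNorm₂ _ _).trans (by
      gcongr; exact hv i)
    have n3 : ‖B (p i) (v i)‖ ≤ ‖B‖ * ‖p i‖ * K := (B.le_opNorm₂ _ _).trans (by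
      gcongr; exact hv i)
    have n4 : ‖B (p i) (p i)‖ ≤ ‖B‖ * (2 * K) * ‖p i‖ := (B.le_opNorm₂ _ _).trans (by
      gcongr; exact hp i)
    calc _ ≤ ‖Λ i (p i)‖ + (‖B (v i) (p i)‖ + ‖B (p i) (v i)‖ + ‖B (p i) (p i)‖) :=
          (norm_add_le _ _).trans (by gcongr; exact norm_add₃_le)
      _ ≤ CL * ‖p i‖ + (‖B‖ * K * ‖p i‖ + ‖B‖ * ‖p i‖ * K + ‖B‖ * (2 * K) * ‖p i‖) := by gcongr
      _ = _ := by ring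
  calc _ ≤ ((CL + ‖B‖ * (4 * K)) * ∑ i, ‖p i‖) ^ 2 := pow_le_pow_left₀ (norm_nonneg _) h1 2
    _ = (CL + ‖B‖ * (4 * K)) ^ 2 * (∑ i, ‖p i‖) ^ 2 := by ring
    _ ≤ (CL + ‖B‖ * (4 * K)) ^ 2 * (3 * ∑ i, ‖p i‖ ^ 2) := by gcongr; exact sq_sum_three_le _
    _ = _ := by ring

theorem norm_lower_order_le (hCL : 0 ≤ CL) (hK : 0 ≤ K) (hΛ : ∀ i, ‖Λ i‖ ≤ CL)
    (hv : ∀ i, ‖v i‖ ≤ K) :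
    ‖∑ i, (Λ i (v i) + B (v i) (v i))‖ ≤ 3 * (CL * K + ‖B‖ * K * K) := by
  have hb0 : 0 ≤ ‖B‖ := norm_nonneg B
  have h1 : ∀ i, ‖Λ i (v i) + B (v i) (v i)‖ ≤ CL * K + ‖B‖ * K * K := by
    intro i
    refine (norm_add_le _ _).trans (add_le_add ?_ ?_)
    · exact ((Λ i).le_opNorm _).trans (mul_le_mul (hΛ i) (hv i) (norm_nonneg _) hCL)
    · refine (B.le_opNorm₂ _ _).trans ?_
      have := hv i
      gcongr
  refine (norm_sum_le _ _).trans ((Finset.sum_le_sum fun i _ => h1 i).trans (le_of_eq ?_))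
  simp
  ring

theorem norm_sum_quadratic_le : ‖∑ i, B (p i) (p i)‖ ≤ ‖B‖ * ∑ i, ‖p i‖ ^ 2 := by
  rw [Finset.mul_sum]
  refine (norm_sum_le _ _).trans (Finset.sum_le_sum fun i _ => ?_)
  refine (B.le_opNorm₂ _ _).trans (le_of_eq ?_)
  ring

end pointwise

/-! ### Lower bounds for the two terms of the Taylor formula -/

theorem integrable_weighted_first (lam r : ℝ) (h : H3 R N) :
    Integrable (fun x => carlemanWeight lam r (x 2) * ∑ i, ‖weakD (MIdx.first i) h x‖ ^ 2)
      (volume.restrict (cube R)) := by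
  simp_rw [Finset.mul_sum]
  exact integrable_finsetSum _ fun i _ => integrable_weightedSq lam r _

theorem integral_weighted_first (lam r : ℝ) (h : H3 R N) :
    ∫ x in cube R, carlemanWeight lam r (x 2) * ∑ i, ‖weakD (MIdx.first i) h x‖ ^ 2
      = ∑ i, weightedSq lam r (weakD (MIdx.first i) h) := by
  simp_rw [Finset.mul_sum]
  rw [integral_finsetSum _ fun i _ => integrable_weightedSq lam r _]
  rfl

section lower

variable {a d k r lam CL K : ℝ}
  {T : H3 R N →L[ℝ] L2 R N} {Q : H3 R N →L[ℝ] H3 R N →L[ℝ] L2 R N} {V h : H3 R N}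

/-- Pointwise the integrand is the weight times |Δh + w|², where w is bounded by a multiple of the
gradient of h because all the gradients involved are bounded. The square is then split by
`half_sq_sub_le`. -/
theorem le_norm_sq_linearization
    (hT : ∀ V, T V =ᵐ[volume.restrict (cube R)] fun x => sqrtWt R r lam x •
        ((∑ i, weakD (MIdx.second i) V x) + ∑ i, linL a d k N i x (weakD (MIdx.first i) V x)))
    (hQ : ∀ V W, Q V W =ᵐ[volume.restrict (cube R)] fun x => sqrtWt R r lam x •
        ∑ i, quadB a N (weakD (MIdx.first i) V x) (weakD (MIdx.first i) W x))
    (hCL : ∀ i, ∀ x ∈ cube R, ‖linL a d k N i x‖ ≤ CL)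
    (hkV : ∀ᵐ x ∂(volume.restrict (cube R)), ∀ i, ‖weakD (MIdx.first i) V x‖ ≤ K)
    (hkh : ∀ᵐ x ∂(volume.restrict (cube R)), ∀ i, ‖weakD (MIdx.first i) h x‖ ≤ 2 * K) :
    Real.exp (-2 * lam * (R + r) ^ 2) * (weightedSq lam r (lapl h) / 2
        - 3 * (CL + ‖quadB a N‖ * (4 * K)) ^ 2 * ∑ i, weightedSq lam r (weakD (MIdx.first i) h))
      ≤ ‖T h + (Q V h + Q h V + Q h h)‖ ^ 2 := by
  set c0 := Real.exp (-2 * lam * (R + r) ^ 2) with hc0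
  have hc0p : 0 < c0 := Real.exp_pos _
  set C1 := 3 * (CL + ‖quadB a N‖ * (4 * K)) ^ 2 with hC1
  have i1 := (integrable_weightedSq lam r (lapl h)).div_const 2
  have i2 := (integrable_weighted_first lam r h).const_mul C1
  have e : c0 * (weightedSq lam r (lapl h) / 2
        - C1 * ∑ i, weightedSq lam r (weakD (MIdx.first i) h)) = ∫ x in cube R, c0 *
        (carlemanWeight lam r (x 2) * ‖lapl h x‖ ^ 2 / 2
          - C1 * (carlemanWeight lam r (x 2) * ∑ i, ‖weakD (MIdx.first i) h x‖ ^ 2)) := by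
    rw [integral_const_mul, integral_sub i1 i2, integral_div, integral_const_mul,
      integral_weighted_first]
    rfl
  rw [e, ← integral_norm_sq]
  refine integral_mono_ae ((i1.sub i2).const_mul c0) (integrable_norm_sq _) ?_
  filter_upwards [hT h, hQ V h, hQ h V, hQ h h, lapl_ae h, hkV, hkh,
    Lp.coeFn_add (T h) (Q V h + Q h V + Q h h), Lp.coeFn_add (Q V h + Q h V) (Q h h),
    Lp.coeFn_add (Q V h) (Q h V), ae_restrict_mem (measurableSet_cube R)]
    with x e1 e2 e3 e4 e5 e6 e7 e8 e9 e10 hx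
  have hw := norm_sq_perturbation_le (B := quadB a N) (fun i => hCL i x hx) e6 e7
  generalize hwd : (∑ i, (linL a d k N i x (weakD (MIdx.first i) h x)
    + (quadB a N (weakD (MIdx.first i) V x) (weakD (MIdx.first i) h x)
      + quadB a N (weakD (MIdx.first i) h x) (weakD (MIdx.first i) V x)
      + quadB a N (weakD (MIdx.first i) h x) (weakD (MIdx.first i) h x)))) = w at hw
  have hsum : (T h + (Q V h + Q h V + Q h h) : L2 R N) x = sqrtWt R r lam x • (lapl h x + w) := by
    rw [e8, Pi.add_apply, e9, Pi.add_apply, e10, Pi.add_apply, e1, e2, e3, e4, e5, ← hwd]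
    simp only [Finset.sum_add_distrib, ← smul_add]
    congr 1
    abel
  rw [hsum, norm_smul, mul_pow, Real.norm_eq_abs, sq_abs, sqrtWt_sq]
  have hcw := @carlemanWeight_pos lam r (x 2)
  have h5 := half_sq_sub_le (lapl h x) w
  calc _ = c0 * carlemanWeight lam r (x 2) * (‖lapl h x‖ ^ 2 / 2
        - C1 * ∑ i, ‖weakD (MIdx.first i) h x‖ ^ 2) := by ring
    _ ≤ c0 * carlemanWeight lam r (x 2) * ‖lapl h x + w‖ ^ 2 := by
        refine mul_le_mul_of_nonneg_left ?_ (by positivity)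
        linarith

/-- The lower order part of L(V) is bounded and costs a multiple of the weighted gradient. The
Laplacian of V is not bounded, so its product with |∇h|² is kept as an integral for the trilinear
estimate. -/
theorem neg_le_inner_quadratic
    (hT : ∀ V, T V =ᵐ[volume.restrict (cube R)] fun x => sqrtWt R r lam x •
        ((∑ i, weakD (MIdx.second i) V x) + ∑ i, linL a d k N i x (weakD (MIdx.first i) V x)))
    (hQ : ∀ V W, Q V W =ᵐ[volume.restrict (cube R)] fun x => sqrtWt R r lam x •
        ∑ i, quadB a N (weakD (MIdx.first i) V x) (weakD (MIdx.first i) W x))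
    (hCL0 : 0 ≤ CL) (hK : 0 ≤ K) (hCL : ∀ i, ∀ x ∈ cube R, ‖linL a d k N i x‖ ≤ CL)
    (hkV : ∀ᵐ x ∂(volume.restrict (cube R)), ∀ i, ‖weakD (MIdx.first i) V x‖ ≤ K)
    (hint : Integrable (fun x => carlemanWeight lam r (x 2)
      * ((∑ j, ∑ l, |cf l (weakD (MIdx.second j) V x)|)
        * ∑ i, ‖weakD (MIdx.first i) h x‖ ^ 2)) (volume.restrict (cube R))) :
    -(Real.exp (-2 * lam * (R + r) ^ 2) * (‖quadB a N‖ * (∫ x in cube R, carlemanWeight lam r (x 2)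
        * ((∑ j, ∑ l, |cf l (weakD (MIdx.second j) V x)|)
          * ∑ i, ‖weakD (MIdx.first i) h x‖ ^ 2))
      + ‖quadB a N‖ * (3 * (CL * K + ‖quadB a N‖ * K * K))
        * ∑ i, weightedSq lam r (weakD (MIdx.first i) h)))
      ≤ inner ℝ (T V + Q V V) (Q h h) := by
  set c0 := Real.exp (-2 * lam * (R + r) ^ 2) with hc0
  set b := ‖quadB a N‖ with hb
  set C2 := 3 * (CL * K + b * K * K) with hC2
  have i1 := hint.const_mul b
  have i2 := (integrable_weighted_first lam r h).const_mul (b * C2)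
  rw [neg_le, ← inner_neg_left, L2.inner_def, ← integral_weighted_first, ← integral_const_mul,
    ← integral_const_mul, ← integral_add i1 i2, ← integral_const_mul]
  refine integral_mono_ae (L2.integrable_inner _ _) ((i1.add i2).const_mul c0) ?_
  filter_upwards [hT V, hQ V V, hQ h h, hkV, Lp.coeFn_add (T V) (Q V V),
    Lp.coeFn_neg (T V + Q V V), ae_restrict_mem (measurableSet_cube R)]
    with x e1 e2 e3 e4 e5 e6 hx
  have hlow := norm_lower_order_le (B := quadB a N) hCL0 hK (fun i => hCL i x hx) e4
  have hq := norm_sum_quadratic_le (B := quadB a N) (p := fun i => weakD (MIdx.first i) h x)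
  have hG : ‖∑ i, weakD (MIdx.second i) V x‖ ≤ ∑ j, ∑ l, |cf l (weakD (MIdx.second j) V x)| :=
    (norm_sum_le _ _).trans (Finset.sum_le_sum fun j _ => norm_le_sum_cf _)
  generalize (∑ j, ∑ l, |cf l (weakD (MIdx.second j) V x)|) = G at hG ⊢
  generalize hwd : (∑ i, (linL a d k N i x (weakD (MIdx.first i) V x)
    + quadB a N (weakD (MIdx.first i) V x) (weakD (MIdx.first i) V x))) = w at hlow
  have hue : (-(T V + Q V V) : L2 R N) x
      = -(sqrtWt R r lam x • ((∑ i, weakD (MIdx.second i) V x) + w)) := by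
    rw [e6, Pi.neg_apply, e5, Pi.add_apply, e1, e2, ← hwd]
    simp only [Finset.sum_add_distrib, ← smul_add]
    congr 2
    abel
  have hule : ‖(∑ i, weakD (MIdx.second i) V x) + w‖ ≤ G + C2 :=
    (norm_add_le _ _).trans (add_le_add hG hlow)
  have hGC : 0 ≤ G + C2 := (norm_nonneg _).trans hule
  calc inner ℝ ((-(T V + Q V V) : L2 R N) x) (Q h h x)
      ≤ ‖(-(T V + Q V V) : L2 R N) x‖ * ‖Q h h x‖ := real_inner_le_norm _ _
    _ = sqrtWt R r lam x ^ 2 * (‖(∑ i, weakD (MIdx.second i) V x) + w‖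
        * ‖∑ i, quadB a N (weakD (MIdx.first i) h x) (weakD (MIdx.first i) h x)‖) := by
        rw [hue, e3, norm_neg, norm_smul, norm_smul, Real.norm_eq_abs,
          ← sq_abs (sqrtWt R r lam x)]
        ring
    _ ≤ sqrtWt R r lam x ^ 2 * ((G + C2) * (b * ∑ i, ‖weakD (MIdx.first i) h x‖ ^ 2)) :=
        mul_le_mul_of_nonneg_left (mul_le_mul hule hq (norm_nonneg _) hGC) (sq_nonneg _)
    _ = _ := by
        rw [sqrtWt_sq]
        ring

end lower

/-- Since λ⁻¹ ≤ λ^(-1/2), all losses are at most D λ^(-1/2) A, which is at most A/4 by the choice of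
λ. A quarter of A remains from the initial half. -/
theorem coercive_arith {lam A D1 I c0 C b c1 c2 c3 S P D : ℝ} (hA : 0 ≤ A) (hc0 : 0 < c0)
    (hlam : 1 ≤ lam) (hb : 0 ≤ b) (hc1 : 0 ≤ c1) (hc2 : 0 ≤ c2)
    (hD1 : D1 ≤ lam⁻¹ * A) (hI : I ≤ c3 * (√lam)⁻¹ * A) (hD : D = c1 + 2 * (b * c2) + 2 * (b * c3))
    (hlamD : 4 * D ≤ √lam) (hC : 0 < C) (hS : c0 * (A / 2 - c1 * D1) ≤ S)
    (hP : -(c0 * (b * I + b * c2 * D1)) ≤ P) : c0 / (4 * C) * (C * A) ≤ S + 2 * P := by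
  have h0 : 0 < lam := by linarith
  have hs : 0 < √lam := Real.sqrt_pos.2 h0
  have hinv : lam⁻¹ ≤ (√lam)⁻¹ := by
    refine inv_anti₀ hs ?_
    rw [Real.sqrt_le_left h0.le]
    nlinarith
  have hD1' : D1 ≤ (√lam)⁻¹ * A := hD1.trans (by gcongr)
  have hDs : D * ((√lam)⁻¹ * A) ≤ A / 4 := by
    rw [← mul_assoc, ← div_eq_mul_inv]
    have : D / √lam ≤ 1 / 4 := by
      rw [div_le_iff₀ hs]
      linarith
    nlinarith
  calc c0 / (4 * C) * (C * A) = c0 * (A / 4) := by field_simp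
    _ ≤ c0 * (A / 2 - D * ((√lam)⁻¹ * A)) := by
        gcongr
        linarith
    _ = c0 * (A / 2 - (c1 + 2 * (b * c2)) * ((√lam)⁻¹ * A)
        - 2 * (b * (c3 * (√lam)⁻¹ * A))) := by rw [hD]; ring
    _ ≤ c0 * (A / 2 - (c1 + 2 * (b * c2)) * D1 - 2 * (b * I)) := by gcongr
    _ = c0 * (A / 2 - c1 * D1) + 2 * -(c0 * (b * I + b * c2 * D1)) := by ring
    _ ≤ _ := by gcongr

/-- The quadratic terms in the Taylor formula of the functional are coercive. -/
theorem exists_coercive {a d k r M : ℝ} (ha : 0 < a) (hR : 0 < R) (hd : R < d) (hr : R < r)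
    (hM : 0 < M) (N : ℕ) : ∃ lam₂ : ℝ, 1 < lam₂ ∧ ∀ lam, lam₂ ≤ lam → ∃ C, 0 < C ∧
    ∀ (T : H3 R N →L[ℝ] L2 R N) (Q : H3 R N →L[ℝ] H3 R N →L[ℝ] L2 R N),
      (∀ V, T V =ᵐ[volume.restrict (cube R)] fun x => sqrtWt R r lam x •
        ((∑ i, weakD (MIdx.second i) V x) + ∑ i, linL a d k N i x (weakD (MIdx.first i) V x))) →
      (∀ V W, Q V W =ᵐ[volume.restrict (cube R)] fun x => sqrtWt R r lam x •
        ∑ i, quadB a N (weakD (MIdx.first i) V x) (weakD (MIdx.first i) W x)) →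
      ∀ V h : H3 R N, ‖V‖ ≤ M → ‖h‖ ≤ 2 * M → h ∈ H03 R N →
        C * normSqH2 h ≤ ‖T h + (Q V h + Q h V + Q h h)‖ ^ 2
          + 2 * inner ℝ (T V + Q V V) (Q h h) := by
  obtain ⟨CL, hCL0, hCL⟩ := exists_bound_linL (k := k) ha hR hd N
  obtain ⟨K, hK0, hK⟩ := exists_bound_weakD hR N
  obtain ⟨K3, hK30, hK3⟩ := exists_trilinear_H3 hR hr N
  obtain ⟨b, hb⟩ : ∃ b, b = ‖quadB a N‖ := ⟨_, rfl⟩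
  have hb0 : 0 ≤ b := by
    rw [hb]
    exact (quadB a N).opNorm_nonneg
  obtain ⟨D, hD⟩ : ∃ D, D = 3 * (CL + b * (4 * (K * M))) ^ 2
    + 2 * (b * (3 * (CL * (K * M) + b * (K * M) * (K * M)))) + 2 * (b * (K3 * M)) := ⟨_, rfl⟩
  have hrR : 0 < r - R := by linarith
  -- Three requirements on λ: it exceeds 1, it satisfies λ(r - R)² ≥ 1 as the Carleman estimate
  -- demands, and √λ ≥ 4D, so that a quarter of A absorbs all losses.
  refine ⟨max 2 (max ((r - R) ^ 2)⁻¹ ((4 * D) ^ 2)), lt_of_lt_of_le (by norm_num) (le_max_left _ _),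
    fun lam hl => ?_⟩
  have hl2 : 2 ≤ lam := (le_max_left _ _).trans hl
  have hl' := (le_max_right _ _).trans hl
  have hlam : 1 ≤ lam := by linarith
  have hlam' : 1 ≤ lam * (r - R) ^ 2 := by
    have := (le_max_left _ _).trans hl'
    rwa [inv_le_iff_one_le_mul₀ (by positivity)] at this
  have hlamD : 4 * D ≤ √lam := Real.le_sqrt_of_sq_le ((le_max_right _ _).trans hl')
  obtain ⟨C, hC0, hC⟩ := exists_normSqH2_le hR hr hlam hlam' N
  have hc0p := Real.exp_pos (-2 * lam * (R + r) ^ 2)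
  refine ⟨Real.exp (-2 * lam * (R + r) ^ 2) / (4 * C), by positivity,
    fun T Q hT hQ V h hV hh hhz => ?_⟩
  have hkV : ∀ᵐ x ∂(volume.restrict (cube R)), ∀ i, ‖weakD (MIdx.first i) V x‖ ≤ K * M := by
    filter_upwards [ae_all_iff.2 (hK V).2] with x hx i
    exact (hx i).trans (by gcongr)
  have hkh : ∀ᵐ x ∂(volume.restrict (cube R)), ∀ i, ‖weakD (MIdx.first i) h x‖ ≤ 2 * (K * M) := by
    filter_upwards [ae_all_iff.2 (hK h).2] with x hx i
    exact (hx i).trans (by nlinarith)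
  obtain ⟨hint, hle⟩ := hK3 lam hlam hlam' V h hhz
  have hS := le_norm_sq_linearization hT hQ hCL hkV hkh
  have hP := neg_le_inner_quadratic hT hQ hCL0 (by positivity) hCL hkV hint
  have hA0 := weightedSq_nonneg lam r (lapl h)
  rw [← hb] at hS hP
  refine le_trans (mul_le_mul_of_nonneg_left (hC h hhz) (by positivity)) ?_
  refine coercive_arith hA0 hc0p hlam hb0 (by positivity) (by positivity)
    (weightedSq_first_le hhz hR hr hlam hlam') (hle.trans ?_) hD hlamD hC0 hS hP
  gcongr

end

section

/-! ### The spaces `H³` and `H³₀` are complete -/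

variable {R : ℝ} {N : ℕ}

theorem continuous_integral_test_smul {φ : E3 → ℝ} (h : ContDiff ℝ ∞ φ ∧ HasCompactSupport φ) :
    Continuous fun u : L2 R N => ∫ x in cube R, φ x • u x := by
  have hm : MemLp φ 2 (volume.restrict (cube R)) := h.1.continuous.memLp_of_hasCompactSupport h.2
  have e : (fun u : L2 R N => ∫ x in cube R, φ x • u x)
      = fun u => (ContinuousLinearMap.lsmul ℝ ℝ).lpPairing (volume.restrict (cube R)) 2 2
        (hm.toLp φ) u := by
    funext u
    rw [ContinuousLinearMap.lpPairing_eq_integral]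
    refine integral_congr_ae ?_
    filter_upwards [hm.coeFn_toLp] with x hx
    rw [hx]
    rfl
  rw [e]
  exact ContinuousLinearMap.continuous _

/-- Each weak derivative identity compares two continuous functions on the ambient product of L²
spaces, so H³ is an intersection of closed sets. -/
theorem isClosed_sobolevH3 (R : ℝ) (N : ℕ) :
    IsClosed (sobolevH3 R N : Set (PiLp 2 fun _ : MIdx => L2 R N)) := by
  have : (sobolevH3 R N : Set (PiLp 2 fun _ : MIdx => L2 R N))
      = ⋂ (β : MIdx) (φ : E3 → ℝ) (_ : IsTestFunction (cube R) φ),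
        {V | ∫ x in cube R, multiDeriv β φ x • V MIdx.none x
          = (-1 : ℝ) ^ β.order • ∫ x in cube R, φ x • V β x} := by
    ext V
    simp only [mem_iInter]
    rfl
  rw [this]
  refine isClosed_iInter fun β => isClosed_iInter fun φ => isClosed_iInter fun hφ => ?_
  have hφ' : ContDiff ℝ ∞ φ ∧ HasCompactSupport φ := ⟨hφ.1, hφ.2.1⟩
  exact isClosed_eq
    ((continuous_integral_test_smul (multiDeriv_smooth β hφ')).comp (PiLp.continuous_apply 2 _ _))
    (((continuous_integral_test_smul (R := R) (N := N) hφ').comp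
      (PiLp.continuous_apply 2 (fun _ : MIdx => L2 R N) β)).const_smul ((-1 : ℝ) ^ β.order))

instance completeSpace_H3 (R : ℝ) (N : ℕ) : CompleteSpace (H3 R N) :=
  (isClosed_sobolevH3 R N).completeSpace_coe

/-- A set of full measure is dense in the open cube, so continuity promotes an almost everywhere
bound to every point of the closure. This gives sup norm control of continuous representatives. -/
theorem norm_le_of_ae_norm_le {F : Type*} [NormedAddCommGroup F] {g : E3 → F}
    (hg : ContinuousOn g (closure (cube R))) {c : ℝ}
    (h : ∀ᵐ x ∂(volume.restrict (cube R)), ‖g x‖ ≤ c) : ∀ x ∈ closure (cube R), ‖g x‖ ≤ c := by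
  rw [ae_restrict_iff' (measurableSet_cube R)] at h
  have hd := Measure.dense_of_ae h
  have hsub : closure (cube R) ⊆ closure (cube R ∩ {x | x ∈ cube R → ‖g x‖ ≤ c}) :=
    closure_minimal (hd.open_subset_closure_inter (isOpen_cube R)) isClosed_closure
  intro x hx
  refine ContinuousWithinAt.closure_le (hsub hx) (f := fun x => ‖g x‖) (g := fun _ => c)
    ((hg x hx).norm.mono (inter_subset_left.trans subset_closure)) continuousWithinAt_const
    fun y hy => hy.2 hy.1

namespace HasBoundaryValues

variable {u v : L2 R N} {S : Set E3} {ψ φ : E3 → CN N}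

theorem add (hu : HasBoundaryValues u S ψ) (hv : HasBoundaryValues v S φ) :
    HasBoundaryValues (u + v) S (ψ + φ) := by
  obtain ⟨g, hg, hug, hgS⟩ := hu
  obtain ⟨g', hg', hvg, hgS'⟩ := hv
  refine ⟨g + g', hg.add hg', ?_, fun x hx => ?_⟩
  · filter_upwards [Lp.coeFn_add u v, hug, hvg] with x h1 h2 h3
    rw [h1, Pi.add_apply, h2, h3, Pi.add_apply]
  · rw [Pi.add_apply, Pi.add_apply, hgS x hx, hgS' x hx]

theorem smul (c : ℝ) (hu : HasBoundaryValues u S ψ) : HasBoundaryValues (c • u) S (c • ψ) := by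
  obtain ⟨g, hg, hug, hgS⟩ := hu
  refine ⟨c • g, hg.const_smul c, ?_, fun x hx => ?_⟩
  · filter_upwards [Lp.coeFn_smul c u, hug] with x h1 h2
    rw [h1, Pi.smul_apply, h2, Pi.smul_apply]
  · rw [Pi.smul_apply, Pi.smul_apply, hgS x hx]

end HasBoundaryValues

theorem hasBoundaryValues_zero (S : Set E3) : HasBoundaryValues (0 : L2 R N) S 0 :=
  ⟨0, continuousOn_const, Lp.coeFn_zero (CN N) 2 (volume.restrict (cube R)), fun _ _ => rfl⟩

/-- The sup norm bound makes the continuous representatives of a convergent sequence uniformly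
Cauchy on the closed cube. Their limit is continuous, represents the limit function, and still
vanishes on S. -/
theorem isClosed_hasBoundaryValues {T : H3 R N →L[ℝ] L2 R N} {K : ℝ}
    (h : ∀ V, ∀ᵐ x ∂(volume.restrict (cube R)), ‖T V x‖ ≤ K * ‖V‖) (S : Set E3)
    (hS : S ⊆ closure (cube R)) : IsClosed {V | HasBoundaryValues (T V) S 0} := by
  refine isClosed_of_closure_subset fun V hV => ?_
  obtain ⟨W, hW, hlim⟩ := mem_closure_iff_seq_limit.1 hV
  choose g hg hWg hg0 using hW
  have hdiff : ∀ n m, ∀ x ∈ closure (cube R), ‖g n x - g m x‖ ≤ K * ‖W n - W m‖ := by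
    intro n m
    refine norm_le_of_ae_norm_le ((hg n).sub (hg m)) ?_
    have h1 := h (W n - W m)
    rw [map_sub] at h1
    filter_upwards [h1, hWg n, hWg m, Lp.coeFn_sub (T (W n)) (T (W m))] with x h2 h3 h4 h5
    rw [h5, Pi.sub_apply, h3, h4] at h2
    exact h2
  have hcauchy : UniformCauchySeqOn g atTop (closure (cube R)) := by
    rw [Metric.uniformCauchySeqOn_iff]
    intro ε hε
    obtain ⟨n0, hn0⟩ := (Metric.cauchySeq_iff.1 hlim.cauchySeq) (ε / (|K| + 1)) (by positivity)
    refine ⟨n0, fun m hm n hn x hx => ?_⟩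
    have h1 := hn0 m hm n hn
    rw [dist_eq_norm, lt_div_iff₀ (by positivity)] at h1
    rw [dist_eq_norm]
    refine (hdiff m n x hx).trans_lt (lt_of_le_of_lt ?_ h1)
    nlinarith [le_abs_self K, norm_nonneg (W m - W n)]
  have hpt : ∀ x ∈ closure (cube R), ∃ y, Tendsto (fun n => g n x) atTop (𝓝 y) := fun x hx =>
    cauchySeq_tendsto_of_complete (hcauchy.cauchySeq hx)
  classical
  choose! G hG using hpt
  have hunif := hcauchy.tendstoUniformlyOn_of_tendsto hG
  refine ⟨G, hunif.continuousOn (Frequently.of_forall hg), ?_, fun x hx => ?_⟩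
  · have hae : ∀ᵐ x ∂(volume.restrict (cube R)), ∀ n, ‖T V x - g n x‖ ≤ K * ‖V - W n‖ := by
      rw [ae_all_iff]
      intro n
      have h1 := h (V - W n)
      rw [map_sub] at h1
      filter_upwards [h1, hWg n, Lp.coeFn_sub (T V) (T (W n))] with x h2 h3 h4
      rwa [h4, Pi.sub_apply, h3] at h2
    have h0 : Tendsto (fun n => K * ‖V - W n‖) atTop (𝓝 0) := by
      have := ((tendsto_const_nhds (x := V)).sub hlim).norm.const_mul K
      simpa using this
    filter_upwards [hae, ae_restrict_mem (measurableSet_cube R)] with x hx hxc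
    refine tendsto_nhds_unique ?_ (hG x (subset_closure hxc))
    have h2 := squeeze_zero_norm hx h0
    have h3 := (tendsto_const_nhds (x := T V x)).sub h2
    simpa using h3
  · have h1 := hG x (hS hx)
    simp only [hg0 _ x hx] at h1
    exact tendsto_nhds_unique h1 tendsto_const_nhds

theorem lowerFace_subset (hR : 0 < R) : lowerFace R ⊆ closure (cube R) := by
  intro x hx
  rw [closure_cube hR]
  intro i
  fin_cases i
  · exact hx.1.le
  · exact hx.2.1.le
  · change |x 2| ≤ R
    rw [hx.2.2, abs_neg, abs_of_pos hR]

/-- `H³₀` as a subspace. -/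
def H03sub (R : ℝ) (N : ℕ) : Submodule ℝ (H3 R N) where
  carrier := H03 R N
  zero_mem' := ⟨hasBoundaryValues_zero _, hasBoundaryValues_zero _⟩
  add_mem' := by
    intro V W hV hW
    have h1 := hV.1.add hW.1
    have h2 := hV.2.add hW.2
    rw [add_zero] at h1 h2
    exact ⟨h1, h2⟩
  smul_mem' := by
    intro c V hV
    have h1 := hV.1.smul c
    have h2 := hV.2.smul c
    rw [smul_zero] at h1 h2
    exact ⟨h1, h2⟩

theorem isClosed_H03 (hR : 0 < R) (N : ℕ) : IsClosed (H03 R N) := by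
  obtain ⟨K, -, hK⟩ := exists_bound_weakD hR N
  exact (isClosed_hasBoundaryValues (T := weakDL MIdx.none) (fun V => (hK V).1) _
    frontier_subset_closure).inter
    (isClosed_hasBoundaryValues (T := weakDL (MIdx.first 2)) (fun V => (hK V).2 2) _
    (lowerFace_subset hR))

theorem sub_mem_H03 {ψ₀ ψ₁ : E3 → CN N} {V W : H3 R N} (hV : V ∈ withBoundaryData R N ψ₀ ψ₁)
    (hW : W ∈ withBoundaryData R N ψ₀ ψ₁) : V - W ∈ H03 R N := by
  have h1 := hV.1.add (hW.1.smul (-1))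
  have h2 := hV.2.add (hW.2.smul (-1))
  rw [neg_one_smul, neg_one_smul, ← sub_eq_add_neg, ← sub_eq_add_neg, sub_self] at h1 h2
  exact ⟨h1, h2⟩

theorem convex_ballB (M : ℝ) (ψ₀ ψ₁ : E3 → CN N) : Convex ℝ (ballB R N M ψ₀ ψ₁) := by
  refine Convex.inter ?_ ?_
  · have : {V : H3 R N | ‖V‖ < M} = Metric.ball 0 M := by
      ext V
      simp
    rw [this]
    exact convex_ball 0 M
  · intro V hV W hW s t _ _ hst
    have h1 := (hV.1.smul s).add (hW.1.smul t)
    have h2 := (hV.2.smul s).add (hW.2.smul t)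
    rw [← add_smul, hst, one_smul] at h1 h2
    exact ⟨h1, h2⟩

theorem norm_le_of_mem_closure_ballB {M : ℝ} {ψ₀ ψ₁ : E3 → CN N} {V : H3 R N}
    (hV : V ∈ closure (ballB R N M ψ₀ ψ₁)) : ‖V‖ ≤ M :=
  closure_minimal (fun _ hW => (show ‖_‖ < M from hW.1).le)
    (isClosed_le continuous_norm continuous_const) hV

/-- Both points are compared with one element of the ball: differences within the ball have zero
data, and H³₀ is closed. Closedness of the inhomogeneous boundary conditions is not needed. -/
theorem sub_mem_H03_of_mem_closure (hR : 0 < R) {M : ℝ} {ψ₀ ψ₁ : E3 → CN N} {V W : H3 R N}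
    (hV : V ∈ closure (ballB R N M ψ₀ ψ₁)) (hW : W ∈ closure (ballB R N M ψ₀ ψ₁)) :
    V - W ∈ H03 R N := by
  obtain ⟨U, hU⟩ : (ballB R N M ψ₀ ψ₁).Nonempty := closure_nonempty_iff.1 ⟨V, hV⟩
  have key : ∀ X ∈ closure (ballB R N M ψ₀ ψ₁), X - U ∈ H03 R N :=
    closure_minimal (fun X hX => sub_mem_H03 hX.2 hU.2)
      ((isClosed_H03 hR N).preimage (continuous_id.sub continuous_const))
  have := (H03sub R N).sub_mem (key V hV) (key W hW)
  rwa [sub_sub_sub_cancel_right] at this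

theorem exists_riesz_of_isClosed {E : Type*} [NormedAddCommGroup E] [InnerProductSpace ℝ E]
    [CompleteSpace E] (S : Submodule ℝ E) (hS : IsClosed (S : Set E)) (f : E →L[ℝ] ℝ) :
    ∃ G ∈ S, ∀ h ∈ S, inner ℝ G h = f h := by
  have : CompleteSpace S := hS.completeSpace_coe
  refine ⟨(InnerProductSpace.toDual ℝ S).symm (f.comp S.subtypeL), Submodule.coe_mem _, fun h hh => ?_⟩
  exact InnerProductSpace.toDual_symm_apply (𝕜 := ℝ) (x := (⟨h, hh⟩ : S)) (y := f.comp S.subtypeL)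

/-- The Riesz representation of the derivative on `H³₀`. -/
theorem exists_isGradientAt (hR : 0 < R) {J : H3 R N → ℝ} {V : H3 R N}
    (hJ : DifferentiableAt ℝ J V) : ∃ G, IsGradientAt J V G := by
  obtain ⟨G, hG, h⟩ := exists_riesz_of_isClosed (H03sub R N) (isClosed_H03 hR N) (fderiv ℝ J V)
  exact ⟨G, hJ, hG, h⟩

theorem normSqH2_nonneg (V : H3 R N) : 0 ≤ normSqH2 V :=
  Finset.sum_nonneg fun β _ => by split_ifs <;> positivity

end

end Convexification

/-! ### Proof of the theorem -/

open Convexification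
theorem theorem5p3 (R r a d k M : ℝ) (N : ℕ) (hR : 0 < R) (hr : R < r) (ha : 0 < a)
    (hd : R < d) (hk : 0 < k) (hN : 1 ≤ N) (hM : 0 < M) :
    ∃ lam₂ : ℝ, 1 < lam₂ ∧ ∀ lam : ℝ, lam₂ ≤ lam →
      -- `lam₂` is a threshold for the strict convexity of the functional
      (∃ C : ℝ, 0 < C ∧ ∀ (ψ₀ ψ₁ : E3 → CN N) (γ : ℝ), 0 < γ →
        ∀ V₁ ∈ closure (ballB R N M ψ₀ ψ₁), ∃ G : H3 R N,
          IsGradientAt (functionalJ r a d k lam γ) V₁ G ∧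
          ∀ V₂ ∈ closure (ballB R N M ψ₀ ψ₁),
            C * normSqH2 (V₂ - V₁) + γ * ‖V₂ - V₁‖ ^ 2
              ≤ functionalJ r a d k lam γ V₂ - functionalJ r a d k lam γ V₁
                - inner ℝ G (V₂ - V₁)) ∧
      -- the unique minimizer and the variational inequality
      (∀ (ψ₀ ψ₁ : E3 → CN N), (ballB R N M ψ₀ ψ₁).Nonempty → ∀ γ : ℝ, 0 < γ →
        (∃! V : H3 R N, V ∈ closure (ballB R N M ψ₀ ψ₁) ∧
          IsMinOn (functionalJ r a d k lam γ) (closure (ballB R N M ψ₀ ψ₁)) V) ∧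
        ∀ V ∈ closure (ballB R N M ψ₀ ψ₁),
          IsMinOn (functionalJ r a d k lam γ) (closure (ballB R N M ψ₀ ψ₁)) V →
          ∃ G : H3 R N, IsGradientAt (functionalJ r a d k lam γ) V G ∧
            ∀ Q ∈ closure (ballB R N M ψ₀ ψ₁), inner ℝ G (V - Q) ≤ 0) := by
  obtain ⟨lam₂, hlam₂, hco⟩ := exists_coercive (k := k) ha hR hd hr hM N
  refine ⟨lam₂, hlam₂, fun lam hlam => ?_⟩
  have h0 : 0 < lam := by linarith
  obtain ⟨C, hC, hco⟩ := hco lam hlam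
  obtain ⟨T, Q, hT, hQ⟩ := exists_operator (k := k) ha hR hd N hr h0
  have hJeq : ∀ γ : ℝ, (functionalJ r a d k lam γ : H3 R N → ℝ)
      = fun V => ‖T V + Q V V‖ ^ 2 + γ * ‖V‖ ^ 2 :=
    fun γ => funext fun V => functionalJ_eq ha hR hd hT hQ V
  have hder : ∀ (γ : ℝ) (V : H3 R N), HasFDerivAt (functionalJ r a d k lam γ)
      (2 • (innerSL ℝ (T V + Q V V)).comp (T + (Q V + Q.flip V)) + γ • (2 • innerSL ℝ V)) V := by
    intro γ V
    rw [hJeq]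
    exact hasFDerivAt_quadratic T Q γ V
  have hgrad : ∀ (ψ₀ ψ₁ : E3 → CN N) (γ : ℝ),
      ∀ V₁ ∈ closure (ballB R N M ψ₀ ψ₁), ∃ G : H3 R N,
        IsGradientAt (functionalJ r a d k lam γ) V₁ G ∧
        ∀ V₂ ∈ closure (ballB R N M ψ₀ ψ₁),
          C * normSqH2 (V₂ - V₁) + γ * ‖V₂ - V₁‖ ^ 2
            ≤ functionalJ r a d k lam γ V₂ - functionalJ r a d k lam γ V₁
              - inner ℝ G (V₂ - V₁) := by
    intro ψ₀ ψ₁ γ V₁ hV₁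
    -- G represents the derivative on H³₀ only. This is enough, since it is paired exclusively with
    -- differences of points of the closed ball, which lie in H³₀.
    obtain ⟨G, hG⟩ := exists_isGradientAt hR (hder γ V₁).differentiableAt
    refine ⟨G, hG, fun V₂ hV₂ => ?_⟩
    have hh := sub_mem_H03_of_mem_closure hR hV₂ hV₁
    have hn1 := norm_le_of_mem_closure_ballB hV₁
    have hn2 := norm_le_of_mem_closure_ballB hV₂
    have hnh : ‖V₂ - V₁‖ ≤ 2 * M := (norm_sub_le _ _).trans (by linarith)
    have hc := hco T Q hT hQ V₁ (V₂ - V₁) hn1 hnh hh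
    have hq := quadratic_diff T Q γ V₁ (V₂ - V₁)
    rw [add_sub_cancel] at hq
    rw [hG.2.2 _ hh, (hder γ V₁).fderiv, hJeq, hq]
    linarith
  refine ⟨⟨C, hC, fun ψ₀ ψ₁ γ _ => hgrad ψ₀ ψ₁ γ⟩, fun ψ₀ ψ₁ hne γ hγ => ⟨?_, ?_⟩⟩
  -- Here only the term γ‖V₂ - V₁‖² of the convexity inequality is used: it is the one that controls
  -- the full H³ norm, in which the set is closed.
  · refine existsUnique_isMinOn_of_strongly_convex isClosed_closure (convex_ballB M ψ₀ ψ₁).closure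
      hne.closure (fun V => ?_) (continuous_iff_continuousAt.2 fun V => (hder γ V).continuousAt)
      hγ fun V hV => ?_
    · rw [hJeq]
      positivity
    · obtain ⟨G, -, hG⟩ := hgrad ψ₀ ψ₁ γ V hV
      refine ⟨G, fun W hW => le_trans ?_ (hG W hW)⟩
      have := mul_nonneg hC.le (normSqH2_nonneg (W - V))
      linarith
  · intro V hV hmin
    obtain ⟨G, hG, -⟩ := hgrad ψ₀ ψ₁ γ V hV
    refine ⟨G, hG, fun W hW => ?_⟩
    -- At a minimum over a convex set the derivative is nonnegative towards every other point W.
    -- Reversing the direction W - V gives the stated sign.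
    have h1 := fderiv_nonneg_of_isMinOn_convex (convex_ballB M ψ₀ ψ₁).closure hV hW hmin hG.1
    rw [← hG.2.2 _ (sub_mem_H03_of_mem_closure hR hW hV), ← neg_sub, inner_neg_right] at h1
    linarith
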